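/- **Setting (latent Dirichlet allocation).** Let $1\le k\le d$, let $\alpha\in\mathbb R^k$ have strictly positive entries, $\alpha_0=\sum_i\alpha_i$, and let $O\in\mathbb R^{d\times k}$ be a matrix of rank $k$ whose columns $O_1,\dots,O_k$ are probability vectors on $d$ words. A sample (document) is a triple of words $x_1,x_2,x_3$, encoded as standard basis vectors of $\mathbb R^d$: draw $h$ from the Dirichlet distribution with parameter $\alpha$, and then, for each $v\in\{1,2,3\}$ independently given $h$, draw a topic $i$ with probability $h_i$ and a word $x_v$ from the distribution $O_i$. Let $p_{\min}=\min_i\alpha_i/\alpha_0$ and let $\sigma_k(O)$ be the smallest singular value of $O$. **Algorithm (empirical ECA).** From $N$ samples form the empirical averages $\hat\mu=\hat{\mathbb E}[x_1]$, $\hat C=\hat{\mathbb E}[x_1x_2^\top]$, $\hat{\mathbb E}[x_1x_2^\top\langle\eta,x_3\rangle]$, and $$\hat P=\hat C-\tfrac{\alpha_0}{\alpha_0+1}\hat\mu\hat\mu^\top,$$ $$\hat T(\eta)=\hat{\mathbb E}[x_1x_2^\top\langle\eta,x_3\rangle]-\tfrac{\alpha_0}{\alpha_0+2}\bigl(\hat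 C\eta\hat\mu^\top+\hat\mu\eta^\top\hat C+\langle\eta,\hat\mu\rangle\hat C\bigr)+\tfrac{2\alpha_0^2}{(\alpha_0+2)(\alpha_0+1)}\langle\eta,\hat\mu\rangle\hat\mu\hat\mu^\top .$$ Let $\hat W=A\Sigma^{-1/2}\in\mathbb R^{d\times k}$, where the columns of $A$ are orthonormal left singular vectors of $\hat P$ for its $k$ largest singular values and $\Sigma$ is the diagonal matrix of these values. Given $\theta\in\mathbb R^k$, let $\hat v_1,\dots,\hat v_k$ be an orthonormal basis of left singular vectors of $\hat W^\top\hat T(\hat W\theta)\hat W$. Return $$\hat O_i=\frac1{\hat Z_i}(\hat W^+)^\top\hat v_i,\qquad \hat Z_i=\frac{2}{(\alpha_0+2)\,(\hat W\hat v_i)^\top\hat T(\hat W\hat v_i)\hat W\hat v_i},\qquad \hat W^+=(\hat W^\top\hat W)^{-1}\hat W^\top$$ (so $1/\hat Z_i$ means $\frac{\alpha_0+2}{2}(\hat W\hat v_i)^\top\hat T(\hat W\hat v_i)\hat W\hat v_i$). **Theorem (Sample complexity for LDA).** There is a universal constant $c>0$ such that the following holds in this setting. Let $\delta\in(0,1)$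 and suppose that we obtain $$N\ge\left(\frac{(\alpha_0+1)\bigl(6+6\sqrt{\ln(3/\delta)}\bigr)}{p_{\min}\,\sigma_k(O)^2}\right)^2$$ independent samples of $x_1,x_2,x_3$. With probability greater than $1-\delta$ over the samples, for every admissible choice of $\hat W$: $\hat W$ has rank $k$, and for $\theta$ drawn uniformly from the unit sphere of $\mathbb R^k$, with probability greater than $3/4$, for every admissible choice of $\hat v_1,\dots,\hat v_k$ there is a permutation $\tau$ of $\{1,\dots,k\}$ such that for all $i$ $$\|O_i-\hat O_{\tau(i)}\|_2\le c\,\frac{(\alpha_0+1)^2k^3}{p_{\min}^2\,\sigma_k(O)^3}\cdot\frac{1+\sqrt{\ln(1/\delta)}}{\sqrt N}.$$ -/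

import Mathlib

open MeasureTheory ProbabilityTheory
open scoped Matrix

noncomputable section

namespace LDA

/-! ### The Dirichlet distribution -/

/-- The point of the probability simplex in `ℝ^(m+1)` whose last `m` coordinates are `x`. -/
def simplexPoint {m : ℕ} (x : Fin m → ℝ) : Fin (m + 1) → ℝ :=
  Fin.cons (1 - ∑ i, x i) x

/-- The Dirichlet density
`Γ(α₀) / ∏ Γ(αᵢ) * ∏ hᵢ ^ (αᵢ - 1)` at a point `h` of the simplex. -/
def dirichletDensity {k : ℕ} (α : Fin k → ℝ) (h : Fin k → ℝ) : ℝ :=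
  Real.Gamma (∑ i, α i) / (∏ i, Real.Gamma (α i)) * ∏ i, h i ^ (α i - 1)

/-- The Dirichlet distribution with parameter `α`, as a measure on `ℝ^k`. The simplex is
parametrized by all coordinates but one, with Lebesgue measure on these, as usual; there is no
Dirichlet distribution for `k = 0`. -/
def dirichlet : {k : ℕ} → (Fin k → ℝ) → Measure (Fin k → ℝ)
  | 0, _ => 0
  | m + 1, α =>
    (((volume : Measure (Fin m → ℝ)).restrict {x | (∀ i, 0 < x i) ∧ ∑ i, x i < 1}).withDensity
      fun x => ENNReal.ofReal (dirichletDensity α (simplexPoint x))).map simplexPoint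

/-! ### Latent Dirichlet allocation -/

/-- `O` is a topic matrix: each column is a probability distribution over the `d` words. -/
structure IsTopicMatrix {d k : ℕ} (O : Matrix (Fin d) (Fin k) ℝ) : Prop where
  nonneg : ∀ j i, 0 ≤ O j i
  sum_col : ∀ i, ∑ j, O j i = 1

/-- The joint law of the three words `x₁, x₂, x₃` of a document. Draw `h` from the Dirichlet
distribution; given `h`, the words are independent, and each is `j` with probability
`∑ i, hᵢ * O j i` (draw a topic `i` from `h`, then a word from the `i`-th column of `O`). -/
def documentLaw {d k : ℕ} (α : Fin k → ℝ) (O : Matrix (Fin d) (Fin k) ℝ) :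
    Measure (Fin 3 → Fin d) :=
  ∑ w : Fin 3 → Fin d,
    (∫⁻ h, ∏ v, ENNReal.ofReal (∑ i, h i * O (w v) i) ∂(dirichlet α)) • Measure.dirac w

/-- `p_min = minᵢ αᵢ / α₀`. -/
def pMin {k : ℕ} (α : Fin k → ℝ) : ℝ :=
  ⨅ i, α i / ∑ j, α j

/-- `σ_k(O)`, the smallest (the `k`-th) singular value of a matrix with `k` columns.
Mathlib numbers singular values from `0`, in decreasing order. -/
def sigmaMin {d k : ℕ} (O : Matrix (Fin d) (Fin k) ℝ) : ℝ :=
  (Matrix.toEuclideanLin O).singularValues (k - 1)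

/-! ### Empirical moments

`w n v` is the `v`-th word of the `n`-th document. -/

/-- The encoding of the word `j` as a standard basis vector. -/
def hot {d : ℕ} (j : Fin d) : Fin d → ℝ := Pi.single j 1

/-- Empirical average of `x₁`. -/
def empMean {N d : ℕ} (w : Fin N → Fin 3 → Fin d) : Fin d → ℝ :=
  (N : ℝ)⁻¹ • ∑ n, hot (w n 0)

/-- Empirical average of `x₁ x₂ᵀ`. -/
def empSecond {N d : ℕ} (w : Fin N → Fin 3 → Fin d) : Matrix (Fin d) (Fin d) ℝ :=
  (N : ℝ)⁻¹ • ∑ n, Matrix.vecMulVec (hot (w n 0)) (hot (w n 1))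

/-- Empirical average of `x₁ x₂ᵀ ⟨η, x₃⟩`. -/
def empThird {N d : ℕ} (w : Fin N → Fin 3 → Fin d) (η : Fin d → ℝ) :
    Matrix (Fin d) (Fin d) ℝ :=
  (N : ℝ)⁻¹ • ∑ n, (η ⬝ᵥ hot (w n 2)) • Matrix.vecMulVec (hot (w n 0)) (hot (w n 1))

/-- The modified empirical second moment. -/
def empPairs {N d : ℕ} (α₀ : ℝ) (w : Fin N → Fin 3 → Fin d) : Matrix (Fin d) (Fin d) ℝ :=
  empSecond w - (α₀ / (α₀ + 1)) • Matrix.vecMulVec (empMean w) (empMean w)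

/-- The modified empirical third moment, contracted with `η`. -/
def empTriples {N d : ℕ} (α₀ : ℝ) (w : Fin N → Fin 3 → Fin d) (η : Fin d → ℝ) :
    Matrix (Fin d) (Fin d) ℝ :=
  empThird w η
    - (α₀ / (α₀ + 2)) •
      (Matrix.vecMulVec (empSecond w *ᵥ η) (empMean w)
        + Matrix.vecMulVec (empMean w) (η ᵥ* empSecond w)
        + (η ⬝ᵥ empMean w) • empSecond w)
    + (2 * α₀ ^ 2 / ((α₀ + 2) * (α₀ + 1))) •
      ((η ⬝ᵥ empMean w) • Matrix.vecMulVec (empMean w) (empMean w))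

/-! ### Empirical excess correlation analysis -/

/-- `M = U diag(s) Vᵀ` is a singular value decomposition of the square matrix `M`, with the
singular values in decreasing order. The columns of `U` are left singular vectors. -/
structure IsSVD {n : ℕ} (M U : Matrix (Fin n) (Fin n) ℝ) (s : Fin n → ℝ)
    (V : Matrix (Fin n) (Fin n) ℝ) : Prop where
  left_orthogonal : U ∈ Matrix.orthogonalGroup (Fin n) ℝ
  right_orthogonal : V ∈ Matrix.orthogonalGroup (Fin n) ℝ
  nonneg : ∀ i, 0 ≤ s i
  antitone : Antitone s
  eq : M = U * Matrix.diagonal s * Vᵀ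

/-- Whitening step: `W = A Σ^(-1/2)` where the columns of `A` are orthonormal left singular vectors
of `P` for its `k` largest singular values and `Σ` is the diagonal matrix of these values. An SVD
is not unique; `IsWhitening hkd P W` says that `W` arises from some choice of it. -/
def IsWhitening {d k : ℕ} (hkd : k ≤ d) (P : Matrix (Fin d) (Fin d) ℝ)
    (W : Matrix (Fin d) (Fin k) ℝ) : Prop :=
  ∃ U s V, IsSVD P U s V ∧
    W = U.submatrix id (Fin.castLE hkd) *
      Matrix.diagonal fun i => (Real.sqrt (s (Fin.castLE hkd i)))⁻¹

/-- SVD step: `v` is a (complete, orthonormal) family of left singular vectors of `M`. -/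
def IsLeftSingularFamily {k : ℕ} (M : Matrix (Fin k) (Fin k) ℝ) (v : Fin k → Fin k → ℝ) : Prop :=
  ∃ U s V, IsSVD M U s V ∧ ∀ i, v i = U.col i

/-- The pseudo-inverse `A⁺ = (AᵀA)⁻¹Aᵀ` of a matrix with linearly independent columns. -/
def pinv {d k : ℕ} (A : Matrix (Fin d) (Fin k) ℝ) : Matrix (Fin k) (Fin d) ℝ :=
  (Aᵀ * A)⁻¹ * Aᵀ

/-- The scale `Ẑ = 2 / ((α₀ + 2) (W v)ᵀ T(W v) (W v))`. -/
def scale {d k : ℕ} (α₀ : ℝ) (T : (Fin d → ℝ) → Matrix (Fin d) (Fin d) ℝ)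
    (W : Matrix (Fin d) (Fin k) ℝ) (v : Fin k → ℝ) : ℝ :=
  2 / ((α₀ + 2) * ((W *ᵥ v) ⬝ᵥ (T (W *ᵥ v) *ᵥ (W *ᵥ v))))

/-- Reconstruction step: `Ô = (1 / Ẑ) (W⁺)ᵀ v`. If the cubic form in `Ẑ` vanishes this reads `0`,
in agreement with `1 / Ẑ = (α₀ + 2) (W v)ᵀ T(W v) (W v) / 2`. -/
def reconstruct {d k : ℕ} (α₀ : ℝ) (T : (Fin d → ℝ) → Matrix (Fin d) (Fin d) ℝ)
    (W : Matrix (Fin d) (Fin k) ℝ) (v : Fin k → ℝ) : Fin d → ℝ :=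
  (scale α₀ T W v)⁻¹ • ((pinv W)ᵀ *ᵥ v)

/-- The uniform probability distribution on the unit sphere of `ℝ^k` (for `k ≥ 1`). -/
def sphereUniform (k : ℕ) : Measure (Metric.sphere (0 : EuclideanSpace ℝ (Fin k)) 1) :=
  ((volume : Measure (EuclideanSpace ℝ (Fin k))).toSphere Set.univ)⁻¹ •
    (volume : Measure (EuclideanSpace ℝ (Fin k))).toSphere

/-- Success of the empirical algorithm on the data `w`, with accuracy `ε`. Whichever singular
vectors of the empirical second moment are used for whitening, the whitening matrix `W` has full
rank, and for `θ` uniform on the sphere, with probability greater than `3/4`, whichever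
left singular vectors are used in the second SVD, the outputs match the columns of `O` up to a
permutation and up to `ℓ₂` error `ε`. The whitening is chosen before `θ` is drawn. -/
def ECASucceeds {N d k : ℕ} (hkd : k ≤ d) (α₀ : ℝ) (O : Matrix (Fin d) (Fin k) ℝ) (ε : ℝ)
    (w : Fin N → Fin 3 → Fin d) : Prop :=
  ∀ W : Matrix (Fin d) (Fin k) ℝ, IsWhitening hkd (empPairs α₀ w) W →
    W.rank = k ∧
    3 / 4 < (sphereUniform k).real
      {θ | ∀ v : Fin k → Fin k → ℝ,
        IsLeftSingularFamily (Wᵀ * empTriples α₀ w (W *ᵥ (θ.1 : Fin k → ℝ)) * W) v →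
        ∃ τ : Equiv.Perm (Fin k), ∀ i,
          ‖WithLp.toLp 2 (O.col i - reconstruct α₀ (empTriples α₀ w) W (v (τ i)))‖ ≤ ε}

end LDA

end

open MeasureTheory ProbabilityTheory
open scoped Matrix

noncomputable section

namespace LDA

/-! Write `D i = α i / (α₀ (α₀ + 1))`. The Dirichlet moments are explicit, and the corrections in
the modified moments cancel every term with distinct topics: in expectation the second moment is `O
diag(D) Oᵀ`, and the third one, contracted with `η`, is `O diag(2 / (α₀ + 2) * D i * ⟨O_i, η⟩) Oᵀ`.
The rest is perturbation theory.

Sampling. The raw empirical moments are frequency vectors, that is, averages of independent one-hot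
vectors. McDiarmid's inequality puts each within `E = O((1 + √ln(3/δ)) / √N)` of its mean in
Euclidean norm, whatever the number of words (`tail_freq`, `three_freq_close`). The modified moments
then err by at most `3 E` and `13 E` (`modified_moment_errors`).

Whitening (`whitening_bounds`). With `B = Wᵀ O diag(√D)`, exact moments would make `B` orthogonal;
here `B Bᵀ - 1` has norm `O(E / (D_min σ²))`. The empirical second moment need not be symmetric, so
`W` whitens exactly not that matrix but its left modulus `U diag(s) Uᵀ`; `left_modulus_frobenius`
shows that this is almost as close to the population moment.

Random direction. The whitened third moment is `B diag(μ) Bᵀ` plus noise, with `μ j = λ j (Bᵀ θ) j`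
and `λ j = 2 / ((α₀ + 2) √(D j))`. Anti-concentration on the sphere, with a union bound over the
sums and differences of the `μ j`, separates all `|μ j|` by a multiple of `1 / k³`
(`sphereUniform_gap`). The left singular vectors are then close to the columns of `B` up to order
and sign (`left_singular_vectors_close`).

Reconstruction. The cubic form at `v ≈ ± B_i` is about `± λ i`, so its product with `v` does not see
the sign and is about `λ i B_i`, a known multiple of `Wᵀ O_i`. The pseudo-inverse then returns the
projection of `O_i` to the leading singular subspace, which is close to `O_i`
(`whitened_topic_error`, `reconstruct_error`).

The assumed sample size bounds `B` but need not make its perturbation small. If it does not, the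
claimed error is so large that any unit vectors satisfy it; hence the case distinction in
`accuracy_of_moment_errors`. -/

section Sphere

open scoped Pointwise

/-! ### Anti-concentration on the sphere -/

/-- A slab of half-width `1 / (4 k n)` takes up at most the fraction `2 / n` of the unit ball in
dimension `k`: `n` disjoint translates of a slightly shrunk copy of the slab fit into the ball. -/
lemma volume_slab_le {k : ℕ} (hk : 0 < k) (u : EuclideanSpace ℝ (Fin k)) (hu : ‖u‖ = 1)
    (n : ℕ) (hn : 0 < n) :
    volume.real {x : EuclideanSpace ℝ (Fin k) | ‖x‖ < 1 ∧ |inner ℝ u x| < 1 / (4 * k * n)} ≤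
      2 / n * volume.real (Metric.ball (0 : EuclideanSpace ℝ (Fin k)) 1) := by
  set t : ℝ := 1 / (4 * k * n) with ht
  set S := {x : EuclideanSpace ℝ (Fin k) | ‖x‖ < 1 ∧ |inner ℝ u x| < t} with hS
  have hk' : (1 : ℝ) ≤ k := by exact_mod_cast hk
  have hn' : (1 : ℝ) ≤ n := by exact_mod_cast hn
  have htpos : 0 < t := by positivity
  -- The `n` translates move by less than `2 * n * t = 1 / (2 * k)`, so shrinking by `r` keeps them
  -- inside the ball. By Bernoulli's inequality the shrinking costs at most half of the volume,
  -- because `r ^ k ≥ 1 / 2`.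
  set r : ℝ := 1 - 1 / (2 * k) with hr
  have hkinv : 1 / (2 * (k : ℝ)) ≤ 1 / 2 := by
    apply one_div_le_one_div_of_le <;> linarith
  have hkinv0 : 0 < 1 / (2 * (k : ℝ)) := by positivity
  have hr0 : 0 < r := by linarith
  have hr1 : r < 1 := by linarith
  have hmS : MeasurableSet S := by
    have h : IsOpen {x : EuclideanSpace ℝ (Fin k) | |inner ℝ u x| < t} :=
      isOpen_lt (by fun_prop) continuous_const
    exact ((isOpen_lt continuous_norm continuous_const).inter h).measurableSet
  set f : ℕ → Set (EuclideanSpace ℝ (Fin k)) :=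
    fun j => (fun x => (2 * j * t) • u + x) '' (r • S) with hf
  have hmeas : ∀ j, MeasurableSet (f j) := by
    intro j
    exact ((Homeomorph.addLeft ((2 * j * t) • u)).measurableEmbedding.measurableSet_image).2
      (hmS.const_smul₀ r)
  have hvol : ∀ j, volume.real (f j) = r ^ k * volume.real S := by
    intro j
    simp only [hf, Set.image_add_left, Measure.real, measure_preimage_add,
      Measure.addHaar_smul, finrank_euclideanSpace, Fintype.card_fin]
    rw [ENNReal.toReal_mul, ENNReal.toReal_ofReal (by positivity), abs_of_nonneg (by positivity)]
  have hbetween : ∀ j, ∀ y ∈ f j, |inner ℝ u y - 2 * j * t| < t := by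
    rintro j y ⟨z, ⟨x, hx, rfl⟩, rfl⟩
    have : inner ℝ u ((2 * j * t) • u + r • x) - 2 * j * t = r * inner ℝ u x := by
      rw [inner_add_right, inner_smul_right, inner_smul_right, real_inner_self_eq_norm_sq, hu]
      ring
    simp only [this]
    rw [abs_mul, abs_of_pos hr0]
    have := hx.2
    nlinarith [abs_nonneg (inner ℝ u x)]
  have hdisj : Set.PairwiseDisjoint (↑(Finset.range n)) f := by
    intro i _ j _ hij
    refine Set.disjoint_left.2 fun y hyi hyj => ?_
    have h1 := abs_lt.1 (hbetween i y hyi)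
    have h2 := abs_lt.1 (hbetween j y hyj)
    rcases lt_or_gt_of_ne hij with h | h
    · have : (i : ℝ) + 1 ≤ j := by exact_mod_cast h
      nlinarith
    · have : (j : ℝ) + 1 ≤ i := by exact_mod_cast h
      nlinarith
  have hsub : (⋃ j ∈ Finset.range n, f j) ⊆ Metric.ball 0 1 := by
    intro y hy
    simp only [Set.mem_iUnion, Finset.mem_range] at hy
    obtain ⟨j, hj, z, ⟨x, hx, rfl⟩, rfl⟩ := hy
    rw [mem_ball_zero_iff]
    have hj' : (j : ℝ) + 1 ≤ n := by exact_mod_cast hj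
    have h1 : ‖(2 * j * t) • u‖ = 2 * j * t := by
      rw [norm_smul, hu, mul_one, Real.norm_of_nonneg (by positivity)]
    have h2 : ‖r • x‖ < r := by
      rw [norm_smul, Real.norm_of_nonneg hr0.le]
      have := hx.1
      nlinarith
    have h3 : 2 * j * t ≤ 1 / (2 * k) := by
      have : 2 * (n : ℝ) * t = 1 / (2 * k) := by rw [ht]; field_simp; norm_num
      rw [← this]
      gcongr
    calc ‖(2 * j * t) • u + r • x‖ ≤ ‖(2 * j * t) • u‖ + ‖r • x‖ := norm_add_le _ _
      _ < 1 / (2 * k) + r := by rw [h1]; linarith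
      _ = 1 := by rw [hr]; ring
  have hsum : (n : ℝ) * (r ^ k * volume.real S) ≤
      volume.real (Metric.ball (0 : EuclideanSpace ℝ (Fin k)) 1) := by
    have hle := measureReal_mono (μ := volume) hsub
      (measure_ball_lt_top (μ := volume) (x := (0 : EuclideanSpace ℝ (Fin k))) (r := 1)).ne
    have hfin : ∀ j ∈ Finset.range n, volume (f j) ≠ ⊤ := by
      intro j hj
      refine ne_top_of_le_ne_top
        (measure_ball_lt_top (μ := volume) (x := (0 : EuclideanSpace ℝ (Fin k))) (r := 1)).ne
        (measure_mono (Set.Subset.trans ?_ hsub))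
      exact Set.subset_biUnion_of_mem (u := f) hj
    rw [measureReal_biUnion_finset hdisj (fun j _ => hmeas j) hfin] at hle
    simpa [hvol] using hle
  have hbern : 1 / 2 ≤ r ^ k := by
    have := one_add_mul_le_pow (a := -(1 / (2 * (k : ℝ)))) (by linarith) k
    have h2 : 1 + (k : ℝ) * -(1 / (2 * k)) = 1 / 2 := by field_simp; norm_num
    rw [h2] at this
    rwa [hr, sub_eq_add_neg]
  rw [div_mul_eq_mul_div, le_div_iff₀ (by linarith)]
  have hV : 0 ≤ volume.real S := measureReal_nonneg
  nlinarith [mul_le_mul_of_nonneg_right hbern (mul_nonneg (by linarith : (0:ℝ) ≤ n) hV)]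

instance sphereUniform_isProbabilityMeasure {k : ℕ} [NeZero k] :
    IsProbabilityMeasure (sphereUniform k) := by
  constructor
  rw [sphereUniform, Measure.smul_apply, smul_eq_mul]
  apply ENNReal.inv_mul_cancel
  · rw [Ne, Measure.measure_univ_eq_zero]
    exact Measure.toSphere_ne_zero _
  · exact measure_ne_top _ _

/-- A uniform point of the sphere is rarely almost orthogonal to a given vector. -/
lemma sphereUniform_inner_small {k : ℕ} (hk : 0 < k) (u : EuclideanSpace ℝ (Fin k)) (hu : u ≠ 0) :
    (sphereUniform k).real {θ | |inner ℝ u (θ : EuclideanSpace ℝ (Fin k))| < ‖u‖ / (32 * k ^ 3)} ≤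
      1 / (4 * k ^ 2) := by
  have hk' : (1 : ℝ) ≤ k := by exact_mod_cast hk
  set s : Set (Metric.sphere (0 : EuclideanSpace ℝ (Fin k)) 1) :=
    {θ | |inner ℝ u (θ : EuclideanSpace ℝ (Fin k))| < ‖u‖ / (32 * k ^ 3)} with hs
  have hms : MeasurableSet s :=
    (isOpen_lt (by fun_prop) continuous_const).measurableSet
  have hunorm : 0 < ‖u‖ := norm_pos_iff.2 hu
  set u' := ‖u‖⁻¹ • u with hu'
  have hu'1 : ‖u'‖ = 1 := by
    rw [hu', norm_smul, norm_inv, norm_norm, inv_mul_cancel₀ hunorm.ne']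
  -- `n = 8 * k ^ 2` gives half-width `1 / (32 * k ^ 3)` and volume fraction `1 / (4 * k ^ 2)`.
  have hslab := volume_slab_le hk u' hu'1 (8 * k ^ 2) (by positivity)
  -- The spherical measure of `s` is proportional to the volume of the cone over `s`, so it suffices
  -- to place this cone in the slab.
  have hsub : Set.Ioo (0 : ℝ) 1 • ((↑) '' s : Set (EuclideanSpace ℝ (Fin k))) ⊆
      {x | ‖x‖ < 1 ∧ |inner ℝ u' x| < 1 / (4 * k * (8 * k ^ 2 : ℕ))} := by
    rintro _ ⟨a, ha, _, ⟨θ, hθ, rfl⟩, rfl⟩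
    have hθ1 : ‖(θ : EuclideanSpace ℝ (Fin k))‖ = 1 := by simp
    simp only [Set.mem_ofPred_eq]
    refine ⟨?_, ?_⟩
    · rw [norm_smul, hθ1, mul_one, Real.norm_of_nonneg ha.1.le]; exact ha.2
    · rw [inner_smul_right, hu', inner_smul_left, abs_mul, abs_mul, abs_of_pos ha.1]
      simp only [conj_trivial, abs_inv, abs_norm]
      have h1 : |inner ℝ u (θ : EuclideanSpace ℝ (Fin k))| < ‖u‖ / (32 * k ^ 3) := hθ
      have h2 : ‖u‖⁻¹ * |inner ℝ u (θ : EuclideanSpace ℝ (Fin k))| < 1 / (32 * k ^ 3) := by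
        rw [inv_mul_lt_iff₀ hunorm]
        calc _ < _ := h1
          _ = _ := by ring
      have h3 : (1 : ℝ) / (4 * k * (8 * k ^ 2 : ℕ)) = 1 / (32 * k ^ 3) := by
        push_cast; ring_nf
      rw [h3]
      refine lt_of_le_of_lt ?_ h2
      have : 0 ≤ ‖u‖⁻¹ * |inner ℝ u (θ : EuclideanSpace ℝ (Fin k))| := by positivity
      nlinarith [ha.2, ha.1]
  have hball : 0 < volume.real (Metric.ball (0 : EuclideanSpace ℝ (Fin k)) 1) :=
    ENNReal.toReal_pos (Metric.measure_ball_pos volume _ one_pos).ne' measure_ball_lt_top.ne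
  have hmono : volume.real (Set.Ioo (0 : ℝ) 1 • ((↑) '' s : Set (EuclideanSpace ℝ (Fin k)))) ≤
      2 / (8 * k ^ 2 : ℕ) * volume.real (Metric.ball (0 : EuclideanSpace ℝ (Fin k)) 1) := by
    refine le_trans (measureReal_mono hsub ?_) hslab
    exact ne_top_of_le_ne_top
      (measure_ball_lt_top (μ := volume) (x := (0 : EuclideanSpace ℝ (Fin k))) (r := 1)).ne
      (measure_mono fun x hx => by simpa using hx.1)
  have hval : (sphereUniform k).real s =
      volume.real (Set.Ioo (0 : ℝ) 1 • ((↑) '' s : Set (EuclideanSpace ℝ (Fin k)))) /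
        volume.real (Metric.ball (0 : EuclideanSpace ℝ (Fin k)) 1) := by
    rw [sphereUniform, Measure.real, Measure.smul_apply, smul_eq_mul, Measure.toSphere_apply' _ hms,
      Measure.toSphere_apply_univ]
    simp only [ENNReal.toReal_mul, ENNReal.toReal_inv, Measure.real, finrank_euclideanSpace,
      Fintype.card_fin, ENNReal.toReal_natCast]
    have : (k : ℝ) ≠ 0 := by linarith
    field_simp
  rw [hval, div_le_iff₀ hball]
  refine hmono.trans (le_of_eq ?_)
  push_cast
  ring

/-- With probability more than `3 / 4`, a uniform point of the sphere is far from orthogonal to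
each of fewer than `k ^ 2` given vectors. -/
lemma sphereUniform_forall_inner_large {k : ℕ} (hk : 0 < k) {ι : Type*} (s : Finset ι)
    (hs : s.card < k ^ 2) (u : ι → EuclideanSpace ℝ (Fin k)) (hu : ∀ i ∈ s, u i ≠ 0) :
    3 / 4 < (sphereUniform k).real
      {θ | ∀ i ∈ s, ‖u i‖ / (32 * k ^ 3) ≤ |inner ℝ (u i) (θ : EuclideanSpace ℝ (Fin k))|} := by
  have : NeZero k := ⟨hk.ne'⟩
  have hk' : (1 : ℝ) ≤ k := by exact_mod_cast hk
  set B := ⋃ i ∈ s, {θ : Metric.sphere (0 : EuclideanSpace ℝ (Fin k)) 1 |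
    |inner ℝ (u i) (θ : EuclideanSpace ℝ (Fin k))| < ‖u i‖ / (32 * k ^ 3)} with hB
  have hmB : MeasurableSet B :=
    Finset.measurableSet_biUnion _ fun i _ =>
      (isOpen_lt (by fun_prop) continuous_const).measurableSet
  have heq : {θ : Metric.sphere (0 : EuclideanSpace ℝ (Fin k)) 1 |
      ∀ i ∈ s, ‖u i‖ / (32 * k ^ 3) ≤ |inner ℝ (u i) (θ : EuclideanSpace ℝ (Fin k))|} = Bᶜ := by
    ext θ
    simp [hB]
  rw [heq, probReal_compl_eq_one_sub hmB]
  have h1 : (sphereUniform k).real B ≤ s.card * (1 / (4 * k ^ 2)) := by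
    refine (measureReal_biUnion_finset_le s _).trans ?_
    refine (Finset.sum_le_card_nsmul s _ (1 / (4 * (k : ℝ) ^ 2)) ?_).trans (by simp)
    exact fun i hi => sphereUniform_inner_small hk (u i) (hu i hi)
  have h2 : (s.card : ℝ) < k ^ 2 := by exact_mod_cast hs
  -- Having strictly fewer than `k ^ 2` vectors is what makes the final probability strictly larger
  -- than `3 / 4`.
  have h3 : (s.card : ℝ) * (1 / (4 * k ^ 2)) < k ^ 2 * (1 / (4 * k ^ 2)) :=
    mul_lt_mul_of_pos_right h2 (by positivity)
  have h4 : (k : ℝ) ^ 2 * (1 / (4 * k ^ 2)) = 1 / 4 := by field_simp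
  linarith

end Sphere

/-! ### The Dirichlet distribution: normalization and moments -/

/-- The open simplex `{x | x > 0, ∑ x < s}`. -/
def openSimplex (m : ℕ) (s : ℝ) : Set (Fin m → ℝ) := {x | (∀ i, 0 < x i) ∧ ∑ i, x i < s}

lemma measurableSet_openSimplex (m : ℕ) (s : ℝ) : MeasurableSet (openSimplex m s) := by
  have h : openSimplex m s = (⋂ i, {x : Fin m → ℝ | 0 < x i}) ∩ {x | ∑ i, x i < s} := by
    ext x; simp [openSimplex]
  rw [h]
  exact (MeasurableSet.iInter fun i => measurableSet_lt measurable_const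
    (measurable_pi_apply i)).inter (measurableSet_lt (by fun_prop) measurable_const)

/-- The substitution `y = s * x` turns the integrand into a multiple of the beta density, whose
integral is one. -/
lemma lintegral_beta_scaled {a b s : ℝ} (ha : 0 < a) (hb : 0 < b) (hs : 0 < s) :
    ∫⁻ y in Set.Ioo 0 s, ENNReal.ofReal (y ^ (a - 1) * (s - y) ^ (b - 1)) =
      ENNReal.ofReal (s ^ (a + b - 1) * (Real.Gamma a * Real.Gamma b / Real.Gamma (a + b))) := by
  have hbeta : 0 < beta a b := beta_pos ha hb
  rw [← lintegral_indicator measurableSet_Ioo]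
  have hmeas : Measurable (Set.indicator (Set.Ioo 0 s)
      fun y : ℝ => ENNReal.ofReal (y ^ (a - 1) * (s - y) ^ (b - 1))) :=
    Measurable.indicator (by fun_prop) measurableSet_Ioo
  have hpt : ∀ x : ℝ, (Set.indicator (Set.Ioo 0 s)
      fun y : ℝ => ENNReal.ofReal (y ^ (a - 1) * (s - y) ^ (b - 1))) (s * x) =
      ENNReal.ofReal (s ^ (a + b - 2) * beta a b) * betaPDF a b x := by
    intro x
    by_cases hx : 0 < x ∧ x < 1
    · have hmem : s * x ∈ Set.Ioo 0 s := ⟨by nlinarith, by nlinarith⟩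
      rw [Set.indicator_of_mem hmem, betaPDF_of_pos_lt_one hx.1 hx.2,
        ← ENNReal.ofReal_mul (by positivity)]
      congr 1
      have h1 : s - s * x = s * (1 - x) := by ring
      have hx' : 0 < 1 - x := by linarith
      rw [h1, Real.mul_rpow hs.le hx.1.le, Real.mul_rpow hs.le (by linarith)]
      have h2 : s ^ (a + b - 2) = s ^ (a - 1) * s ^ (b - 1) := by
        rw [← Real.rpow_add hs]; congr 1; ring
      rw [h2]
      field_simp
    · have hmem : s * x ∉ Set.Ioo 0 s := by
        rintro ⟨h1, h2⟩
        exact hx ⟨by by_contra h; nlinarith, by nlinarith⟩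
      rw [Set.indicator_of_notMem hmem, betaPDF_eq, if_neg hx]
      simp
  rw [← Real.smul_map_volume_mul_left hs.ne', lintegral_smul_measure,
    lintegral_map hmeas (by fun_prop)]
  simp only [hpt]
  rw [lintegral_const_mul' _ _ ENNReal.ofReal_ne_top, lintegral_betaPDF_eq_one ha hb, mul_one,
    smul_eq_mul, ← ENNReal.ofReal_mul (abs_nonneg _), abs_of_pos hs]
  congr 1
  have h2 : s ^ (a + b - 1) = s * s ^ (a + b - 2) := by
    nth_rewrite 2 [← Real.rpow_one s]
    rw [← Real.rpow_add hs]; congr 1; ring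
  rw [h2, beta, mul_assoc]

/-- Dirichlet's integral over the simplex. -/
lemma lintegral_openSimplex (m : ℕ) : ∀ (β : Fin m → ℝ) (_ : ∀ i, 0 < β i) (a : ℝ) (_ : 0 < a)
    (s : ℝ) (_ : 0 < s),
    ∫⁻ x in openSimplex m s,
        ENNReal.ofReal ((∏ i, x i ^ (β i - 1)) * (s - ∑ i, x i) ^ (a - 1)) =
      ENNReal.ofReal (s ^ (∑ i, β i + a - 1) *
        ((∏ i, Real.Gamma (β i)) * Real.Gamma a / Real.Gamma (∑ i, β i + a))) := by
  induction m with
  | zero =>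
    intro β _ a ha s hs
    have h : openSimplex 0 s = Set.univ := by
      ext x; simp [openSimplex, hs]
    rw [h, Measure.restrict_univ, volume_pi, Measure.pi_of_empty, lintegral_dirac]
    simp [(Real.Gamma_pos_of_pos ha).ne']
  | succ m ih =>
    intro β hβ a ha s hs
    set F : (Fin (m + 1) → ℝ) → ENNReal := (openSimplex (m + 1) s).indicator fun x =>
      ENNReal.ofReal ((∏ i, x i ^ (β i - 1)) * (s - ∑ i, x i) ^ (a - 1)) with hF
    have hFm : Measurable F :=
      Measurable.indicator (by fun_prop) (measurableSet_openSimplex _ _)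
    set b := ∑ i : Fin m, β i.succ + a with hb
    have hb0 : 0 < b := add_pos_of_nonneg_of_pos (Finset.sum_nonneg fun i _ => (hβ _).le) ha
    set K := (∏ i : Fin m, Real.Gamma (β i.succ)) * Real.Gamma a / Real.Gamma b with hK
    have hK0 : 0 < K := div_pos (mul_pos (Finset.prod_pos fun i _ => Real.Gamma_pos_of_pos (hβ _))
      (Real.Gamma_pos_of_pos ha)) (Real.Gamma_pos_of_pos hb0)
    rw [← lintegral_indicator (measurableSet_openSimplex _ _)]
    -- Fixing the first coordinate `y` leaves a simplex of size `s - y`, which is why the induction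
    -- runs over all sizes. The induction hypothesis contributes `(s - y) ^ (b - 1)`, and a scaled
    -- beta integral in `y` remains.
    have hinner : ∀ y : ℝ, ∫⁻ z : Fin m → ℝ, F (Fin.cons y z) =
        (Set.Ioo 0 s).indicator
          (fun y => ENNReal.ofReal K * ENNReal.ofReal (y ^ (β 0 - 1) * (s - y) ^ (b - 1))) y := by
      intro y
      by_cases hy : y ∈ Set.Ioo 0 s
      · have hsy : 0 < s - y := sub_pos.2 hy.2
        have hpt : ∀ z : Fin m → ℝ, F (Fin.cons y z) = ENNReal.ofReal (y ^ (β 0 - 1)) *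
            (openSimplex m (s - y)).indicator (fun z => ENNReal.ofReal
              ((∏ i, z i ^ (β i.succ - 1)) * (s - y - ∑ i, z i) ^ (a - 1))) z := by
          intro z
          have hmem : (Fin.cons y z : Fin (m + 1) → ℝ) ∈ openSimplex (m + 1) s ↔
              z ∈ openSimplex m (s - y) := by
            simp only [openSimplex, Set.mem_ofPred_eq, Fin.forall_fin_succ, Fin.cons_zero,
              Fin.cons_succ, Fin.sum_univ_succ, hy.1, true_and]
            constructor <;> rintro ⟨h1, h2⟩ <;> exact ⟨h1, by linarith⟩
          by_cases hz : z ∈ openSimplex m (s - y)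
          · rw [hF, Set.indicator_of_mem (hmem.2 hz), Set.indicator_of_mem hz,
              ← ENNReal.ofReal_mul (Real.rpow_nonneg hy.1.le _)]
            simp only [Fin.prod_univ_succ, Fin.sum_univ_succ, Fin.cons_zero, Fin.cons_succ]
            congr 1
            rw [sub_add_eq_sub_sub]; ring
          · rw [hF, Set.indicator_of_notMem (fun h => hz (hmem.1 h)), Set.indicator_of_notMem hz,
              mul_zero]
        simp only [hpt]
        rw [lintegral_const_mul' _ _ ENNReal.ofReal_ne_top,
          lintegral_indicator (measurableSet_openSimplex _ _),
          ih (fun i => β i.succ) (fun i => hβ _) a ha (s - y) hsy, Set.indicator_of_mem hy,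
          ← ENNReal.ofReal_mul (Real.rpow_nonneg hy.1.le _), ← ENNReal.ofReal_mul hK0.le]
        congr 1
        ring
      · rw [Set.indicator_of_notMem hy]
        have hpt : ∀ z : Fin m → ℝ, F (Fin.cons y z) = 0 := by
          intro z
          rw [hF, Set.indicator_of_notMem]
          rintro ⟨h1, h2⟩
          apply hy
          rw [Fin.sum_univ_succ] at h2
          have h3 : 0 ≤ ∑ i : Fin m, (Fin.cons y z : Fin (m + 1) → ℝ) i.succ :=
            Finset.sum_nonneg fun i _ => (h1 _).le
          have h4 := h1 0
          simp only [Fin.cons_zero] at h2 h4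
          exact ⟨h4, by linarith⟩
        simp [hpt]
    have hsplit : ∫⁻ x, F x = ∫⁻ y : ℝ, ∫⁻ z : Fin m → ℝ, F (Fin.cons y z) := by
      have he := (volume_preserving_piFinSuccAbove (fun _ : Fin (m + 1) => ℝ) 0).symm
      rw [← he.lintegral_comp hFm, Measure.volume_eq_prod, lintegral_prod]
      · simp [MeasurableEquiv.piFinSuccAbove, Fin.insertNthEquiv]
      · exact (hFm.comp he.measurable).aemeasurable
    rw [hsplit]
    simp only [hinner]
    rw [lintegral_indicator measurableSet_Ioo, lintegral_const_mul' _ _ ENNReal.ofReal_ne_top,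
      lintegral_beta_scaled (hβ 0) hb0 hs, ← ENNReal.ofReal_mul hK0.le]
    congr 1
    rw [hK, Fin.prod_univ_succ, Fin.sum_univ_succ, add_assoc, ← hb]
    have := (Real.Gamma_pos_of_pos hb0).ne'
    field_simp

lemma measurable_simplexPoint {m : ℕ} : Measurable (simplexPoint (m := m)) := by
  refine measurable_pi_iff.2 fun i => ?_
  refine Fin.cases ?_ (fun j => ?_) i
  · simp only [simplexPoint, Fin.cons_zero]; fun_prop
  · simp only [simplexPoint, Fin.cons_succ]; fun_prop

lemma measurable_dirichletDensity {k : ℕ} (α : Fin k → ℝ) : Measurable (dirichletDensity α) := by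
  unfold dirichletDensity; fun_prop

lemma simplexPoint_pos {m : ℕ} {x : Fin m → ℝ} (hx : x ∈ openSimplex m 1) (i : Fin (m + 1)) :
    0 < simplexPoint x i := by
  refine Fin.cases ?_ (fun j => ?_) i
  · simpa [simplexPoint] using hx.2
  · simpa [simplexPoint] using hx.1 j

lemma lintegral_dirichlet {m : ℕ} (α : Fin (m + 1) → ℝ) (f : (Fin (m + 1) → ℝ) → ENNReal)
    (hf : Measurable f) :
    ∫⁻ h, f h ∂(dirichlet α) = ∫⁻ x in openSimplex m 1,
      ENNReal.ofReal (dirichletDensity α (simplexPoint x)) * f (simplexPoint x) := by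
  rw [dirichlet, lintegral_map hf measurable_simplexPoint, lintegral_withDensity_eq_lintegral_mul]
  · rfl
  · exact ((measurable_dirichletDensity α).comp measurable_simplexPoint).ennreal_ofReal
  · exact hf.comp measurable_simplexPoint

lemma dirichlet_isProbabilityMeasure {k : ℕ} (hk : 0 < k) (α : Fin k → ℝ) (hα : ∀ i, 0 < α i) :
    IsProbabilityMeasure (dirichlet α) := by
  obtain ⟨m, rfl⟩ : ∃ m, k = m + 1 := ⟨k - 1, by omega⟩
  constructor
  have h := lintegral_dirichlet α (fun _ => 1) measurable_const
  rw [lintegral_one] at h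
  rw [h]
  have hA : 0 < Real.Gamma (∑ i, α i) / ∏ i, Real.Gamma (α i) :=
    div_pos (Real.Gamma_pos_of_pos (Finset.sum_pos (fun i _ => hα i) Finset.univ_nonempty))
      (Finset.prod_pos fun i _ => Real.Gamma_pos_of_pos (hα i))
  have hpt : ∀ x : Fin m → ℝ, ENNReal.ofReal (dirichletDensity α (simplexPoint x)) * 1 =
      ENNReal.ofReal (Real.Gamma (∑ i, α i) / ∏ i, Real.Gamma (α i)) *
        ENNReal.ofReal ((∏ i, x i ^ (α i.succ - 1)) * (1 - ∑ i, x i) ^ (α 0 - 1)) := by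
    intro x
    rw [mul_one, ← ENNReal.ofReal_mul hA.le, dirichletDensity]
    conv_lhs => rw [Fin.prod_univ_succ (fun i => simplexPoint x i ^ (α i - 1))]
    simp only [simplexPoint, Fin.cons_zero, Fin.cons_succ]
    congr 2
    ring
  simp only [hpt]
  rw [lintegral_const_mul' _ _ ENNReal.ofReal_ne_top,
    lintegral_openSimplex m (fun i => α i.succ) (fun i => hα _) (α 0) (hα 0) 1 one_pos,
    ← ENNReal.ofReal_mul hA.le, Real.one_rpow, one_mul, ENNReal.ofReal_eq_one]
  have h1 : ∑ i : Fin m, α i.succ + α 0 = ∑ i, α i := by rw [Fin.sum_univ_succ, add_comm]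
  have h2 : (∏ i : Fin m, Real.Gamma (α i.succ)) * Real.Gamma (α 0) = ∏ i, Real.Gamma (α i) := by
    rw [Fin.prod_univ_succ, mul_comm]
  rw [h1, h2]
  have h3 := (Real.Gamma_pos_of_pos
    (Finset.sum_pos (fun i _ => hα i) (Finset.univ_nonempty (α := Fin (m + 1))))).ne'
  have h4 : ∏ i, Real.Gamma (α i) ≠ 0 :=
    (Finset.prod_pos fun i _ => Real.Gamma_pos_of_pos (hα i)).ne'
  field_simp

/-- Size-biasing a Dirichlet distribution raises one of its parameters by one. -/
lemma lintegral_coord_mul_dirichlet {k : ℕ} (α : Fin k → ℝ) (hα : ∀ i, 0 < α i) (i : Fin k)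
    (f : (Fin k → ℝ) → ENNReal) (hf : Measurable f) :
    ∫⁻ h, ENNReal.ofReal (h i) * f h ∂(dirichlet α) =
      ENNReal.ofReal (α i / ∑ j, α j) * ∫⁻ h, f h ∂(dirichlet (α + Pi.single i 1)) := by
  obtain ⟨m, rfl⟩ : ∃ m, k = m + 1 := ⟨k - 1, by have := i.2; omega⟩
  rw [lintegral_dirichlet α _ (by fun_prop), lintegral_dirichlet _ _ hf,
    ← lintegral_const_mul' _ _ ENNReal.ofReal_ne_top]
  refine setLIntegral_congr_fun (measurableSet_openSimplex _ _) fun x hx => ?_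
  have hs : 0 < ∑ j, α j := Finset.sum_pos (fun i _ => hα i) Finset.univ_nonempty
  have hp := simplexPoint_pos hx
  rw [← mul_assoc, ← mul_assoc, ← ENNReal.ofReal_mul' (hp i).le,
    ← ENNReal.ofReal_mul (div_pos (hα i) hs).le]
  congr 2
  -- Since `Γ(x + 1) = x Γ(x)`, raising `α i` by one multiplies the density by `h i * (∑ j, α j) / α
  -- i`.
  have hsum : ∑ j, (α + Pi.single i 1 : Fin (m + 1) → ℝ) j = ∑ j, α j + 1 := by
    simp [Finset.sum_add_distrib]
  have hprod : ∏ j, Real.Gamma ((α + Pi.single i 1 : Fin (m + 1) → ℝ) j) =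
      α i * ∏ j, Real.Gamma (α j) := by
    rw [← Finset.mul_prod_erase _ _ (Finset.mem_univ i),
      ← Finset.mul_prod_erase _ (fun j => Real.Gamma (α j)) (Finset.mem_univ i)]
    simp only [Pi.add_apply, Pi.single_eq_same, Real.Gamma_add_one (hα i).ne', mul_assoc]
    congr 2
    refine Finset.prod_congr rfl fun j hj => ?_
    rw [Pi.single_eq_of_ne (Finset.ne_of_mem_erase hj), add_zero]
  have hpow : ∏ j, simplexPoint x j ^ ((α + Pi.single i 1 : Fin (m + 1) → ℝ) j - 1) =
      simplexPoint x i * ∏ j, simplexPoint x j ^ (α j - 1) := by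
    rw [← Finset.mul_prod_erase _ _ (Finset.mem_univ i),
      ← Finset.mul_prod_erase _ (fun j => simplexPoint x j ^ (α j - 1)) (Finset.mem_univ i),
      ← mul_assoc]
    congr 1
    · simp only [Pi.add_apply, Pi.single_eq_same]
      rw [Real.rpow_sub_one (hp i).ne', Real.rpow_add_one (hp i).ne',
        Real.rpow_sub_one (hp i).ne']
      field_simp
    · refine Finset.prod_congr rfl fun j hj => ?_
      simp [Pi.single_eq_of_ne (Finset.ne_of_mem_erase hj)]
  simp only [dirichletDensity]
  rw [hsum, hprod, hpow, Real.Gamma_add_one hs.ne']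
  have h3 := (Real.Gamma_pos_of_pos hs).ne'
  have h4 : ∏ i, Real.Gamma (α i) ≠ 0 :=
    (Finset.prod_pos fun i _ => Real.Gamma_pos_of_pos (hα i)).ne'
  have h5 := (hα i).ne'
  field_simp

/-- The third moment `E[hᵢ hⱼ hₗ]` of the Dirichlet distribution. -/
def dirichletThird {k : ℕ} (α : Fin k → ℝ) (i j l : Fin k) : ℝ :=
  α i / (∑ a, α a) * ((α j + Pi.single (M := fun _ => ℝ) i 1 j) / (∑ a, α a + 1)) *
    ((α l + Pi.single (M := fun _ => ℝ) i 1 l + Pi.single (M := fun _ => ℝ) j 1 l) /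
      (∑ a, α a + 2))

/-- Size-biasing three times removes the coordinates one by one. Each removal raises a parameter,
which yields the Kronecker deltas in the later factors; what is left is the total mass of a
Dirichlet distribution. -/
lemma lintegral_third_moment {k : ℕ} (α : Fin k → ℝ) (hα : ∀ i, 0 < α i) (i j l : Fin k) :
    ∫⁻ h, ENNReal.ofReal (h i) * (ENNReal.ofReal (h j) * ENNReal.ofReal (h l)) ∂(dirichlet α) =
      ENNReal.ofReal (dirichletThird α i j l) := by
  have hk : 0 < k := i.pos
  have hne : (Finset.univ : Finset (Fin k)).Nonempty := ⟨i, Finset.mem_univ i⟩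
  have hs : 0 < ∑ a, α a := Finset.sum_pos (fun i _ => hα i) hne
  have hup : ∀ (β : Fin k → ℝ), (∀ a, 0 < β a) → ∀ b : Fin k,
      ∀ a, 0 < (β + Pi.single b 1 : Fin k → ℝ) a := by
    intro β hβ b a
    have : 0 ≤ (Pi.single b 1 : Fin k → ℝ) a := by
      by_cases h : a = b
      · subst h; simp
      · simp [Pi.single_eq_of_ne h]
    exact add_pos_of_pos_of_nonneg (hβ a) this
  have h1 := hup α hα i
  have h2 := hup _ h1 j
  have h3 := hup _ h2 l
  have hsum : ∀ (β : Fin k → ℝ) (b : Fin k),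
      ∑ a, (β + Pi.single b 1 : Fin k → ℝ) a = ∑ a, β a + 1 := by
    intro β b; simp [Finset.sum_add_distrib]
  rw [lintegral_coord_mul_dirichlet α hα i _ (by fun_prop),
    lintegral_coord_mul_dirichlet _ h1 j _ (by fun_prop)]
  have := dirichlet_isProbabilityMeasure hk _ h3
  have h5 := lintegral_coord_mul_dirichlet _ h2 l (fun _ => 1) measurable_const
  simp only [mul_one, lintegral_one, measure_univ] at h5
  rw [h5, hsum (α + Pi.single i 1) j, hsum α i, ← ENNReal.ofReal_mul (div_nonneg (h1 j).le (by linarith)),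
    ← ENNReal.ofReal_mul (div_nonneg (hα i).le hs.le)]
  congr 1
  simp only [dirichletThird, Pi.add_apply]
  rw [mul_assoc, add_assoc (∑ a, α a), one_add_one_eq_two]

lemma dirichletThird_nonneg {k : ℕ} (α : Fin k → ℝ) (hα : ∀ i, 0 < α i) (i j l : Fin k) :
    0 ≤ dirichletThird α i j l := by
  have hs : 0 ≤ ∑ a, α a := Finset.sum_nonneg fun i _ => (hα i).le
  have hp : ∀ b a : Fin k, 0 ≤ Pi.single (M := fun _ => ℝ) b 1 a := by
    intro b a
    by_cases h : a = b
    · subst h; simp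
    · simp [Pi.single_eq_of_ne h]
  unfold dirichletThird
  have := hp i j
  have := hp i l
  have := hp j l
  have := (hα i).le
  have := (hα j).le
  have := (hα l).le
  positivity

/-- The probability of a triple of words. -/
def documentProb {d k : ℕ} (α : Fin k → ℝ) (O : Matrix (Fin d) (Fin k) ℝ) (w : Fin 3 → Fin d) : ℝ :=
  ∑ i, ∑ j, ∑ l, dirichletThird α i j l * (O (w 0) i * O (w 1) j * O (w 2) l)

/-- `ENNReal.ofReal` respects sums and products of nonnegative numbers only, so the document law can
be expanded only where `h ≥ 0`. -/
lemma dirichlet_ae_nonneg {k : ℕ} (α : Fin k → ℝ) : ∀ᵐ h ∂(dirichlet α), ∀ i, 0 ≤ h i := by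
  cases k with
  | zero => simp [dirichlet]
  | succ m =>
    have hms : MeasurableSet {h : Fin (m + 1) → ℝ | ∀ i, 0 ≤ h i} := by
      have h : {h : Fin (m + 1) → ℝ | ∀ i, 0 ≤ h i} = ⋂ i, {x | 0 ≤ x i} := by ext x; simp
      rw [h]
      exact MeasurableSet.iInter fun i => measurableSet_le measurable_const (measurable_pi_apply i)
    rw [dirichlet, ae_map_iff measurable_simplexPoint.aemeasurable hms]
    refine (withDensity_absolutelyContinuous _ _).ae_le ?_
    filter_upwards [ae_restrict_mem (measurableSet_openSimplex m 1)] with x hx i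
    exact (simplexPoint_pos hx i).le

lemma lintegral_document {d k : ℕ} (α : Fin k → ℝ) (hα : ∀ i, 0 < α i)
    (O : Matrix (Fin d) (Fin k) ℝ) (hO : IsTopicMatrix O) (w : Fin 3 → Fin d) :
    ∫⁻ h, ∏ v, ENNReal.ofReal (∑ i, h i * O (w v) i) ∂(dirichlet α) =
      ENNReal.ofReal (documentProb α O w) := by
  have hcongr : ∫⁻ h, ∏ v, ENNReal.ofReal (∑ i, h i * O (w v) i) ∂(dirichlet α) =
      ∫⁻ h, ∑ i, ∑ j, ∑ l, ENNReal.ofReal (O (w 0) i * O (w 1) j * O (w 2) l) *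
        (ENNReal.ofReal (h i) * (ENNReal.ofReal (h j) * ENNReal.ofReal (h l))) ∂(dirichlet α) := by
    refine lintegral_congr_ae ?_
    filter_upwards [dirichlet_ae_nonneg α] with h hh
    have hs : ∀ v, 0 ≤ ∑ i, h i * O (w v) i :=
      fun v => Finset.sum_nonneg fun i _ => mul_nonneg (hh i) (hO.nonneg _ _)
    have hnn : ∀ i j l, 0 ≤ O (w 0) i * O (w 1) j * O (w 2) l * (h i * (h j * h l)) :=
      fun i j l => mul_nonneg (mul_nonneg (mul_nonneg (hO.nonneg _ _) (hO.nonneg _ _))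
        (hO.nonneg _ _)) (mul_nonneg (hh i) (mul_nonneg (hh j) (hh l)))
    have hterm : ∀ i j l, ENNReal.ofReal (O (w 0) i * O (w 1) j * O (w 2) l) *
        (ENNReal.ofReal (h i) * (ENNReal.ofReal (h j) * ENNReal.ofReal (h l))) =
        ENNReal.ofReal (O (w 0) i * O (w 1) j * O (w 2) l * (h i * (h j * h l))) := by
      intro i j l
      rw [ENNReal.ofReal_mul' (mul_nonneg (hh i) (mul_nonneg (hh j) (hh l))),
        ENNReal.ofReal_mul (hh i), ENNReal.ofReal_mul (hh j)]
    simp only [hterm]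
    simp_rw [← ENNReal.ofReal_sum_of_nonneg (fun l _ => hnn _ _ l)]
    simp_rw [← ENNReal.ofReal_sum_of_nonneg
      (fun j _ => Finset.sum_nonneg fun l _ => hnn _ j l)]
    rw [← ENNReal.ofReal_sum_of_nonneg
      (fun i _ => Finset.sum_nonneg fun j _ => Finset.sum_nonneg fun l _ => hnn i j l),
      Fin.prod_univ_three, ← ENNReal.ofReal_mul (hs 0),
      ← ENNReal.ofReal_mul (mul_nonneg (hs 0) (hs 1))]
    congr 1
    rw [Finset.sum_mul_sum, Finset.sum_mul]
    simp_rw [Finset.sum_mul, Finset.mul_sum]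
    refine Finset.sum_congr rfl fun i _ => Finset.sum_congr rfl fun j _ =>
      Finset.sum_congr rfl fun l _ => ?_
    ring
  rw [hcongr, lintegral_finsetSum _ (fun i _ => by fun_prop), documentProb,
    ENNReal.ofReal_sum_of_nonneg]
  · refine Finset.sum_congr rfl fun i _ => ?_
    rw [lintegral_finsetSum _ (fun j _ => by fun_prop), ENNReal.ofReal_sum_of_nonneg]
    · refine Finset.sum_congr rfl fun j _ => ?_
      rw [lintegral_finsetSum _ (fun l _ => by fun_prop), ENNReal.ofReal_sum_of_nonneg]
      · refine Finset.sum_congr rfl fun l _ => ?_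
        rw [lintegral_const_mul' _ _ ENNReal.ofReal_ne_top, lintegral_third_moment α hα,
          ENNReal.ofReal_mul (dirichletThird_nonneg α hα i j l), mul_comm]
      · intro l _
        exact mul_nonneg (dirichletThird_nonneg α hα _ _ _) (mul_nonneg (mul_nonneg
          (hO.nonneg _ _) (hO.nonneg _ _)) (hO.nonneg _ _))
    · intro j _
      exact Finset.sum_nonneg fun l _ => mul_nonneg (dirichletThird_nonneg α hα _ _ _)
        (mul_nonneg (mul_nonneg (hO.nonneg _ _) (hO.nonneg _ _)) (hO.nonneg _ _))
  · intro i _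
    exact Finset.sum_nonneg fun j _ => Finset.sum_nonneg fun l _ =>
      mul_nonneg (dirichletThird_nonneg α hα _ _ _)
        (mul_nonneg (mul_nonneg (hO.nonneg _ _) (hO.nonneg _ _)) (hO.nonneg _ _))

lemma documentProb_nonneg {d k : ℕ} (α : Fin k → ℝ) (hα : ∀ i, 0 < α i)
    (O : Matrix (Fin d) (Fin k) ℝ) (hO : IsTopicMatrix O) (w : Fin 3 → Fin d) :
    0 ≤ documentProb α O w :=
  Finset.sum_nonneg fun _ _ => Finset.sum_nonneg fun _ _ => Finset.sum_nonneg fun _ _ =>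
    mul_nonneg (dirichletThird_nonneg α hα _ _ _)
      (mul_nonneg (mul_nonneg (hO.nonneg _ _) (hO.nonneg _ _)) (hO.nonneg _ _))

lemma documentLaw_real_singleton {d k : ℕ} (α : Fin k → ℝ) (hα : ∀ i, 0 < α i)
    (O : Matrix (Fin d) (Fin k) ℝ) (hO : IsTopicMatrix O) (w : Fin 3 → Fin d) :
    (documentLaw α O).real {w} = documentProb α O w := by
  rw [Measure.real, documentLaw]
  simp only [lintegral_document α hα O hO, Measure.coe_finsetSum, Finset.sum_apply,
    Measure.smul_apply, smul_eq_mul, Measure.dirac_apply' _ (measurableSet_singleton w)]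
  rw [Finset.sum_eq_single w]
  · simp [documentProb_nonneg α hα O hO w]
  · intro b _ hb
    simp [hb]
  · simp

/-! ### Bounded differences and concentration of empirical frequencies -/

section Concentration

variable {S : Type*}

/-- The weight of the sequence `x` under the product of the distributions `q`. -/
def seqWeight (q : S → ℝ) {N : ℕ} (x : Fin N → S) : ℝ := ∏ n, q (x n)

lemma seqWeight_nonneg {q : S → ℝ} (hq : ∀ s, 0 ≤ q s) {N : ℕ} (x : Fin N → S) :
    0 ≤ seqWeight q x :=
  Finset.prod_nonneg fun _ _ => hq _

lemma seqWeight_cons (q : S → ℝ) {N : ℕ} (s : S) (x : Fin N → S) :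
    seqWeight q (Fin.cons s x : Fin (N + 1) → S) = q s * seqWeight q x := by
  simp [seqWeight, Fin.prod_univ_succ]

variable [Fintype S]

lemma sum_seq_succ {M : Type*} [AddCommMonoid M] {N : ℕ} (F : (Fin (N + 1) → S) → M) :
    ∑ x, F x = ∑ s, ∑ y : Fin N → S, F (Fin.cons s y) := by
  rw [← (Fin.consEquiv fun _ => S).sum_comp, Fintype.sum_prod_type]
  rfl

lemma sum_seqWeight {q : S → ℝ} (hq1 : ∑ s, q s = 1) : ∀ N : ℕ,
    ∑ x : Fin N → S, seqWeight q x = 1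
  | 0 => by simp [seqWeight]
  | N + 1 => by
    rw [sum_seq_succ]
    simp_rw [seqWeight_cons, ← Finset.mul_sum, sum_seqWeight hq1 N, mul_one, hq1]

/-- Hoeffding's lemma on a finite probability space. -/
lemma hoeffding_finite {q : S → ℝ} (hq : ∀ s, 0 ≤ q s) (hq1 : ∑ s, q s = 1) (g : S → ℝ) {c : ℝ}
    (hc : 0 ≤ c) (hg : ∀ s s', g s - g s' ≤ c) (t : ℝ) :
    ∑ s, q s * Real.exp (t * (g s - ∑ s', q s' * g s')) ≤ Real.exp (c ^ 2 * t ^ 2 / 8) := by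
  have : Nonempty S := by
    by_contra h
    rw [not_nonempty_iff] at h
    simp at hq1
  let _ : MeasurableSpace S := ⊤
  have : DiscreteMeasurableSpace S := ⟨fun _ => trivial⟩
  -- The weights are turned into a probability measure in order to apply Hoeffding's lemma for
  -- bounded random variables.
  set μ : Measure S := ∑ s, ENNReal.ofReal (q s) • Measure.dirac s with hμ
  have hsingle : ∀ s, μ.real {s} = q s := by
    intro s
    rw [Measure.real, hμ]
    simp only [Measure.coe_finsetSum, Finset.sum_apply, Measure.smul_apply, smul_eq_mul,
      Measure.dirac_apply' _ (measurableSet_singleton s)]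
    rw [Finset.sum_eq_single s]
    · simp [hq]
    · intro b _ hb
      simp [hb]
    · simp
  have hprob : IsProbabilityMeasure μ := by
    constructor
    rw [hμ]
    simp only [Measure.coe_finsetSum, Finset.sum_apply, Measure.smul_apply, smul_eq_mul,
      measure_univ, mul_one]
    rw [← ENNReal.ofReal_sum_of_nonneg fun s _ => hq s, hq1, ENNReal.ofReal_one]
  have hint : ∀ f : S → ℝ, ∫ s, f s ∂μ = ∑ s, q s * f s := by
    intro f
    rw [integral_fintype (Integrable.of_finite)]
    simp [hsingle]
  obtain ⟨s₀, -, hs₀⟩ := Finset.exists_min_image Finset.univ g Finset.univ_nonempty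
  have hsub := hasSubgaussianMGF_of_mem_Icc (μ := μ) (X := g) (a := g s₀) (b := g s₀ + c)
    (measurable_of_finite g).aemeasurable
    (Filter.Eventually.of_forall fun s => ⟨hs₀ s (Finset.mem_univ s), by linarith [hg s s₀]⟩)
  have h := hsub.mgf_le t
  rw [mgf, hint, hint] at h
  refine h.trans (le_of_eq ?_)
  congr 1
  simp only [add_sub_cancel_left, NNReal.coe_pow, NNReal.coe_div, coe_nnnorm, NNReal.coe_ofNat,
    Real.norm_of_nonneg hc]
  ring

/-- McDiarmid's inequality, in exponential form. -/
lemma mcdiarmid_mgf {q : S → ℝ} (hq : ∀ s, 0 ≤ q s) (hq1 : ∑ s, q s = 1) {c : ℝ} (hc : 0 ≤ c)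
    (t : ℝ) : ∀ {N : ℕ} (f : (Fin N → S) → ℝ)
    (_ : ∀ x y n, (∀ m, m ≠ n → x m = y m) → f x - f y ≤ c),
    ∑ x, seqWeight q x * Real.exp (t * (f x - ∑ y, seqWeight q y * f y)) ≤
      Real.exp (N * (c ^ 2 * t ^ 2 / 8))
  | 0, f, _ => by simp [seqWeight]
  | N + 1, f, hf => by
    -- `g s` is the conditional mean of `f` given the first sample. In the martingale splitting `f -
    -- E f = (g - E g) + (f - g)`, Hoeffding's lemma handles the first term and induction on `N` the
    -- second.
    set g : S → ℝ := fun s => ∑ y : Fin N → S, seqWeight q y * f (Fin.cons s y) with hg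
    have hmean : ∑ y, seqWeight q y * f y = ∑ s, q s * g s := by
      rw [sum_seq_succ]
      simp_rw [seqWeight_cons, hg, Finset.mul_sum, mul_assoc]
    have hgc : ∀ s s', g s - g s' ≤ c := by
      intro s s'
      rw [hg]
      simp only
      rw [← Finset.sum_sub_distrib]
      calc ∑ y : Fin N → S, (seqWeight q y * f (Fin.cons s y) - seqWeight q y * f (Fin.cons s' y))
          ≤ ∑ y : Fin N → S, seqWeight q y * c := by
            refine Finset.sum_le_sum fun y _ => ?_
            rw [← mul_sub]
            refine mul_le_mul_of_nonneg_left (hf _ _ 0 fun m hm => ?_) (seqWeight_nonneg hq y)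
            obtain ⟨j, rfl⟩ := Fin.exists_succ_eq.2 hm
            simp
        _ = c := by rw [← Finset.sum_mul, sum_seqWeight hq1, one_mul]
    have hrest : ∀ s, ∑ y : Fin N → S, seqWeight q y * Real.exp (t * (f (Fin.cons s y) - g s)) ≤
        Real.exp (N * (c ^ 2 * t ^ 2 / 8)) := by
      intro s
      refine mcdiarmid_mgf hq hq1 hc t (fun y => f (Fin.cons s y)) fun x y n hxy => ?_
      refine hf _ _ n.succ fun m hm => ?_
      revert hm
      refine Fin.cases (fun _ => by simp) (fun j hj => ?_) m
      simpa only [Fin.cons_succ] using hxy j fun h => hj (congrArg Fin.succ h)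
    rw [hmean, sum_seq_succ]
    calc ∑ s, ∑ y : Fin N → S, seqWeight q (Fin.cons s y : Fin (N + 1) → S) *
          Real.exp (t * (f (Fin.cons s y) - ∑ s, q s * g s))
        = ∑ s, q s * Real.exp (t * (g s - ∑ s, q s * g s)) *
          ∑ y : Fin N → S, seqWeight q y * Real.exp (t * (f (Fin.cons s y) - g s)) := by
          refine Finset.sum_congr rfl fun s _ => ?_
          rw [Finset.mul_sum]
          refine Finset.sum_congr rfl fun y _ => ?_
          have : t * (f (Fin.cons s y) - ∑ s, q s * g s) =
            t * (g s - ∑ s, q s * g s) + t * (f (Fin.cons s y) - g s) := by ring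
          rw [seqWeight_cons, this, Real.exp_add]
          ring
      _ ≤ ∑ s, q s * Real.exp (t * (g s - ∑ s, q s * g s)) * Real.exp (N * (c ^ 2 * t ^ 2 / 8)) :=
          Finset.sum_le_sum fun s _ => mul_le_mul_of_nonneg_left (hrest s)
            (mul_nonneg (hq s) (Real.exp_pos _).le)
      _ ≤ Real.exp (c ^ 2 * t ^ 2 / 8) * Real.exp (N * (c ^ 2 * t ^ 2 / 8)) := by
          rw [← Finset.sum_mul]
          exact mul_le_mul_of_nonneg_right (hoeffding_finite hq hq1 g hc hgc t) (Real.exp_pos _).le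
      _ = Real.exp ((N + 1 : ℕ) * (c ^ 2 * t ^ 2 / 8)) := by
          rw [← Real.exp_add]; congr 1; push_cast; ring

variable {E : Type*} [NormedAddCommGroup E] [InnerProductSpace ℝ E]

lemma sum_seqWeight_smul_sum {q : S → ℝ} (hq1 : ∑ s, q s = 1) {Y : S → E}
    (hY : ∑ s, q s • Y s = 0) : ∀ N : ℕ,
    ∑ x : Fin N → S, seqWeight q x • ∑ n, Y (x n) = 0
  | 0 => by simp
  | N + 1 => by
    rw [sum_seq_succ]
    simp only [seqWeight_cons, Fin.sum_univ_succ, Fin.cons_zero, Fin.cons_succ, smul_add,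
      Finset.sum_add_distrib, mul_smul]
    have h1 : ∑ s, ∑ y : Fin N → S, q s • seqWeight q y • Y s = 0 := by
      simp_rw [smul_comm (q _), ← Finset.sum_smul, sum_seqWeight hq1, one_smul, hY]
    have h2 : ∑ s, ∑ y : Fin N → S, q s • seqWeight q y • ∑ n, Y (y n) = 0 := by
      simp_rw [← Finset.smul_sum, sum_seqWeight_smul_sum hq1 hY N, smul_zero]
      simp
    rw [h1, h2, add_zero]

/-- The second moment of a sum of independent centered vectors. -/
lemma sum_seqWeight_norm_sq {q : S → ℝ} (hq1 : ∑ s, q s = 1) {Y : S → E}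
    (hY : ∑ s, q s • Y s = 0) : ∀ N : ℕ,
    ∑ x : Fin N → S, seqWeight q x * ‖∑ n, Y (x n)‖ ^ 2 = N * ∑ s, q s * ‖Y s‖ ^ 2
  | 0 => by simp
  | N + 1 => by
    rw [sum_seq_succ]
    have hcross : ∀ s, ∑ y : Fin N → S, seqWeight q y * inner ℝ (Y s) (∑ n, Y (y n)) = 0 := by
      intro s
      have h : ∑ y : Fin N → S, seqWeight q y * inner ℝ (Y s) (∑ n, Y (y n)) =
          inner ℝ (Y s) (∑ y : Fin N → S, seqWeight q y • ∑ n, Y (y n)) := by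
        rw [inner_sum]
        exact Finset.sum_congr rfl fun y _ => (inner_smul_right _ _ _).symm
      rw [h, sum_seqWeight_smul_sum hq1 hY N, inner_zero_right]
    calc ∑ s, ∑ y : Fin N → S, seqWeight q (Fin.cons s y : Fin (N + 1) → S) *
          ‖∑ n, Y ((Fin.cons s y : Fin (N + 1) → S) n)‖ ^ 2
        = ∑ s, (q s * ‖Y s‖ ^ 2 * ∑ y : Fin N → S, seqWeight q y +
          2 * q s * ∑ y : Fin N → S, seqWeight q y * inner ℝ (Y s) (∑ n, Y (y n)) +
          q s * ∑ y : Fin N → S, seqWeight q y * ‖∑ n, Y (y n)‖ ^ 2) := by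
          refine Finset.sum_congr rfl fun s _ => ?_
          rw [Finset.mul_sum, Finset.mul_sum, Finset.mul_sum, ← Finset.sum_add_distrib,
            ← Finset.sum_add_distrib]
          refine Finset.sum_congr rfl fun y _ => ?_
          rw [seqWeight_cons, Fin.sum_univ_succ]
          simp only [Fin.cons_zero, Fin.cons_succ]
          rw [norm_add_sq_real]
          ring
      _ = _ := by
          simp_rw [hcross, sum_seqWeight hq1, sum_seqWeight_norm_sq hq1 hY N, mul_zero, mul_one,
            add_zero, Finset.sum_add_distrib, ← Finset.sum_mul, hq1]
          push_cast
          ring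

/-- A sum of independent centered vectors of bounded spread concentrates. -/
lemma tail_norm_sum {q : S → ℝ} (hq : ∀ s, 0 ≤ q s) (hq1 : ∑ s, q s = 1) {Y : S → E}
    (hY : ∑ s, q s • Y s = 0) (hvar : ∑ s, q s * ‖Y s‖ ^ 2 ≤ 1)
    (hdiff : ∀ s s', ‖Y s - Y s'‖ ≤ Real.sqrt 2) {N : ℕ} (hN : 0 < N) {r : ℝ} (hr : 0 < r) :
    ∑ x : Fin N → S with (1 / Real.sqrt N + r ≤ ‖∑ n, Y (x n)‖ / N), seqWeight q x ≤
      Real.exp (-(N * r ^ 2)) := by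
  have hN' : (0 : ℝ) < N := by exact_mod_cast hN
  set f : (Fin N → S) → ℝ := fun x => ‖∑ n, Y (x n)‖ / N with hf
  set m := ∑ x, seqWeight q x * f x with hm
  -- By Cauchy-Schwarz the mean of the norm is at most the root of its second moment, which is at
  -- most `1 / N` by independence.
  have hmean : m ≤ 1 / Real.sqrt N := by
    have hsq : m ^ 2 ≤ ∑ x, seqWeight q x * f x ^ 2 := by
      have h := Finset.sum_mul_sq_le_sq_mul_sq Finset.univ
        (fun x : Fin N → S => Real.sqrt (seqWeight q x))
        (fun x => Real.sqrt (seqWeight q x) * f x)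
      simp only [mul_pow, ← mul_assoc, Real.sq_sqrt (seqWeight_nonneg hq _),
        Real.mul_self_sqrt (seqWeight_nonneg hq _), sum_seqWeight hq1, one_mul] at h
      exact h
    have hval : ∑ x, seqWeight q x * f x ^ 2 ≤ 1 / N := by
      have h := sum_seqWeight_norm_sq hq1 hY N
      have h2 : ∑ x, seqWeight q x * f x ^ 2 =
          (∑ x : Fin N → S, seqWeight q x * ‖∑ n, Y (x n)‖ ^ 2) / N ^ 2 := by
        rw [Finset.sum_div]
        refine Finset.sum_congr rfl fun x _ => ?_
        simp only [hf, div_pow]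
        ring
      rw [h2, h, div_le_div_iff₀ (by positivity) hN']
      nlinarith [mul_le_mul_of_nonneg_left hvar (sq_nonneg (N : ℝ))]
    rw [← Real.sqrt_one, ← Real.sqrt_div zero_le_one]
    exact Real.le_sqrt_of_sq_le (hsq.trans hval)
  have hbd : ∀ x y n, (∀ k, k ≠ n → x k = y k) → f x - f y ≤ Real.sqrt 2 / N := by
    intro x y n hxy
    rw [hf]
    simp only
    rw [← sub_div]
    gcongr
    refine (norm_sub_norm_le _ _).trans ?_
    rw [← Finset.sum_sub_distrib, Finset.sum_eq_single n]
    · exact hdiff _ _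
    · intro k _ hk
      rw [hxy k hk, sub_self]
    · simp
  -- `t = 2 * N * r` minimizes the Chernoff exponent `t ^ 2 / (4 * N) - t * r`.
  have hmgf := mcdiarmid_mgf hq hq1 (by positivity) (2 * N * r) f hbd
  rw [← hm] at hmgf
  have hexp : (N : ℝ) * ((Real.sqrt 2 / N) ^ 2 * (2 * N * r) ^ 2 / 8) = N * r ^ 2 := by
    rw [div_pow, Real.sq_sqrt (by norm_num)]
    field_simp
    ring
  rw [hexp] at hmgf
  have hcheb : (∑ x : Fin N → S with (1 / Real.sqrt N + r ≤ ‖∑ n, Y (x n)‖ / N), seqWeight q x) *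
      Real.exp (2 * N * r * r) ≤ ∑ x, seqWeight q x * Real.exp (2 * N * r * (f x - m)) := by
    rw [Finset.sum_mul]
    refine (Finset.sum_le_sum fun x hx => ?_).trans (Finset.sum_le_sum_of_subset_of_nonneg
      (Finset.filter_subset _ _) fun x _ _ => mul_nonneg (seqWeight_nonneg hq x)
        (Real.exp_pos _).le)
    refine mul_le_mul_of_nonneg_left (Real.exp_le_exp.2 ?_) (seqWeight_nonneg hq x)
    have := (Finset.mem_filter.1 hx).2
    have hfx : r ≤ f x - m := by simp only [hf]; linarith
    exact mul_le_mul_of_nonneg_left hfx (by positivity)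
  have h := hcheb.trans hmgf
  rw [← le_div_iff₀ (Real.exp_pos _), ← Real.exp_sub] at h
  refine h.trans (Real.exp_le_exp.2 (le_of_eq (by ring)))

end Concentration

/-! ### Empirical frequencies as averages of one-hot vectors -/

section Frequencies

variable {S ι : Type*} [DecidableEq ι]

/-- The frequency of the label `a` in the sample `x`, where samples are labelled by `g`. -/
def freq (g : S → ι) {N : ℕ} (x : Fin N → S) (a : ι) : ℝ :=
  (N : ℝ)⁻¹ * ∑ n, if g (x n) = a then 1 else 0

/-- The probability of the label `a`. -/
def labelProb [Fintype S] (q : S → ℝ) (g : S → ι) (a : ι) : ℝ :=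
  ∑ s, q s * if g s = a then 1 else 0

variable [Fintype S] [Fintype ι]

/-- Empirical frequencies are close to the probabilities, in Euclidean norm. -/
lemma tail_freq {q : S → ℝ} (hq : ∀ s, 0 ≤ q s) (hq1 : ∑ s, q s = 1) (g : S → ι) {N : ℕ}
    (hN : 0 < N) {r : ℝ} (hr : 0 < r) :
    ∑ x : Fin N → S with
      (1 / Real.sqrt N + r ≤ Real.sqrt (∑ a, (freq g x a - labelProb q g a) ^ 2)),
      seqWeight q x ≤ Real.exp (-(N * r ^ 2)) := by
  have hN' : (N : ℝ) ≠ 0 := by exact_mod_cast hN.ne'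
  -- One-hot vectors have norm one and mutual distance at most `√2`, so neither the variance nor the
  -- spread depends on the number of labels.
  set e : S → EuclideanSpace ℝ ι := fun s => EuclideanSpace.single (g s) 1 with he
  set π : EuclideanSpace ℝ ι := ∑ s, q s • e s with hπ
  have hπa : ∀ a, π a = labelProb q g a := by
    intro a
    simp [hπ, he, labelProb, Pi.single_apply, eq_comm]
  have hY : ∑ s, q s • (e s - π) = 0 := by
    simp_rw [smul_sub]
    rw [Finset.sum_sub_distrib, ← Finset.sum_smul, hq1, one_smul, sub_self]
  have hvar : ∑ s, q s * ‖e s - π‖ ^ 2 ≤ 1 := by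
    have h1 : ∀ s, q s * ‖e s - π‖ ^ 2 = q s - 2 * inner ℝ (q s • e s) π + q s * ‖π‖ ^ 2 := by
      intro s
      rw [norm_sub_sq_real, inner_smul_left]
      simp [he]
      ring
    simp_rw [h1]
    rw [Finset.sum_add_distrib, Finset.sum_sub_distrib, ← Finset.mul_sum, ← sum_inner,
      ← Finset.sum_mul, hq1, ← hπ, real_inner_self_eq_norm_sq]
    nlinarith [sq_nonneg ‖π‖]
  have hdiff : ∀ s s', ‖(e s - π) - (e s' - π)‖ ≤ Real.sqrt 2 := by
    intro s s'
    rw [sub_sub_sub_cancel_right]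
    by_cases h : g s = g s'
    · simp [he, h]
    · refine Real.le_sqrt_of_sq_le ?_
      rw [norm_sub_sq_real]
      simp [he, EuclideanSpace.inner_single_left, h]
      norm_num
  refine le_of_eq_of_le ?_ (tail_norm_sum hq hq1 hY hvar hdiff hN hr)
  congr 1
  refine Finset.filter_congr fun x _ => ?_
  have hnorm : Real.sqrt (∑ a, (freq g x a - labelProb q g a) ^ 2) =
      ‖∑ n, (e (x n) - π)‖ / N := by
    have h1 : ‖∑ n, (e (x n) - π)‖ / N = ‖(N : ℝ)⁻¹ • ∑ n, (e (x n) - π)‖ := by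
      rw [norm_smul, norm_inv, Real.norm_natCast]; field_simp
    rw [h1, EuclideanSpace.norm_eq]
    congr 1
    refine Finset.sum_congr rfl fun a _ => ?_
    rw [Real.norm_eq_abs, sq_abs]
    congr 1
    simp only [PiLp.smul_apply, Finset.sum_sub_distrib, PiLp.sub_apply, Finset.sum_const,
      Finset.card_univ, Fintype.card_fin, smul_eq_mul, mul_sub, freq, WithLp.ofLp_sum,
      Finset.sum_apply]
    congr 1
    · congr 1
      refine Finset.sum_congr rfl fun n _ => ?_
      simp [he, eq_comm]
    · rw [hπa, nsmul_eq_mul, ← mul_assoc, inv_mul_cancel₀ hN', one_mul]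
  rw [hnorm]

end Frequencies

/-! ### From independent samples to simultaneous frequency bounds -/

section Sampling

variable {S : Type*} [Fintype S] [MeasurableSpace S] [MeasurableSingletonClass S]

/-- Probabilities of events about independent samples, as finite sums. -/
lemma prob_sample_eq_sum {Ω : Type*} [MeasurableSpace Ω] {P : Measure Ω} [IsProbabilityMeasure P]
    {N : ℕ} {X : Fin N → Ω → S} (hX : ∀ n, Measurable (X n)) {ν : Measure S}
    (hlaw : ∀ n, P.map (X n) = ν) (hindep : iIndepFun X P) (p : (Fin N → S) → Prop)
    [DecidablePred p] :
    P.real {ω | p fun n => X n ω} = ∑ x with p x, seqWeight (fun s => ν.real {s}) x := by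
  have hmeas : Measurable fun ω n => X n ω := measurable_pi_iff.2 hX
  have hpi := (iIndepFun_iff_map_fun_eq_pi_map fun n => (hX n).aemeasurable).1 hindep
  have hpre : {ω | p fun n => X n ω} =
      (fun ω n => X n ω) ⁻¹' (Finset.univ.filter p : Finset (Fin N → S)) := by
    ext ω; simp
  have hms : ∀ A : Set (Fin N → S), MeasurableSet A := fun A => A.toFinite.measurableSet
  have : ∀ n, IsProbabilityMeasure (P.map (X n)) :=
    fun n => Measure.isProbabilityMeasure_map (hX n).aemeasurable
  rw [hpre, ← map_measureReal_apply hmeas (hms _), hpi, ← sum_measureReal_singleton]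
  refine Finset.sum_congr rfl fun x _ => ?_
  rw [Measure.real, Measure.pi_singleton, ENNReal.toReal_prod]
  simp [seqWeight, hlaw, Measure.real]

/-- Three families of frequencies are simultaneously close to the corresponding probabilities. -/
lemma three_freq_close {ι₁ ι₂ ι₃ : Type} [Fintype ι₁] [Fintype ι₂] [Fintype ι₃] [DecidableEq ι₁]
    [DecidableEq ι₂] [DecidableEq ι₃] (g₁ : S → ι₁) (g₂ : S → ι₂) (g₃ : S → ι₃)
    {Ω : Type*} [MeasurableSpace Ω] {P : Measure Ω} [IsProbabilityMeasure P]
    {N : ℕ} (hN : 0 < N) {X : Fin N → Ω → S} (hX : ∀ n, Measurable (X n)) {ν : Measure S}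
    (hlaw : ∀ n, P.map (X n) = ν) (hindep : iIndepFun X P) {δ : ℝ} (hδ₀ : 0 < δ) (hδ₁ : δ < 1) :
    1 - δ < P.real {ω |
      Real.sqrt (∑ a, (freq g₁ (fun n => X n ω) a - labelProb (fun s => ν.real {s}) g₁ a) ^ 2) ≤
        6 / 5 * (1 + Real.sqrt (Real.log (3 / δ))) / Real.sqrt N ∧
      Real.sqrt (∑ a, (freq g₂ (fun n => X n ω) a - labelProb (fun s => ν.real {s}) g₂ a) ^ 2) ≤
        6 / 5 * (1 + Real.sqrt (Real.log (3 / δ))) / Real.sqrt N ∧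
      Real.sqrt (∑ a, (freq g₃ (fun n => X n ω) a - labelProb (fun s => ν.real {s}) g₃ a) ^ 2) ≤
        6 / 5 * (1 + Real.sqrt (Real.log (3 / δ))) / Real.sqrt N} := by
  classical
  have hN' : (0 : ℝ) < N := by exact_mod_cast hN
  have hsN : 0 < Real.sqrt N := Real.sqrt_pos.2 hN'
  have hν : IsProbabilityMeasure ν := by
    rw [← hlaw ⟨0, hN⟩]; exact Measure.isProbabilityMeasure_map (hX _).aemeasurable
  set q : S → ℝ := fun s => ν.real {s} with hq
  have hq0 : ∀ s, 0 ≤ q s := fun s => measureReal_nonneg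
  have hq1 : ∑ s, q s = 1 := by
    simp [hq]
  have hL : 0 < Real.log (3 / δ) := Real.log_pos (by rw [lt_div_iff₀ hδ₀]; linarith)
  set ℓ := Real.sqrt (Real.log (3 / δ)) with hℓ
  have hℓ0 : 0 < ℓ := Real.sqrt_pos.2 hL
  have hℓ2 : ℓ ^ 2 = Real.log (3 / δ) := Real.sq_sqrt hL.le
  set R := 6 / 5 * (1 + ℓ) / Real.sqrt N with hR
  -- `r` is what remains of the radius `R` after the mean term `1 / √N`. Since `1 / 5 + 6 / 5 * ℓ`
  -- strictly exceeds `ℓ`, each of the three failure probabilities is strictly below `δ / 3`.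
  set r := (1 / 5 + 6 / 5 * ℓ) / Real.sqrt N with hr
  have hr0 : 0 < r := by positivity
  have hRr : R = 1 / Real.sqrt N + r := by rw [hR, hr]; field_simp; ring
  have hexp : Real.exp (-(N * r ^ 2)) < δ / 3 := by
    have h1 : (N : ℝ) * r ^ 2 = (1 / 5 + 6 / 5 * ℓ) ^ 2 := by
      rw [hr, div_pow, Real.sq_sqrt hN'.le]; field_simp
    have h2 : Real.exp (-Real.log (3 / δ)) = δ / 3 := by
      rw [Real.exp_neg, Real.exp_log (by positivity), inv_div]
    rw [h1, ← h2, Real.exp_lt_exp, ← hℓ2]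
    nlinarith
  have htail : ∀ {ι : Type} [Fintype ι] [DecidableEq ι] (g : S → ι),
      P.real {ω | ¬ Real.sqrt (∑ a, (freq g (fun n => X n ω) a - labelProb q g a) ^ 2) ≤ R} <
        δ / 3 := by
    intro ι _ _ g
    refine lt_of_le_of_lt ?_ hexp
    refine le_trans ?_ (tail_freq hq0 hq1 g hN hr0)
    rw [← prob_sample_eq_sum hX hlaw hindep]
    refine measureReal_mono (fun ω hω => ?_) (measure_ne_top _ _)
    simp only [Set.mem_ofPred_eq, not_le] at hω ⊢
    rw [← hRr]; exact hω.le
  have hcover : (Set.univ : Set Ω) ⊆ {ω |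
      Real.sqrt (∑ a, (freq g₁ (fun n => X n ω) a - labelProb q g₁ a) ^ 2) ≤ R ∧
      Real.sqrt (∑ a, (freq g₂ (fun n => X n ω) a - labelProb q g₂ a) ^ 2) ≤ R ∧
      Real.sqrt (∑ a, (freq g₃ (fun n => X n ω) a - labelProb q g₃ a) ^ 2) ≤ R} ∪
      ({ω | ¬ Real.sqrt (∑ a, (freq g₁ (fun n => X n ω) a - labelProb q g₁ a) ^ 2) ≤ R} ∪
      ({ω | ¬ Real.sqrt (∑ a, (freq g₂ (fun n => X n ω) a - labelProb q g₂ a) ^ 2) ≤ R} ∪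
      {ω | ¬ Real.sqrt (∑ a, (freq g₃ (fun n => X n ω) a - labelProb q g₃ a) ^ 2) ≤ R})) := by
    intro ω _
    simp only [Set.mem_union, Set.mem_ofPred_eq]
    tauto
  have h1 := measureReal_mono (μ := P) hcover (measure_ne_top _ _)
  have h2 := h1.trans ((measureReal_union_le _ _).trans (add_le_add_right
    ((measureReal_union_le _ _).trans (add_le_add_right (measureReal_union_le _ _) _)) _))
  rw [probReal_univ] at h2
  have := htail g₁
  have := htail g₂
  have := htail g₃
  linarith

end Sampling

/-! ### Population moments -/

lemma sum_fin_three_arrow {d : ℕ} {M : Type*} [AddCommMonoid M] (F : (Fin 3 → Fin d) → M) :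
    ∑ w, F w = ∑ a, ∑ b, ∑ c, F ![a, b, c] := by
  let e : (Fin 3 → Fin d) ≃ Fin d × Fin d × Fin d :=
    { toFun := fun w => (w 0, w 1, w 2)
      invFun := fun p => ![p.1, p.2.1, p.2.2]
      left_inv := fun w => by ext i; fin_cases i <;> rfl
      right_inv := fun p => rfl }
  rw [← e.symm.sum_comp, Fintype.sum_prod_type]
  refine Finset.sum_congr rfl fun a _ => ?_
  rw [Fintype.sum_prod_type]
  rfl

/-- The second moment `E[hᵢ hⱼ]` of the Dirichlet distribution. -/
def dirichletSecond {k : ℕ} (α : Fin k → ℝ) (i j : Fin k) : ℝ :=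
  α i / (∑ a, α a) * ((α j + Pi.single (M := fun _ => ℝ) i 1 j) / (∑ a, α a + 1))

section Moments

variable {d k : ℕ} (α : Fin k → ℝ) (O : Matrix (Fin d) (Fin k) ℝ)

/-- The mean of `x₁`. -/
def popMean (a : Fin d) : ℝ := ∑ i, α i / (∑ j, α j) * O a i

/-- The mean of `x₁ x₂ᵀ`. -/
def popSecond (a b : Fin d) : ℝ := ∑ i, ∑ j, dirichletSecond α i j * (O a i * O b j)

/-- The mean of `x₁ ⊗ x₂ ⊗ x₃`. -/
def popThird (a b c : Fin d) : ℝ :=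
  ∑ i, ∑ j, ∑ l, dirichletThird α i j l * (O a i * O b j * O c l)

variable {α O}

lemma sum_dirichletThird (hα : ∀ i, 0 < α i) (i j : Fin k) :
    ∑ l, dirichletThird α i j l = dirichletSecond α i j := by
  have hs : 0 < ∑ a, α a := Finset.sum_pos (fun i _ => hα i) ⟨i, Finset.mem_univ i⟩
  have h : ∑ l, (α l + Pi.single (M := fun _ => ℝ) i 1 l + Pi.single (M := fun _ => ℝ) j 1 l) =
      ∑ a, α a + 2 := by
    simp [Finset.sum_add_distrib]; ring
  simp only [dirichletThird, dirichletSecond]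
  rw [← Finset.mul_sum, ← Finset.sum_div, h, div_self (by linarith), mul_one]

lemma sum_dirichletSecond (hα : ∀ i, 0 < α i) (i : Fin k) :
    ∑ j, dirichletSecond α i j = α i / ∑ a, α a := by
  have hs : 0 < ∑ a, α a := Finset.sum_pos (fun i _ => hα i) ⟨i, Finset.mem_univ i⟩
  have h : ∑ l, (α l + Pi.single (M := fun _ => ℝ) i 1 l) = ∑ a, α a + 1 := by
    simp [Finset.sum_add_distrib]
  simp only [dirichletSecond]
  rw [← Finset.mul_sum, ← Finset.sum_div, h, div_self (by linarith), mul_one]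

lemma sum_popThird (hα : ∀ i, 0 < α i) (hO : IsTopicMatrix O) (a b : Fin d) :
    ∑ c, popThird α O a b c = popSecond α O a b := by
  simp only [popThird, popSecond]
  rw [Finset.sum_comm]
  refine Finset.sum_congr rfl fun i _ => ?_
  rw [Finset.sum_comm]
  refine Finset.sum_congr rfl fun j _ => ?_
  rw [Finset.sum_comm, ← sum_dirichletThird hα, Finset.sum_mul]
  refine Finset.sum_congr rfl fun l _ => ?_
  rw [← Finset.mul_sum, ← Finset.mul_sum, hO.sum_col, mul_one]

lemma sum_popSecond (hα : ∀ i, 0 < α i) (hO : IsTopicMatrix O) (a : Fin d) :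
    ∑ b, popSecond α O a b = popMean α O a := by
  simp only [popMean, popSecond]
  rw [Finset.sum_comm]
  refine Finset.sum_congr rfl fun i _ => ?_
  rw [Finset.sum_comm, ← sum_dirichletSecond hα, Finset.sum_mul]
  refine Finset.sum_congr rfl fun j _ => ?_
  rw [← Finset.mul_sum, ← Finset.mul_sum, hO.sum_col, mul_one]

lemma labelProb_third (a b c : Fin d) :
    labelProb (documentProb α O) (fun w => (w 0, w 1, w 2)) (a, b, c) = popThird α O a b c := by
  rw [labelProb, Finset.sum_eq_single ![a, b, c]]
  · simp [documentProb, popThird]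
  · intro w _ hw
    rw [if_neg, mul_zero]
    intro h
    apply hw
    simp only [Prod.mk.injEq] at h
    ext i
    fin_cases i
    · simp [h.1]
    · simp [h.2.1]
    · simp [h.2.2]
  · simp

lemma labelProb_second (hα : ∀ i, 0 < α i) (hO : IsTopicMatrix O) (a b : Fin d) :
    labelProb (documentProb α O) (fun w => (w 0, w 1)) (a, b) = popSecond α O a b := by
  rw [← sum_popThird hα hO, labelProb, sum_fin_three_arrow, Finset.sum_eq_single a,
    Finset.sum_eq_single b]
  · simp [documentProb, popThird]
  · intro b' _ hb; simp [hb]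
  · simp
  · intro a' _ ha; simp [ha]
  · simp

lemma labelProb_first (hα : ∀ i, 0 < α i) (hO : IsTopicMatrix O) (a : Fin d) :
    labelProb (documentProb α O) (fun w => w 0) a = popMean α O a := by
  rw [← sum_popSecond hα hO, labelProb, sum_fin_three_arrow, Finset.sum_eq_single a]
  · simp_rw [← sum_popThird hα hO]
    simp [documentProb, popThird]
  · intro a' _ ha; simp [ha]
  · simp

/-- The numerator of `E[hᵢ hⱼ]` is `αᵢ αⱼ` plus a Kronecker term. The factor `α₀ / (α₀ + 1)` scales
the product of the means to cancel exactly `αᵢ αⱼ`. -/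
lemma pairs_coefficient (hα : ∀ i, 0 < α i) (i j : Fin k) :
    dirichletSecond α i j - (∑ a, α a) / (∑ a, α a + 1) *
      (α i / (∑ a, α a) * (α j / (∑ a, α a))) =
      if i = j then α i / (∑ a, α a) / (∑ a, α a + 1) else 0 := by
  have hs : 0 < ∑ a, α a := Finset.sum_pos (fun i _ => hα i) ⟨i, Finset.mem_univ i⟩
  have h1 : ∑ a, α a + 1 ≠ 0 := by linarith
  simp only [dirichletSecond, Pi.single_apply, eq_comm (a := j)]
  split_ifs with h
  · subst h; field_simp; ring
  · field_simp; ring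

/-- The modified second moment is diagonal in the topics. -/
lemma popSecond_sub (hα : ∀ i, 0 < α i) (a b : Fin d) :
    popSecond α O a b - (∑ a, α a) / (∑ a, α a + 1) * (popMean α O a * popMean α O b) =
      ∑ i, α i / (∑ a, α a) / (∑ a, α a + 1) * (O a i * O b i) := by
  have h : (∑ a, α a) / (∑ a, α a + 1) * (popMean α O a * popMean α O b) =
      ∑ i, ∑ j, (∑ a, α a) / (∑ a, α a + 1) * (α i / (∑ a, α a) * (α j / (∑ a, α a))) *
        (O a i * O b j) := by
    rw [popMean, popMean, Finset.sum_mul_sum, Finset.mul_sum]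
    refine Finset.sum_congr rfl fun i _ => ?_
    rw [Finset.mul_sum]
    refine Finset.sum_congr rfl fun j _ => ?_
    ring
  rw [h, popSecond, ← Finset.sum_sub_distrib]
  refine Finset.sum_congr rfl fun i _ => ?_
  rw [← Finset.sum_sub_distrib]
  simp_rw [← sub_mul, pairs_coefficient hα]
  simp

/-- The numerator of `E[hᵢ hⱼ hₗ]` consists of `αᵢ αⱼ αₗ`, quadratic terms for each coincidence of
two indices, and `2 αᵢ` if all three agree. The corrections by products of lower moments cancel all
but the last. -/
lemma triples_coefficient (hα : ∀ i, 0 < α i) (i j l : Fin k) :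
    dirichletThird α i j l - (∑ a, α a) / (∑ a, α a + 2) *
        (dirichletSecond α i l * (α j / ∑ a, α a) + (α i / ∑ a, α a) * dirichletSecond α l j +
          (α l / ∑ a, α a) * dirichletSecond α i j) +
      2 * (∑ a, α a) ^ 2 / ((∑ a, α a + 2) * (∑ a, α a + 1)) *
        ((α l / ∑ a, α a) * ((α i / ∑ a, α a) * (α j / ∑ a, α a))) =
      if i = j then (if i = l then
        2 / (∑ a, α a + 2) * (α i / (∑ a, α a) / (∑ a, α a + 1)) else 0) else 0 := by
  have hs : 0 < ∑ a, α a := Finset.sum_pos (fun i _ => hα i) ⟨i, Finset.mem_univ i⟩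
  have h1 : ∑ a, α a + 1 ≠ 0 := by linarith
  have h2 : ∑ a, α a + 2 ≠ 0 := by linarith
  simp only [dirichletSecond, dirichletThird, Pi.single_apply]
  by_cases hij : i = j
  · subst hij
    by_cases hil : i = l
    · subst hil; simp only [if_true]; field_simp; ring
    · simp only [if_true, if_neg hil, if_neg (Ne.symm hil)]; field_simp; ring
  · by_cases hil : i = l
    · subst hil
      simp only [if_true, if_neg hij, if_neg (Ne.symm hij)]; field_simp; ring
    · by_cases hjl : j = l
      · subst hjl
        simp only [if_true, if_neg hij, if_neg (Ne.symm hij)]; field_simp; ring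
      · simp only [if_neg hij, if_neg (Ne.symm hij), if_neg hil, if_neg (Ne.symm hil), if_neg hjl,
          if_neg (Ne.symm hjl)]
        field_simp; ring

/-- The modified third moment is diagonal in the topics. -/
lemma popThird_sub (hα : ∀ i, 0 < α i) (a b c : Fin d) :
    popThird α O a b c - (∑ a, α a) / (∑ a, α a + 2) *
        (popSecond α O a c * popMean α O b + popMean α O a * popSecond α O c b +
          popMean α O c * popSecond α O a b) +
      2 * (∑ a, α a) ^ 2 / ((∑ a, α a + 2) * (∑ a, α a + 1)) *
        (popMean α O c * (popMean α O a * popMean α O b)) =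
      ∑ i, 2 / (∑ a, α a + 2) * (α i / (∑ a, α a) / (∑ a, α a + 1)) *
        (O a i * O b i * O c i) := by
  have h1 : popSecond α O a c * popMean α O b =
      ∑ i, ∑ j, ∑ l, dirichletSecond α i l * (α j / ∑ a, α a) * (O a i * O b j * O c l) := by
    rw [popSecond, popMean, Finset.sum_mul]
    refine Finset.sum_congr rfl fun i _ => ?_
    rw [Finset.sum_mul_sum, Finset.sum_comm]
    exact Finset.sum_congr rfl fun j _ => Finset.sum_congr rfl fun l _ => by ring
  have h2 : popMean α O a * popSecond α O c b =
      ∑ i, ∑ j, ∑ l, (α i / ∑ a, α a) * dirichletSecond α l j * (O a i * O b j * O c l) := by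
    rw [popSecond, popMean, Finset.sum_comm, Finset.sum_mul]
    refine Finset.sum_congr rfl fun i _ => ?_
    rw [Finset.mul_sum]
    refine Finset.sum_congr rfl fun j _ => ?_
    rw [Finset.mul_sum]
    exact Finset.sum_congr rfl fun l _ => by ring
  have h3 : popMean α O c * popSecond α O a b =
      ∑ i, ∑ j, ∑ l, (α l / ∑ a, α a) * dirichletSecond α i j * (O a i * O b j * O c l) := by
    rw [popSecond, popMean, mul_comm, Finset.sum_mul]
    refine Finset.sum_congr rfl fun i _ => ?_
    rw [Finset.sum_mul_sum]
    exact Finset.sum_congr rfl fun j _ => Finset.sum_congr rfl fun l _ => by ring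
  have h4 : popMean α O c * (popMean α O a * popMean α O b) =
      ∑ i, ∑ j, ∑ l, ((α l / ∑ a, α a) * ((α i / ∑ a, α a) * (α j / ∑ a, α a))) *
        (O a i * O b j * O c l) := by
    rw [mul_comm]
    simp only [popMean]
    rw [Finset.sum_mul_sum, Finset.sum_mul]
    refine Finset.sum_congr rfl fun i _ => ?_
    rw [Finset.sum_mul_sum]
    exact Finset.sum_congr rfl fun j _ => Finset.sum_congr rfl fun l _ => by ring
  rw [h1, h2, h3, h4, popThird]
  simp only [← Finset.sum_add_distrib, ← Finset.sum_sub_distrib, Finset.mul_sum]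
  have hterm : ∀ i j l, dirichletThird α i j l * (O a i * O b j * O c l) -
      (∑ a, α a) / (∑ a, α a + 2) *
        (dirichletSecond α i l * (α j / ∑ a, α a) * (O a i * O b j * O c l) +
          (α i / ∑ a, α a) * dirichletSecond α l j * (O a i * O b j * O c l) +
          (α l / ∑ a, α a) * dirichletSecond α i j * (O a i * O b j * O c l)) +
      2 * (∑ a, α a) ^ 2 / ((∑ a, α a + 2) * (∑ a, α a + 1)) *
        ((α l / ∑ a, α a) * ((α i / ∑ a, α a) * (α j / ∑ a, α a)) * (O a i * O b j * O c l)) =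
      if i = j then (if i = l then
        2 / (∑ a, α a + 2) * (α i / (∑ a, α a) / (∑ a, α a + 1)) * (O a i * O b j * O c l)
          else 0) else 0 := by
    intro i j l
    have := triples_coefficient hα i j l
    have h5 : ∀ x y z w u t s v : ℝ, x * w - y * (z * w + u * w + t * w) + s * (v * w) =
      (x - y * (z + u + t) + s * v) * w := by intros; ring
    rw [h5, this]
    split_ifs <;> simp
  simp_rw [hterm]
  refine Finset.sum_congr rfl fun i _ => ?_
  rw [Finset.sum_eq_single i]
  · simp
  · intro j _ hj; simp [Ne.symm hj]
  · simp

end Moments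

/-! ### Euclidean norms -/

section L2

variable {ι ι' κ : Type*} [Fintype ι] [Fintype ι'] [Fintype κ]

/-- The Euclidean norm of a vector of reals. -/
def l2 (x : ι → ℝ) : ℝ := ‖WithLp.toLp 2 x‖

lemma l2_eq_sqrt (x : ι → ℝ) : l2 x = Real.sqrt (∑ i, x i ^ 2) := by
  rw [l2, EuclideanSpace.norm_eq]; simp

lemma l2_nonneg (x : ι → ℝ) : 0 ≤ l2 x := norm_nonneg _

lemma l2_sq (x : ι → ℝ) : l2 x ^ 2 = ∑ i, x i ^ 2 := by
  rw [l2_eq_sqrt, Real.sq_sqrt (Finset.sum_nonneg fun i _ => sq_nonneg _)]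

lemma l2_sq_eq_dotProduct (x : ι → ℝ) : l2 x ^ 2 = x ⬝ᵥ x := by
  rw [l2_sq, dotProduct]; exact Finset.sum_congr rfl fun i _ => sq _

lemma l2_add_le (x y : ι → ℝ) : l2 (x + y) ≤ l2 x + l2 y := by
  simpa [l2] using norm_add_le (WithLp.toLp 2 x) (WithLp.toLp 2 y)

lemma l2_sub_le (x y : ι → ℝ) : l2 (x - y) ≤ l2 x + l2 y := by
  simpa [l2] using norm_sub_le (WithLp.toLp 2 x) (WithLp.toLp 2 y)

lemma l2_smul (c : ℝ) (x : ι → ℝ) : l2 (c • x) = |c| * l2 x := by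
  simp [l2, norm_smul]

lemma l2_neg (x : ι → ℝ) : l2 (-x) = l2 x := by
  simp [l2]

lemma abs_dotProduct_le (x y : ι → ℝ) : |x ⬝ᵥ y| ≤ l2 x * l2 y := by
  have h := abs_real_inner_le_norm (WithLp.toLp 2 x) (WithLp.toLp 2 y)
  rw [EuclideanSpace.inner_toLp_toLp] at h
  simpa [dotProduct_comm, l2] using h

lemma abs_apply_le_l2 (x : ι → ℝ) (i : ι) : |x i| ≤ l2 x := by
  rw [l2_eq_sqrt]
  refine Real.abs_le_sqrt ?_
  exact Finset.single_le_sum (f := fun i => x i ^ 2) (fun i _ => sq_nonneg _) (Finset.mem_univ i)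

lemma l2_le_of_sq_le {x : ι → ℝ} {c : ℝ} (hc : 0 ≤ c) (h : l2 x ^ 2 ≤ c ^ 2) : l2 x ≤ c :=
  le_of_sq_le_sq h hc

lemma l2_le_one_of_sum_eq_one {x : ι → ℝ} (hx : ∀ i, 0 ≤ x i) (hs : ∑ i, x i = 1) : l2 x ≤ 1 := by
  refine l2_le_of_sq_le zero_le_one ?_
  rw [l2_sq, one_pow, ← hs]
  refine Finset.sum_le_sum fun i _ => ?_
  have : x i ≤ 1 := hs ▸ Finset.single_le_sum (fun i _ => hx i) (Finset.mem_univ i)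
  nlinarith [hx i]

/-- The Euclidean norm of an elementary tensor. -/
lemma l2_tensor (e : κ ≃ ι × ι') (f : ι → ℝ) (g : ι' → ℝ) :
    l2 (fun p => f (e p).1 * g (e p).2) = l2 f * l2 g := by
  rw [l2_eq_sqrt, l2_eq_sqrt, l2_eq_sqrt, ← Real.sqrt_mul (Finset.sum_nonneg fun i _ => sq_nonneg _),
    e.sum_comp (fun p : ι × ι' => (f p.1 * g p.2) ^ 2), Fintype.sum_prod_type, Finset.sum_mul_sum]
  simp_rw [mul_pow]

/-- Telescoping through the mixed product `f ⊗ g'` means that only `f` and `g'` have to be bounded.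
The bijection `e` lets the two factors occupy arbitrary tensor slots. -/
lemma l2_tensor_sub_le (e : κ ≃ ι × ι') {f f' : ι → ℝ} {g g' : ι' → ℝ} {A B : ℝ}
    (hf : l2 f ≤ 1) (hg' : l2 g' ≤ 1) (hA : l2 (f' - f) ≤ A) (hB : l2 (g' - g) ≤ B) :
    l2 (fun p => f' (e p).1 * g' (e p).2 - f (e p).1 * g (e p).2) ≤ A + B := by
  have h : (fun p => f' (e p).1 * g' (e p).2 - f (e p).1 * g (e p).2) =
      (fun p => (f' - f) (e p).1 * g' (e p).2) + fun p => f (e p).1 * (g' - g) (e p).2 := by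
    ext p; simp; ring
  rw [h]
  refine (l2_add_le _ _).trans ?_
  rw [l2_tensor, l2_tensor]
  have h1 := l2_nonneg (f' - f)
  have h2 := l2_nonneg (g' - g)
  have h3 := l2_nonneg f
  have h4 := l2_nonneg g'
  nlinarith

end L2

/-! ### Stability of the modified moments as functions of the raw moments -/

section MomentErrors

variable {d : ℕ}

/-- The modified second moment as a function of the raw moments. -/
def pairTensor (a : ℝ) (μ : Fin d → ℝ) (C : Fin d × Fin d → ℝ) (p : Fin d × Fin d) : ℝ :=
  C p - a * (μ p.1 * μ p.2)

/-- The modified third moment as a function of the raw moments. -/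
def tripleTensor (a b : ℝ) (μ : Fin d → ℝ) (C : Fin d × Fin d → ℝ) (Q : Fin d × Fin d × Fin d → ℝ)
    (p : Fin d × Fin d × Fin d) : ℝ :=
  Q p - a * (C (p.1, p.2.2) * μ p.2.1 + μ p.1 * C (p.2.2, p.2.1) + μ p.2.2 * C (p.1, p.2.1)) +
    b * (μ p.2.2 * (μ p.1 * μ p.2.1))

variable {a b E : ℝ} {μ μ' : Fin d → ℝ} {C C' : Fin d × Fin d → ℝ}
  {Q Q' : Fin d × Fin d × Fin d → ℝ}

/-- The second moment contributes `E`, and the product of two means contributes `2 * E`. -/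
lemma pairTensor_sub_le (ha : 0 ≤ a) (ha1 : a ≤ 1) (hμ : l2 μ ≤ 1) (hμ' : l2 μ' ≤ 1)
    (hdμ : l2 (μ' - μ) ≤ E) (hdC : l2 (C' - C) ≤ E) :
    l2 (pairTensor a μ' C' - pairTensor a μ C) ≤ 3 * E := by
  have h : pairTensor a μ' C' - pairTensor a μ C =
      (C' - C) - a • fun p : Fin d × Fin d => μ' p.1 * μ' p.2 - μ p.1 * μ p.2 := by
    ext p; simp [pairTensor]; ring
  have h1 := l2_tensor_sub_le (Equiv.refl (Fin d × Fin d)) hμ hμ' hdμ hdμ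
  simp only [Equiv.refl_apply] at h1
  rw [h]
  refine (l2_sub_le _ _).trans ?_
  rw [l2_smul, abs_of_nonneg ha]
  have h2 := l2_nonneg fun p : Fin d × Fin d => μ' p.1 * μ' p.2 - μ p.1 * μ p.2
  nlinarith

/-- The third moment contributes `E`, the three products of a mean with a second moment `2 * E`
each, and the triple product of means `3 * E` with a coefficient of at most `2`: in total `1 + 6 + 6
= 13`. -/
lemma tripleTensor_sub_le (ha : 0 ≤ a) (ha1 : a ≤ 1) (hb : 0 ≤ b) (hb2 : b ≤ 2)
    (hμ : l2 μ ≤ 1) (hμ' : l2 μ' ≤ 1) (hC : l2 C ≤ 1) (hC' : l2 C' ≤ 1)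
    (hdμ : l2 (μ' - μ) ≤ E) (hdC : l2 (C' - C) ≤ E) (hdQ : l2 (Q' - Q) ≤ E) :
    l2 (tripleTensor a b μ' C' Q' - tripleTensor a b μ C Q) ≤ 13 * E := by
  -- The three bijections group the slots according to which two of them carry the second moment.
  let e₁ : Fin d × Fin d × Fin d ≃ (Fin d × Fin d) × Fin d :=
    { toFun := fun p => ((p.1, p.2.2), p.2.1)
      invFun := fun p => (p.1.1, p.2, p.1.2)
      left_inv := fun _ => rfl
      right_inv := fun _ => rfl }
  let e₂ : Fin d × Fin d × Fin d ≃ Fin d × (Fin d × Fin d) :=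
    { toFun := fun p => (p.1, (p.2.2, p.2.1))
      invFun := fun p => (p.1, p.2.2, p.2.1)
      left_inv := fun _ => rfl
      right_inv := fun _ => rfl }
  let e₃ : Fin d × Fin d × Fin d ≃ Fin d × (Fin d × Fin d) :=
    { toFun := fun p => (p.2.2, (p.1, p.2.1))
      invFun := fun p => (p.2.1, p.2.2, p.1)
      left_inv := fun _ => rfl
      right_inv := fun _ => rfl }
  set t₁ : Fin d × Fin d × Fin d → ℝ :=
    fun p => C' (e₁ p).1 * μ' (e₁ p).2 - C (e₁ p).1 * μ (e₁ p).2 with ht₁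
  set t₂ : Fin d × Fin d × Fin d → ℝ :=
    fun p => μ' (e₂ p).1 * C' (e₂ p).2 - μ (e₂ p).1 * C (e₂ p).2 with ht₂
  set t₃ : Fin d × Fin d × Fin d → ℝ :=
    fun p => μ' (e₃ p).1 * C' (e₃ p).2 - μ (e₃ p).1 * C (e₃ p).2 with ht₃
  set t₄ : Fin d × Fin d × Fin d → ℝ :=
    fun p => μ' (e₃ p).1 * (fun r : Fin d × Fin d => μ' r.1 * μ' r.2) (e₃ p).2 -
      μ (e₃ p).1 * (fun r : Fin d × Fin d => μ r.1 * μ r.2) (e₃ p).2 with ht₄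
  have h : tripleTensor a b μ' C' Q' - tripleTensor a b μ C Q =
      (Q' - Q) - a • (t₁ + t₂ + t₃) + b • t₄ := by
    ext p
    simp only [tripleTensor, ht₁, ht₂, ht₃, ht₄, e₁, e₂, e₃, Pi.sub_apply, Pi.add_apply,
      Pi.smul_apply, smul_eq_mul, Equiv.coe_fn_mk]
    ring
  have h1 : l2 t₁ ≤ E + E := l2_tensor_sub_le e₁ hC hμ' hdC hdμ
  have h2 : l2 t₂ ≤ E + E := l2_tensor_sub_le e₂ hμ hC' hdμ hdC
  have h3 : l2 t₃ ≤ E + E := l2_tensor_sub_le e₃ hμ hC' hdμ hdC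
  have h4 : l2 t₄ ≤ E + (E + E) := by
    have h5 := l2_tensor (Equiv.refl (Fin d × Fin d)) μ' μ'
    have h6 := l2_tensor_sub_le (Equiv.refl (Fin d × Fin d)) hμ hμ' hdμ hdμ
    simp only [Equiv.refl_apply] at h5 h6
    have h7 : l2 (fun r : Fin d × Fin d => μ' r.1 * μ' r.2) ≤ 1 := by
      rw [h5]
      have := l2_nonneg μ'
      nlinarith
    exact l2_tensor_sub_le e₃ (g := fun r : Fin d × Fin d => μ r.1 * μ r.2)
      (g' := fun r : Fin d × Fin d => μ' r.1 * μ' r.2) hμ h7 hdμ h6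
  have h5 : l2 (t₁ + t₂ + t₃) ≤ 6 * E := by
    have := l2_add_le (t₁ + t₂) t₃
    have := l2_add_le t₁ t₂
    linarith
  rw [h]
  refine (l2_add_le _ _).trans ?_
  have h6 := l2_sub_le (Q' - Q) (a • (t₁ + t₂ + t₃))
  rw [l2_smul, abs_of_nonneg ha] at h6
  rw [l2_smul, abs_of_nonneg hb]
  have h7 := l2_nonneg t₄
  have h8 := l2_nonneg (t₁ + t₂ + t₃)
  nlinarith

/-- Cauchy-Schwarz against the elementary tensor `x ⊗ y ⊗ z`. It turns a Euclidean bound on a tensor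
into a bound on all its contractions. -/
lemma abs_contract_le (A : Fin d × Fin d × Fin d → ℝ) (x y z : Fin d → ℝ) :
    |∑ p : Fin d × Fin d × Fin d, A p * (x p.1 * (y p.2.1 * z p.2.2))| ≤
      l2 A * (l2 x * (l2 y * l2 z)) := by
  have h1 := l2_tensor (Equiv.refl (Fin d × Fin d)) y z
  have h2 := l2_tensor (Equiv.refl (Fin d × (Fin d × Fin d))) x
    (fun r : Fin d × Fin d => y r.1 * z r.2)
  simp only [Equiv.refl_apply] at h1 h2
  rw [← h1, ← h2]
  exact abs_dotProduct_le A fun p => x p.1 * (y p.2.1 * z p.2.2)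

end MomentErrors

/-! ### The modified empirical moments against their population values -/

section EmpiricalErrors

variable {d k N : ℕ}

/-- The weights in the diagonalization of the modified second moment. -/
def topicWeight (α : Fin k → ℝ) (i : Fin k) : ℝ := α i / (∑ a, α a) / (∑ a, α a + 1)

/-- The modified second moment of the population. -/
def popPairs (α : Fin k → ℝ) (O : Matrix (Fin d) (Fin k) ℝ) : Matrix (Fin d) (Fin d) ℝ :=
  O * Matrix.diagonal (topicWeight α) * Oᵀ

/-- The modified third moment of the population, contracted with `η`. -/
def popTriples (α : Fin k → ℝ) (O : Matrix (Fin d) (Fin k) ℝ) (η : Fin d → ℝ) :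
    Matrix (Fin d) (Fin d) ℝ :=
  O * Matrix.diagonal (fun i => 2 / (∑ a, α a + 2) * topicWeight α i * (Oᵀ *ᵥ η) i) * Oᵀ

lemma popPairs_apply (α : Fin k → ℝ) (O : Matrix (Fin d) (Fin k) ℝ) (a b : Fin d) :
    popPairs α O a b = ∑ i, topicWeight α i * (O a i * O b i) := by
  rw [popPairs, Matrix.mul_apply]
  simp only [Matrix.mul_diagonal, Matrix.transpose_apply]
  exact Finset.sum_congr rfl fun i _ => by ring

lemma popTriples_apply (α : Fin k → ℝ) (O : Matrix (Fin d) (Fin k) ℝ) (η : Fin d → ℝ)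
    (a b : Fin d) :
    popTriples α O η a b =
      ∑ c, (∑ i, 2 / (∑ a, α a + 2) * topicWeight α i * (O a i * O b i * O c i)) * η c := by
  rw [popTriples, Matrix.mul_apply]
  simp only [Matrix.mul_diagonal, Matrix.transpose_apply, Matrix.mulVec, dotProduct,
    Finset.sum_mul, Finset.mul_sum]
  rw [Finset.sum_comm]
  exact Finset.sum_congr rfl fun c _ => Finset.sum_congr rfl fun i _ => by ring

lemma empMean_apply (w : Fin N → Fin 3 → Fin d) (a : Fin d) :
    empMean w a = freq (fun s => s 0) w a := by
  simp [empMean, freq, hot, Finset.sum_apply, Pi.single_apply, eq_comm]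

lemma empSecond_apply (w : Fin N → Fin 3 → Fin d) (a b : Fin d) :
    empSecond w a b = freq (fun s => (s 0, s 1)) w (a, b) := by
  simp only [empSecond, freq, hot, Matrix.smul_apply, Matrix.sum_apply, Matrix.vecMulVec_apply,
    smul_eq_mul, Prod.mk.injEq]
  congr 1
  refine Finset.sum_congr rfl fun n _ => ?_
  simp only [Pi.single_apply, eq_comm (a := a) (b := w n 0), eq_comm (a := b) (b := w n 1)]
  by_cases h1 : w n 0 = a <;> by_cases h2 : w n 1 = b <;> simp [h1, h2]

lemma empThird_apply (w : Fin N → Fin 3 → Fin d) (η : Fin d → ℝ) (a b : Fin d) :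
    empThird w η a b = ∑ c, freq (fun s => (s 0, s 1, s 2)) w (a, b, c) * η c := by
  simp only [empThird, freq, hot, Matrix.smul_apply, Matrix.sum_apply, Matrix.vecMulVec_apply,
    smul_eq_mul, Prod.mk.injEq, mul_assoc]
  rw [← Finset.mul_sum]
  congr 1
  simp_rw [Finset.sum_mul]
  rw [Finset.sum_comm]
  refine Finset.sum_congr rfl fun n _ => ?_
  rw [dotProduct_single, mul_one]
  rw [Finset.sum_eq_single (w n 2)]
  · simp only [Pi.single_apply, eq_comm (a := a) (b := w n 0), eq_comm (a := b) (b := w n 1)]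
    by_cases h1 : w n 0 = a <;> by_cases h2 : w n 1 = b <;> simp [h1, h2]
  · intro c _ hc
    simp [hc.symm]
  · simp

lemma freq_nonneg {S ι : Type*} [DecidableEq ι] (g : S → ι) (x : Fin N → S) (a : ι) :
    0 ≤ freq g x a :=
  mul_nonneg (by positivity) (Finset.sum_nonneg fun n _ => by split_ifs <;> norm_num)

lemma sum_freq {S ι : Type*} [DecidableEq ι] [Fintype ι] (hN : 0 < N) (g : S → ι) (x : Fin N → S) :
    ∑ a, freq g x a = 1 := by
  have hN' : (N : ℝ) ≠ 0 := by exact_mod_cast hN.ne'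
  simp only [freq]
  rw [← Finset.mul_sum, Finset.sum_comm]
  simp [hN']

lemma labelProb_nonneg {S ι : Type*} [DecidableEq ι] [Fintype S] {q : S → ℝ} (hq : ∀ s, 0 ≤ q s)
    (g : S → ι) (a : ι) : 0 ≤ labelProb q g a :=
  Finset.sum_nonneg fun s _ => mul_nonneg (hq s) (by split_ifs <;> norm_num)

lemma sum_labelProb {S ι : Type*} [DecidableEq ι] [Fintype ι] [Fintype S] {q : S → ℝ}
    (hq1 : ∑ s, q s = 1) (g : S → ι) : ∑ a, labelProb q g a = 1 := by
  simp only [labelProb]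
  rw [Finset.sum_comm]
  simp [hq1]

lemma empPairs_apply (α₀ : ℝ) (w : Fin N → Fin 3 → Fin d) (a b : Fin d) :
    empPairs α₀ w a b = pairTensor (α₀ / (α₀ + 1)) (freq (fun s => s 0) w)
      (freq (fun s => (s 0, s 1)) w) (a, b) := by
  simp [empPairs, pairTensor, Matrix.vecMulVec_apply, empMean_apply, empSecond_apply]

lemma empTriples_apply (α₀ : ℝ) (w : Fin N → Fin 3 → Fin d) (η : Fin d → ℝ) (a b : Fin d) :
    empTriples α₀ w η a b = ∑ c, tripleTensor (α₀ / (α₀ + 2))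
      (2 * α₀ ^ 2 / ((α₀ + 2) * (α₀ + 1))) (freq (fun s => s 0) w)
      (freq (fun s => (s 0, s 1)) w) (freq (fun s => (s 0, s 1, s 2)) w) (a, b, c) * η c := by
  simp only [empTriples, tripleTensor, Matrix.add_apply, Matrix.sub_apply, Matrix.smul_apply,
    Matrix.vecMulVec_apply, empMean_apply, empSecond_apply, empThird_apply, Matrix.mulVec,
    Matrix.vecMul, dotProduct, smul_eq_mul, add_mul, sub_mul, Finset.sum_add_distrib,
    Finset.sum_sub_distrib, mul_add, Finset.mul_sum, Finset.sum_mul]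
  congr 1
  · congr 1
    refine congrArg₂ _ (congrArg₂ _ ?_ ?_) ?_ <;>
    exact Finset.sum_congr rfl fun c _ => by ring
  · exact Finset.sum_congr rfl fun c _ => by ring

/-- If the raw empirical moments are within `E` of the population moments, then the modified
moments are within a constant multiple of `E`. -/
lemma modified_moment_errors {α : Fin k → ℝ} (hα : ∀ i, 0 < α i) {O : Matrix (Fin d) (Fin k) ℝ}
    (hO : IsTopicMatrix O) (hq1 : ∑ w, documentProb α O w = 1) (hN : 0 < N)
    (w : Fin N → Fin 3 → Fin d) {E : ℝ}
    (h1 : l2 (freq (fun s => s 0) w - labelProb (documentProb α O) fun s => s 0) ≤ E)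
    (h2 : l2 (freq (fun s => (s 0, s 1)) w -
      labelProb (documentProb α O) fun s => (s 0, s 1)) ≤ E)
    (h3 : l2 (freq (fun s => (s 0, s 1, s 2)) w -
      labelProb (documentProb α O) fun s => (s 0, s 1, s 2)) ≤ E) :
    l2 (fun p : Fin d × Fin d => (empPairs (∑ i, α i) w - popPairs α O) p.1 p.2) ≤ 3 * E ∧
    ∀ η x y : Fin d → ℝ,
      |x ⬝ᵥ ((empTriples (∑ i, α i) w η - popTriples α O η) *ᵥ y)| ≤
        13 * E * (l2 x * (l2 y * l2 η)) := by
  have hs : 0 ≤ ∑ a, α a := Finset.sum_nonneg fun i _ => (hα i).le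
  set α₀ := ∑ a, α a with hα₀
  set q := documentProb α O with hq
  have hq0 : ∀ s, 0 ≤ q s := documentProb_nonneg α hα O hO
  set μ := labelProb q fun s => s 0 with hμ
  set C := labelProb q fun s => (s 0, s 1) with hC
  set Q := labelProb q fun s => (s 0, s 1, s 2) with hQ
  -- All the moment tensors are probability vectors, which gives the norm bounds needed for the
  -- product estimates.
  have hμ1 : l2 μ ≤ 1 := l2_le_one_of_sum_eq_one (labelProb_nonneg hq0 _) (sum_labelProb hq1 _)
  have hC1 : l2 C ≤ 1 := l2_le_one_of_sum_eq_one (labelProb_nonneg hq0 _) (sum_labelProb hq1 _)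
  have hμ1' := l2_le_one_of_sum_eq_one (freq_nonneg _ w) (sum_freq hN (fun s => s 0) w)
  have hC1' := l2_le_one_of_sum_eq_one (freq_nonneg _ w) (sum_freq hN (fun s => (s 0, s 1)) w)
  have ha : 0 ≤ α₀ / (α₀ + 1) := by positivity
  have ha1 : α₀ / (α₀ + 1) ≤ 1 := div_le_one_of_le₀ (by linarith) (by linarith)
  have hb : 0 ≤ α₀ / (α₀ + 2) := by positivity
  have hb1 : α₀ / (α₀ + 2) ≤ 1 := div_le_one_of_le₀ (by linarith) (by linarith)
  have hc : 0 ≤ 2 * α₀ ^ 2 / ((α₀ + 2) * (α₀ + 1)) := by positivity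
  have hc2 : 2 * α₀ ^ 2 / ((α₀ + 2) * (α₀ + 1)) ≤ 2 := by
    rw [div_le_iff₀ (by positivity)]; nlinarith
  have hpair : ∀ a b, popPairs α O a b = pairTensor (α₀ / (α₀ + 1)) μ C (a, b) := by
    intro a b
    rw [popPairs_apply]
    simp only [topicWeight, ← popSecond_sub hα, pairTensor, hα₀, hμ, hC, hq, labelProb_first hα hO,
      labelProb_second hα hO]
  have htriple : ∀ η a b, popTriples α O η a b = ∑ c, tripleTensor (α₀ / (α₀ + 2))
      (2 * α₀ ^ 2 / ((α₀ + 2) * (α₀ + 1))) μ C Q (a, b, c) * η c := by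
    intro η a b
    rw [popTriples_apply]
    simp only [topicWeight, ← popThird_sub hα, tripleTensor, hα₀, hμ, hC, hQ, hq,
      labelProb_first hα hO, labelProb_second hα hO, labelProb_third]
  refine ⟨?_, fun η x y => ?_⟩
  · have := pairTensor_sub_le ha ha1 hμ1 hμ1' h1 h2
    refine le_of_eq_of_le ?_ this
    congr 1
    ext p
    simp [hpair, empPairs_apply]
  · have h := tripleTensor_sub_le hb hb1 hc hc2 hμ1 hμ1' hC1 hC1' h1 h2 h3
    set A := tripleTensor (α₀ / (α₀ + 2)) (2 * α₀ ^ 2 / ((α₀ + 2) * (α₀ + 1)))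
      (freq (fun s => s 0) w) (freq (fun s => (s 0, s 1)) w) (freq (fun s => (s 0, s 1, s 2)) w) -
      tripleTensor (α₀ / (α₀ + 2)) (2 * α₀ ^ 2 / ((α₀ + 2) * (α₀ + 1))) μ C Q with hA
    have hval : x ⬝ᵥ ((empTriples α₀ w η - popTriples α O η) *ᵥ y) =
        ∑ p : Fin d × Fin d × Fin d, A p * (x p.1 * (y p.2.1 * η p.2.2)) := by
      have hent : ∀ a b, (empTriples α₀ w η - popTriples α O η) a b = ∑ c, A (a, b, c) * η c := by
        intro a b
        rw [Matrix.sub_apply, empTriples_apply, htriple, ← Finset.sum_sub_distrib]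
        exact Finset.sum_congr rfl fun c _ => by simp only [hA, Pi.sub_apply, sub_mul]
      simp only [dotProduct, Matrix.mulVec, hent, Fintype.sum_prod_type, Finset.mul_sum,
        Finset.sum_mul]
      exact Finset.sum_congr rfl fun a _ => Finset.sum_congr rfl fun b _ =>
        Finset.sum_congr rfl fun c _ => by ring
    rw [hval]
    refine (abs_contract_le A x y η).trans ?_
    exact mul_le_mul_of_nonneg_right h
      (mul_nonneg (l2_nonneg _) (mul_nonneg (l2_nonneg _) (l2_nonneg _)))

end EmpiricalErrors

/-! ### Operator bounds -/

section Operators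

variable {m n l : Type*} [Fintype m] [Fintype n] [Fintype l]

/-- The operator norm of `A` is at most `c`. -/
def OpLe (A : Matrix m n ℝ) (c : ℝ) : Prop := ∀ x, l2 (A *ᵥ x) ≤ c * l2 x

lemma dotProduct_mulVec_transpose (A : Matrix m n ℝ) (x : m → ℝ) (y : n → ℝ) :
    x ⬝ᵥ (A *ᵥ y) = (Aᵀ *ᵥ x) ⬝ᵥ y := by
  rw [Matrix.dotProduct_mulVec, Matrix.mulVec_transpose]

lemma OpLe.transpose {A : Matrix m n ℝ} {c : ℝ} (hA : OpLe A c) (hc : 0 ≤ c) : OpLe Aᵀ c := by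
  intro y
  rcases (l2_nonneg (Aᵀ *ᵥ y)).eq_or_lt with h0 | hpos
  · rw [← h0]; exact mul_nonneg hc (l2_nonneg y)
  · have h1 : l2 (Aᵀ *ᵥ y) ^ 2 ≤ l2 y * (c * l2 (Aᵀ *ᵥ y)) := by
      rw [l2_sq_eq_dotProduct, ← dotProduct_mulVec_transpose]
      exact (le_abs_self _).trans ((abs_dotProduct_le _ _).trans
        (mul_le_mul_of_nonneg_left (hA _) (l2_nonneg _)))
    nlinarith

lemma OpLe.mul {A : Matrix m n ℝ} {B : Matrix n l ℝ} {a b : ℝ} (hA : OpLe A a) (hB : OpLe B b)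
    (ha : 0 ≤ a) : OpLe (A * B) (a * b) := by
  intro x
  rw [← Matrix.mulVec_mulVec, mul_assoc]
  exact (hA _).trans (mul_le_mul_of_nonneg_left (hB x) ha)

lemma OpLe.of_isometry [DecidableEq n] {A : Matrix m n ℝ} (hA : Aᵀ * A = 1) : OpLe A 1 := by
  intro x
  refine l2_le_of_sq_le (by linarith [l2_nonneg x]) ?_
  rw [l2_sq_eq_dotProduct, dotProduct_mulVec_transpose, Matrix.mulVec_mulVec, hA, Matrix.one_mulVec,
    one_mul, l2_sq_eq_dotProduct]

lemma OpLe.diagonal [DecidableEq n] {f : n → ℝ} {c : ℝ} (hc : 0 ≤ c) (hf : ∀ i, |f i| ≤ c) :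
    OpLe (Matrix.diagonal f) c := by
  intro x
  refine l2_le_of_sq_le (mul_nonneg hc (l2_nonneg x)) ?_
  rw [mul_pow, l2_sq, l2_sq, Finset.mul_sum]
  refine Finset.sum_le_sum fun i _ => ?_
  rw [Matrix.mulVec_diagonal, mul_pow]
  exact mul_le_mul_of_nonneg_right (sq_le_sq.2 (by rw [abs_of_nonneg hc]; exact hf i))
    (sq_nonneg _)

lemma OpLe.of_frobenius (A : Matrix m n ℝ) : OpLe A (l2 fun p : m × n => A p.1 p.2) := by
  intro x
  refine l2_le_of_sq_le (mul_nonneg (l2_nonneg _) (l2_nonneg x)) ?_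
  rw [mul_pow, l2_sq, l2_sq, Fintype.sum_prod_type, Finset.sum_mul]
  refine Finset.sum_le_sum fun i _ => ?_
  have h := abs_dotProduct_le (A i) x
  have h2 : ((A *ᵥ x) i) ^ 2 ≤ (l2 (A i) * l2 x) ^ 2 :=
    sq_le_sq.2 (by rw [abs_of_nonneg (mul_nonneg (l2_nonneg (A i)) (l2_nonneg x))]; exact h)
  rwa [mul_pow, l2_sq] at h2

lemma OpLe.mono {A : Matrix m n ℝ} {a b : ℝ} (hA : OpLe A a) (hab : a ≤ b) : OpLe A b :=
  fun x => (hA x).trans (mul_le_mul_of_nonneg_right hab (l2_nonneg x))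

lemma OpLe.add {A B : Matrix m n ℝ} {a b : ℝ} (hA : OpLe A a) (hB : OpLe B b) :
    OpLe (A + B) (a + b) := by
  intro x
  rw [Matrix.add_mulVec, add_mul]
  exact (l2_add_le _ _).trans (add_le_add (hA x) (hB x))

/-- The square of the Frobenius norm is a trace. -/
lemma frobenius_sq (A : Matrix m n ℝ) :
    l2 (fun p : m × n => A p.1 p.2) ^ 2 = (Aᵀ * A).trace := by
  rw [l2_sq, Fintype.sum_prod_type, Finset.sum_comm, Matrix.trace]
  refine Finset.sum_congr rfl fun j _ => ?_
  rw [Matrix.diag_apply, Matrix.mul_apply]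
  exact Finset.sum_congr rfl fun i _ => by rw [Matrix.transpose_apply, sq]

lemma exists_ne_zero_mulVec_eq_zero {a b : ℕ} (hab : a < b) (A : Matrix (Fin a) (Fin b) ℝ) :
    ∃ y, y ≠ 0 ∧ A *ᵥ y = 0 := by
  have h : LinearMap.ker A.mulVecLin ≠ ⊥ :=
    LinearMap.ker_ne_bot_of_finrank_lt (by simpa using hab)
  obtain ⟨y, hy, hy0⟩ := Submodule.exists_mem_ne_zero_of_ne_bot h
  exact ⟨y, hy0, by simpa using hy⟩

lemma l2_eq_zero {x : n → ℝ} : l2 x = 0 ↔ x = 0 := by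
  rw [l2, norm_eq_zero]
  exact ⟨fun h => by simpa using congrArg WithLp.ofLp h, fun h => by simp [h]⟩

lemma l2_pos {x : n → ℝ} (hx : x ≠ 0) : 0 < l2 x :=
  lt_of_le_of_ne (l2_nonneg x) fun h => hx (l2_eq_zero.1 h.symm)

end Operators

/-! ### The smallest singular value as a lower bound for the matrix -/

section SmallestSingularValue

variable {d k : ℕ}

/-- In an orthonormal eigenbasis of `OᵀO` the square of `l2 (O *ᵥ y)` is a weighted sum of squared
coordinates. The eigenvalues are sorted in decreasing order, so the one with index `k - 1` is the
least weight. For `k = 0`, where `k - 1` truncates to `0`, every `y` vanishes. -/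
lemma sigmaMin_mul_l2_le (O : Matrix (Fin d) (Fin k) ℝ) (y : Fin k → ℝ) :
    sigmaMin O * l2 y ≤ l2 (O *ᵥ y) := by
  rcases Nat.eq_zero_or_pos k with rfl | hk
  · rw [l2_eq_zero.2 (Subsingleton.elim y 0), mul_zero]
    exact l2_nonneg _
  set T := Matrix.toEuclideanLin O with hT
  have hn : Module.finrank ℝ (EuclideanSpace ℝ (Fin k)) = k := by simp
  have hsym := T.isSymmetric_adjoint_comp_self
  set b := hsym.eigenvectorBasis hn with hb
  set x : EuclideanSpace ℝ (Fin k) := WithLp.toLp 2 y with hx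
  have h1 : ‖T x‖ ^ 2 = ∑ i, hsym.eigenvalues hn i * inner ℝ (b i) x ^ 2 := by
    rw [← real_inner_self_eq_norm_sq, ← LinearMap.adjoint_inner_right, ← LinearMap.comp_apply,
      ← b.sum_inner_mul_inner]
    refine Finset.sum_congr rfl fun i _ => ?_
    have h := hsym (b i) x
    rw [hb, hsym.apply_eigenvectorBasis, ← hb, inner_smul_left] at h
    rw [← h, real_inner_comm]
    simp
    ring
  have h2 : ‖x‖ ^ 2 = ∑ i, inner ℝ (b i) x ^ 2 := by
    rw [← real_inner_self_eq_norm_sq, ← b.sum_inner_mul_inner]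
    exact Finset.sum_congr rfl fun i _ => by rw [real_inner_comm, sq]
  have h3 : T.singularValues (k - 1) ^ 2 = hsym.eigenvalues hn ⟨k - 1, by omega⟩ :=
    T.sq_singularValues_of_lt hn (by omega)
  have h4 : l2 (O *ᵥ y) = ‖T x‖ := by
    simp [l2, hT, hx, Matrix.toLpLin_toLp]
  have h5 : l2 y = ‖x‖ := rfl
  have h6 : 0 ≤ sigmaMin O := T.singularValues_nonneg _
  rw [h4, h5]
  refine le_of_sq_le_sq ?_ (norm_nonneg _)
  rw [mul_pow, h1, h2, Finset.mul_sum]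
  refine Finset.sum_le_sum fun i _ => mul_le_mul_of_nonneg_right ?_ (sq_nonneg _)
  rw [sigmaMin, ← hT, h3]
  exact hsym.eigenvalues_antitone hn (Fin.mk_le_mk.2 (by have := i.2; omega))

lemma sigmaMin_pos {O : Matrix (Fin d) (Fin k) ℝ} (hk : 0 < k) (hrank : O.rank = k) :
    0 < sigmaMin O := by
  rw [sigmaMin, LinearMap.singularValues_pos_iff_lt_finrank_range]
  have h : Module.finrank ℝ (Matrix.toEuclideanLin O).range = O.rank := by
    rw [Matrix.rank_eq_finrank_range_toLin O (EuclideanSpace.basisFun _ ℝ).toBasis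
      (EuclideanSpace.basisFun _ ℝ).toBasis, Matrix.toEuclideanLin_eq_toLin_orthonormal]
  rw [h, hrank]
  omega

end SmallestSingularValue

/-! ### Singular value decompositions in coordinates -/

section SVD

variable {n : ℕ} {M U V : Matrix (Fin n) (Fin n) ℝ} {s : Fin n → ℝ}

lemma IsSVD.left_mul (h : IsSVD M U s V) : Uᵀ * U = 1 :=
  (Matrix.mem_orthogonalGroup_iff' _ _).1 h.left_orthogonal

lemma IsSVD.left_mul' (h : IsSVD M U s V) : U * Uᵀ = 1 :=
  (Matrix.mem_orthogonalGroup_iff _ _).1 h.left_orthogonal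

lemma IsSVD.right_mul (h : IsSVD M U s V) : Vᵀ * V = 1 :=
  (Matrix.mem_orthogonalGroup_iff' _ _).1 h.right_orthogonal

lemma l2_mulVec_of_isometry {m n : Type*} [Fintype m] [Fintype n] [DecidableEq n]
    {A : Matrix m n ℝ} (hA : Aᵀ * A = 1) (x : n → ℝ) : l2 (A *ᵥ x) = l2 x := by
  have h : l2 (A *ᵥ x) ^ 2 = l2 x ^ 2 := by
    rw [l2_sq_eq_dotProduct, dotProduct_mulVec_transpose, Matrix.mulVec_mulVec, hA,
      Matrix.one_mulVec, l2_sq_eq_dotProduct]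
  exact (sq_eq_sq₀ (l2_nonneg _) (l2_nonneg _)).1 h

/-- `V` is an isometry and drops out. The estimates below therefore use `Mᵀ`, for which only the
left singular vectors matter. -/
lemma IsSVD.l2_transpose_mulVec_sq (h : IsSVD M U s V) (x : Fin n → ℝ) :
    l2 (Mᵀ *ᵥ x) ^ 2 = ∑ i, s i ^ 2 * (Uᵀ *ᵥ x) i ^ 2 := by
  have h1 : Mᵀ *ᵥ x = V *ᵥ (Matrix.diagonal s *ᵥ (Uᵀ *ᵥ x)) := by
    rw [h.eq]
    simp [Matrix.mul_assoc]
  rw [h1, l2_mulVec_of_isometry h.right_mul, l2_sq]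
  exact Finset.sum_congr rfl fun i _ => by rw [Matrix.mulVec_diagonal, mul_pow]

lemma IsSVD.l2_sq_eq (h : IsSVD M U s V) (x : Fin n → ℝ) :
    l2 x ^ 2 = ∑ i, (Uᵀ *ᵥ x) i ^ 2 := by
  rw [← l2_sq, l2_mulVec_of_isometry]
  rw [Matrix.transpose_transpose, h.left_mul']

end SVD

/-! ### Whitening with a perturbed second moment -/

section Whitening

variable {d k : ℕ} {O : Matrix (Fin d) (Fin k) ℝ} {D : Fin k → ℝ}

lemma weighted_gram_mulVec (x : Fin d → ℝ) :
    (O * Matrix.diagonal D * Oᵀ) *ᵥ x = O *ᵥ fun i => D i * (Oᵀ *ᵥ x) i := by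
  rw [← Matrix.mulVec_mulVec, ← Matrix.mulVec_mulVec]
  congr 1
  ext i
  rw [Matrix.mulVec_diagonal]

lemma weighted_gram_quad (x y : Fin d → ℝ) :
    x ⬝ᵥ ((O * Matrix.diagonal D * Oᵀ) *ᵥ y) = ∑ i, D i * ((Oᵀ *ᵥ x) i * (Oᵀ *ᵥ y) i) := by
  rw [weighted_gram_mulVec, dotProduct_mulVec_transpose, dotProduct]
  exact Finset.sum_congr rfl fun i _ => by ring

lemma weighted_gram_transpose :
    (O * Matrix.diagonal D * Oᵀ)ᵀ = O * Matrix.diagonal D * Oᵀ := by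
  simp [Matrix.mul_assoc]

/-- A weighted Gram matrix is bounded below on the range of `O`. -/
lemma weighted_gram_lower {σ D₀ : ℝ} (hσ : 0 < σ) (hOσ : ∀ y, σ * l2 y ≤ l2 (O *ᵥ y))
    (hD₀ : 0 ≤ D₀) (hD : ∀ i, D₀ ≤ D i) (y : Fin k → ℝ) :
    D₀ * σ ^ 2 * l2 (O *ᵥ y) ≤ l2 ((O * Matrix.diagonal D * Oᵀ) *ᵥ (O *ᵥ y)) := by
  set x := O *ᵥ y with hx
  rcases (l2_nonneg x).eq_or_lt with h0 | hpos
  · rw [← h0, mul_zero]; exact l2_nonneg _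
  -- `Oᵀ` inherits the lower bound on the range of `O`: `‖x‖² = ⟨Oᵀ x, y⟩ ≤ ‖Oᵀ x‖ ‖y‖` and `σ ‖y‖ ≤
  -- ‖x‖`.
  have h1 : σ * l2 x ≤ l2 (Oᵀ *ᵥ x) := by
    have h2 : l2 x ^ 2 ≤ l2 (Oᵀ *ᵥ x) * l2 y := by
      rw [l2_sq_eq_dotProduct]
      nth_rewrite 2 [hx]
      rw [dotProduct_mulVec_transpose]
      exact (le_abs_self _).trans (abs_dotProduct_le _ _)
    have h3 := hOσ y
    rw [← hx] at h3
    have h4 := l2_nonneg (Oᵀ *ᵥ x)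
    have h5 : l2 x * (σ * l2 x) ≤ l2 x * l2 (Oᵀ *ᵥ x) := by nlinarith
    exact le_of_mul_le_mul_left h5 hpos
  have h2 : D₀ * l2 (Oᵀ *ᵥ x) ^ 2 ≤ l2 x * l2 ((O * Matrix.diagonal D * Oᵀ) *ᵥ x) := by
    refine le_trans ?_ ((le_abs_self _).trans (abs_dotProduct_le _ _))
    rw [weighted_gram_quad, l2_sq, Finset.mul_sum]
    refine Finset.sum_le_sum fun i _ => ?_
    nlinarith [mul_le_mul_of_nonneg_right (hD i) (sq_nonneg ((Oᵀ *ᵥ x) i))]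
  have h3 : D₀ * (σ * l2 x) ^ 2 ≤ D₀ * l2 (Oᵀ *ᵥ x) ^ 2 := by
    gcongr
  have h4 : l2 x * (D₀ * σ ^ 2 * l2 x) ≤ l2 x * l2 ((O * Matrix.diagonal D * Oᵀ) *ᵥ x) := by
    nlinarith
  exact le_of_mul_le_mul_left h4 hpos

/-- The columns have norm at most one, so each summand `D i * ⟨O_i, z⟩ * ⟨O_i, y⟩` of the bilinear
form is at most `D i * ‖z‖ * ‖y‖`. -/
lemma weighted_gram_upper {t : ℝ} (hcol : ∀ i, l2 (O.col i) ≤ 1) (hD0 : ∀ i, 0 ≤ D i)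
    (hDt : ∑ i, D i ≤ t) : OpLe (O * Matrix.diagonal D * Oᵀ) t := by
  intro x
  have ht : 0 ≤ t := (Finset.sum_nonneg fun i _ => hD0 i).trans hDt
  have hle : ∀ y z : Fin d → ℝ, |z ⬝ᵥ ((O * Matrix.diagonal D * Oᵀ) *ᵥ y)| ≤
      t * (l2 z * l2 y) := by
    intro y z
    rw [weighted_gram_quad]
    refine (Finset.abs_sum_le_sum_abs _ _).trans ?_
    refine le_trans ?_ (mul_le_mul_of_nonneg_right hDt (mul_nonneg (l2_nonneg z) (l2_nonneg y)))
    rw [Finset.sum_mul]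
    refine Finset.sum_le_sum fun i _ => ?_
    have hz : ∀ u : Fin d → ℝ, |(Oᵀ *ᵥ u) i| ≤ l2 u := fun u =>
      (abs_dotProduct_le (O.col i) u).trans
        (mul_le_of_le_one_left (l2_nonneg u) (hcol i))
    rw [abs_mul, abs_of_nonneg (hD0 i), abs_mul]
    exact mul_le_mul_of_nonneg_left (mul_le_mul (hz z) (hz y) (abs_nonneg _) (l2_nonneg z)) (hD0 i)
  have h := hle x ((O * Matrix.diagonal D * Oᵀ) *ᵥ x)
  rw [← l2_sq_eq_dotProduct, abs_of_nonneg (sq_nonneg _)] at h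
  rcases (l2_nonneg ((O * Matrix.diagonal D * Oᵀ) *ᵥ x)).eq_or_lt with h0 | hpos
  · rw [← h0]; exact mul_nonneg ht (l2_nonneg x)
  · nlinarith

variable {P' U V : Matrix (Fin d) (Fin d) ℝ} {s : Fin d → ℝ} {ε σ D₀ t : ℝ}

/-- The `k` largest singular values of the perturbed matrix are bounded below. -/
lemma svd_head_ge (hsvd : IsSVD P' U s V) (hε : OpLe (P' - O * Matrix.diagonal D * Oᵀ)ᵀ ε)
    (hσ : 0 < σ) (hOσ : ∀ y, σ * l2 y ≤ l2 (O *ᵥ y)) (hD₀ : 0 ≤ D₀) (hD : ∀ i, D₀ ≤ D i)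
    (hkd : k ≤ d) (i : Fin k) : D₀ * σ ^ 2 - ε ≤ s (Fin.castLE hkd i) := by
  have hk : k - 1 < k := by have := i.2; omega
  -- A min-max argument: `k - 1` linear conditions on `y` leave a nonzero `x = O y` orthogonal to
  -- the first `k - 1` left singular vectors. On such `x`, `P'ᵀ` stretches by at most the `k`-th
  -- singular value, which has index `k - 1`.
  obtain ⟨y, hy0, hy⟩ := exists_ne_zero_mulVec_eq_zero hk
    ((Uᵀ * O).submatrix (Fin.castLE (by omega : k - 1 ≤ d)) id)
  set x := O *ᵥ y with hx
  have hxpos : 0 < l2 x := lt_of_lt_of_le (mul_pos hσ (l2_pos hy0)) (hOσ y)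
  set z : Fin d := ⟨k - 1, by omega⟩ with hz
  have hzero : ∀ j : Fin d, j < z → (Uᵀ *ᵥ x) j = 0 := by
    intro j hj
    have h := congrFun hy ⟨j, hj⟩
    rw [hx, Matrix.mulVec_mulVec]
    exact h
  have hup : l2 (P'ᵀ *ᵥ x) ≤ s z * l2 x := by
    refine l2_le_of_sq_le (mul_nonneg (hsvd.nonneg z) (l2_nonneg x)) ?_
    rw [hsvd.l2_transpose_mulVec_sq, mul_pow, hsvd.l2_sq_eq, Finset.mul_sum]
    refine Finset.sum_le_sum fun j _ => ?_
    by_cases hj : j < z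
    · rw [hzero j hj]; simp
    · exact mul_le_mul_of_nonneg_right
        (pow_le_pow_left₀ (hsvd.nonneg j) (hsvd.antitone (not_lt.1 hj)) 2) (sq_nonneg _)
  have hlow := weighted_gram_lower hσ hOσ hD₀ hD y
  rw [← hx] at hlow
  have hdec : (O * Matrix.diagonal D * Oᵀ) *ᵥ x =
      P'ᵀ *ᵥ x - (P' - O * Matrix.diagonal D * Oᵀ)ᵀ *ᵥ x := by
    rw [← Matrix.sub_mulVec, ← Matrix.transpose_sub, sub_sub_cancel, weighted_gram_transpose]
  rw [hdec] at hlow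
  have h1 := hlow.trans (l2_sub_le _ _)
  have h2 := hε x
  have h3 : (D₀ * σ ^ 2 - ε) * l2 x ≤ s z * l2 x := by linarith
  refine (le_of_mul_le_mul_right h3 hxpos).trans (hsvd.antitone ?_)
  rw [Fin.le_def]
  have := i.2
  simp [hz]; omega

/-- The other singular values of the perturbed matrix are small. -/
lemma svd_tail_le (hsvd : IsSVD P' U s V) (hε : OpLe (P' - O * Matrix.diagonal D * Oᵀ)ᵀ ε)
    (j : Fin d) (hj : k ≤ j) : s j ≤ ε := by
  have hkd : k + 1 ≤ d := by have := j.2; omega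
  set A := U.submatrix id (Fin.castLE hkd) with hA
  -- The dual argument: the span of the first `k + 1` left singular vectors contains a nonzero `x`
  -- killed by `Oᵀ`. There `P'ᵀ` reduces to the error, yet stretches by at least the singular value
  -- with index `k`.
  obtain ⟨y, hy0, hy⟩ := exists_ne_zero_mulVec_eq_zero (Nat.lt_succ_self k) (Oᵀ * A)
  have hU := hsvd.left_mul
  set x := A *ᵥ y with hx
  have hUA : ∀ a b, (Uᵀ * A) a b = if a = Fin.castLE hkd b then 1 else 0 := by
    intro a b
    have : (Uᵀ * A) a b = (Uᵀ * U) a (Fin.castLE hkd b) := rfl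
    rw [this, hU, Matrix.one_apply]
  have hAA : Aᵀ * A = 1 := by
    ext a b
    have : (Aᵀ * A) a b = (Uᵀ * U) (Fin.castLE hkd a) (Fin.castLE hkd b) := rfl
    rw [this, hU, Matrix.one_apply, Matrix.one_apply]
    simp
  have hxpos : 0 < l2 x := by
    rw [hx, l2_mulVec_of_isometry hAA]; exact l2_pos hy0
  have hzero : ∀ a : Fin d, k < a → (Uᵀ *ᵥ x) a = 0 := by
    intro a ha
    rw [hx, Matrix.mulVec_mulVec, Matrix.mulVec, dotProduct]
    refine Finset.sum_eq_zero fun b _ => ?_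
    rw [hUA, if_neg, zero_mul]
    rintro rfl
    have := b.2
    simp at ha
    omega
  have hlow : s j * l2 x ≤ l2 (P'ᵀ *ᵥ x) := by
    refine le_of_sq_le_sq ?_ (l2_nonneg _)
    rw [hsvd.l2_transpose_mulVec_sq, mul_pow, hsvd.l2_sq_eq, Finset.mul_sum]
    refine Finset.sum_le_sum fun a _ => ?_
    by_cases ha : k < a
    · rw [hzero a ha]; simp
    · exact mul_le_mul_of_nonneg_right (pow_le_pow_left₀ (hsvd.nonneg j)
        (hsvd.antitone (Fin.le_def.2 (by omega))) 2) (sq_nonneg _)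
  have hdec : P'ᵀ *ᵥ x = (P' - O * Matrix.diagonal D * Oᵀ)ᵀ *ᵥ x := by
    rw [Matrix.transpose_sub, Matrix.sub_mulVec, weighted_gram_transpose]
    have : Oᵀ *ᵥ x = 0 := by rw [hx, Matrix.mulVec_mulVec, hy]
    rw [← Matrix.mulVec_mulVec x, this, Matrix.mulVec_zero, sub_zero]
  rw [hdec] at hlow
  exact le_of_mul_le_mul_right (hlow.trans (hε x)) hxpos

lemma svd_value_le (hsvd : IsSVD P' U s V) {c : ℝ} (hc : OpLe P'ᵀ c) (j : Fin d) : s j ≤ c := by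
  have hU := hsvd.left_mul
  have hUj : Uᵀ *ᵥ U.col j = Pi.single j 1 := by
    ext a
    have : (Uᵀ *ᵥ U.col j) a = (Uᵀ * U) a j := rfl
    rw [this, hU, Matrix.one_apply, Pi.single_apply]
  have h1 : l2 (U.col j) = 1 := by
    have h : l2 (U.col j) ^ 2 = 1 := by
      rw [hsvd.l2_sq_eq, hUj]; simp [Pi.single_apply]
    nlinarith [l2_nonneg (U.col j)]
  have h2 : l2 (P'ᵀ *ᵥ U.col j) = s j := by
    have h : l2 (P'ᵀ *ᵥ U.col j) ^ 2 = s j ^ 2 := by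
      rw [hsvd.l2_transpose_mulVec_sq, hUj]; simp [Pi.single_apply]
    exact (sq_eq_sq₀ (l2_nonneg _) (hsvd.nonneg j)).1 h
  have := hc (U.col j)
  rwa [h1, h2, mul_one] at this

/-- Replacing a matrix by its left modulus costs at most a factor `√2` in Frobenius distance to a
positive semidefinite matrix. -/
lemma left_modulus_frobenius (hsvd : IsSVD P' U s V) {P : Matrix (Fin d) (Fin d) ℝ} (hP : Pᵀ = P)
    (hpsd : ∀ x, 0 ≤ x ⬝ᵥ (P *ᵥ x)) :
    l2 (fun p : Fin d × Fin d => (U * Matrix.diagonal s * Uᵀ - P) p.1 p.2) ^ 2 ≤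
      2 * l2 (fun p : Fin d × Fin d => (P' - P) p.1 p.2) ^ 2 := by
  have hU := hsvd.left_mul
  have hV := hsvd.right_mul
  have hdiag : ∀ A B : Matrix (Fin d) (Fin d) ℝ,
      (A * Matrix.diagonal s * Bᵀ * P).trace = ∑ i, s i * (B.col i ⬝ᵥ (P *ᵥ A.col i)) := by
    intro A B
    rw [Matrix.mul_assoc, Matrix.trace_mul_comm, ← Matrix.mul_assoc, Matrix.trace]
    refine Finset.sum_congr rfl fun i _ => ?_
    rw [Matrix.diag_apply, Matrix.mul_diagonal, mul_comm, Matrix.mul_assoc]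
    rfl
  have hexp : ∀ A B : Matrix (Fin d) (Fin d) ℝ, Aᵀ * A = 1 → Bᵀ * B = 1 →
      l2 (fun p : Fin d × Fin d => (A * Matrix.diagonal s * Bᵀ - P) p.1 p.2) ^ 2 =
        ∑ i, s i ^ 2 - 2 * ∑ i, s i * (A.col i ⬝ᵥ (P *ᵥ B.col i)) + (P * P).trace := by
    intro A B hA hB
    set R := A * Matrix.diagonal s * Bᵀ with hR
    have hRt : Rᵀ = B * Matrix.diagonal s * Aᵀ := by simp [hR, Matrix.mul_assoc]
    have h1 : (Rᵀ * R).trace = ∑ i, s i ^ 2 := by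
      have : Rᵀ * R = B * (Matrix.diagonal s * Matrix.diagonal s * Bᵀ) := by
        rw [hRt, hR]
        calc B * Matrix.diagonal s * Aᵀ * (A * Matrix.diagonal s * Bᵀ)
            = B * Matrix.diagonal s * (Aᵀ * A) * Matrix.diagonal s * Bᵀ := by
              simp only [Matrix.mul_assoc]
          _ = _ := by rw [hA]; simp only [Matrix.mul_assoc, Matrix.mul_one]
      rw [this, Matrix.trace_mul_comm, Matrix.mul_assoc, hB, Matrix.mul_one,
        Matrix.diagonal_mul_diagonal, Matrix.trace_diagonal]
      exact Finset.sum_congr rfl fun i _ => (sq _).symm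
    have h2 : (Rᵀ * P).trace = ∑ i, s i * (A.col i ⬝ᵥ (P *ᵥ B.col i)) := by rw [hRt, hdiag]
    have h3 : (P * R).trace = (Rᵀ * P).trace := by
      rw [← Matrix.trace_transpose, Matrix.transpose_mul, hP]
    rw [frobenius_sq, Matrix.transpose_sub, hP, Matrix.sub_mul, Matrix.mul_sub, Matrix.mul_sub,
      Matrix.trace_sub, Matrix.trace_sub, Matrix.trace_sub, h1, h3, h2]
    ring
  -- The squared distances of the left and the right modulus to `P` add up to at most twice that of
  -- `P'`: the cross terms compare by positivity of `P` at `U.col i - V.col i`. The right modulus is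
  -- then dropped.
  have e1 := hexp U U hU hU
  have e2 := hexp V V hV hV
  have e3 := hexp U V hU hV
  rw [← hsvd.eq] at e3
  have hsum : 2 * ∑ i, s i * (U.col i ⬝ᵥ (P *ᵥ V.col i)) ≤
      ∑ i, s i * (U.col i ⬝ᵥ (P *ᵥ U.col i)) + ∑ i, s i * (V.col i ⬝ᵥ (P *ᵥ V.col i)) := by
    rw [Finset.mul_sum, ← Finset.sum_add_distrib]
    refine Finset.sum_le_sum fun i _ => ?_
    have h := hpsd (U.col i - V.col i)
    rw [Matrix.mulVec_sub, dotProduct_sub, sub_dotProduct, sub_dotProduct] at h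
    have hsym : V.col i ⬝ᵥ (P *ᵥ U.col i) = U.col i ⬝ᵥ (P *ᵥ V.col i) := by
      rw [dotProduct_mulVec_transpose, hP, dotProduct_comm]
    rw [hsym] at h
    nlinarith [hsvd.nonneg i]
  have h4 := sq_nonneg (l2 (fun p : Fin d × Fin d => (V * Matrix.diagonal s * Vᵀ - P) p.1 p.2))
  rw [e2] at h4
  rw [e1, e3]
  linarith

end Whitening

/-! ### The whitening matrix and its pseudo-inverse -/

section WhiteningMatrix

variable {d k : ℕ} {O : Matrix (Fin d) (Fin k) ℝ} {D : Fin k → ℝ}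
  {P' : Matrix (Fin d) (Fin d) ℝ} {W : Matrix (Fin d) (Fin k) ℝ} {ε σ D₀ t : ℝ}

/-- Properties of a whitening matrix computed from a perturbation of `O diag(D) Oᵀ`. -/
lemma whitening_bounds {hkd : k ≤ d} (hk : 0 < k) (hW : IsWhitening hkd P' W)
    (hε : l2 (fun p : Fin d × Fin d => (P' - O * Matrix.diagonal D * Oᵀ) p.1 p.2) ≤ ε)
    (hσ : 0 < σ) (hOσ : ∀ y, σ * l2 y ≤ l2 (O *ᵥ y)) (hD₀ : 0 < D₀) (hD : ∀ i, D₀ ≤ D i)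
    (hcol : ∀ i, l2 (O.col i) ≤ 1) (hDt : ∑ i, D i ≤ t) (hεD : ε ≤ 3 / 5 * (D₀ * σ ^ 2)) :
    W.rank = k ∧
    OpLe W (Real.sqrt (5 / (2 * (D₀ * σ ^ 2)))) ∧
    OpLe (pinv W)ᵀ (Real.sqrt (2 * t)) ∧
    (∀ i, l2 (O.col i - (pinv W)ᵀ *ᵥ (Wᵀ *ᵥ O.col i)) ≤ 2 * ε / (D i * σ)) ∧
    OpLe (Wᵀ * (O * Matrix.diagonal D * Oᵀ) * W - 1)
      (5 / (2 * (D₀ * σ ^ 2)) * (Real.sqrt 2 * ε)) := by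
  obtain ⟨U, s, V, hsvd, hWeq⟩ := hW
  have hς : 0 < D₀ * σ ^ 2 := by positivity
  set ς := D₀ * σ ^ 2 with hςdef
  set P := O * Matrix.diagonal D * Oᵀ with hP
  have hε0 : 0 ≤ ε := (l2_nonneg _).trans hε
  have hD0 : ∀ i, 0 ≤ D i := fun i => hD₀.le.trans (hD i)
  have ht : 0 ≤ t := (Finset.sum_nonneg fun i _ => hD0 i).trans hDt
  have hop : OpLe (P' - P) ε := (OpLe.of_frobenius _).mono hε
  have hopT : OpLe (P' - P)ᵀ ε := hop.transpose hε0
  have hU := hsvd.left_mul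
  set e : Fin k → Fin d := Fin.castLE hkd with he
  have hinj : Function.Injective e := Fin.castLE_injective hkd
  -- An error of at most `3 / 5 * ς` leaves `2 / 5 * ς`; this is the source of the constant `5 / (2
  -- * ς)`.
  have hhead : ∀ i, 2 / 5 * ς ≤ s (e i) := by
    intro i
    have := svd_head_ge hsvd hopT hσ hOσ hD₀.le hD hkd i
    rw [← hςdef] at this
    linarith
  have hpos : ∀ i, 0 < s (e i) := fun i => lt_of_lt_of_le (by positivity) (hhead i)
  have htail : ∀ j : Fin d, k ≤ j → s j ≤ ε := fun j hj => svd_tail_le hsvd hopT j hj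
  have hPt : OpLe P t := weighted_gram_upper hcol hD0 hDt
  have hςt : ς ≤ t := by
    have h1 : σ ≤ 1 := by
      have h := hOσ (Pi.single ⟨0, hk⟩ 1)
      have h2 : l2 (Pi.single (⟨0, hk⟩ : Fin k) (1 : ℝ)) = 1 := by simp [l2]
      rw [h2, mul_one, Matrix.mulVec_single_one] at h
      exact h.trans (hcol _)
    have h2 : D₀ ≤ t := (hD ⟨0, hk⟩).trans
      ((Finset.single_le_sum (fun i _ => hD0 i) (Finset.mem_univ _)).trans hDt)
    have h3 : σ ^ 2 ≤ 1 := by nlinarith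
    rw [hςdef]
    nlinarith
  have hmax : ∀ j, s j ≤ 2 * t := by
    have hP'T : OpLe P'ᵀ (t + ε) := by
      have h := (hPt.transpose ht).add hopT
      rwa [← Matrix.transpose_add, add_sub_cancel] at h
    intro j
    have := svd_value_le hsvd hP'T j
    linarith
  set A := U.submatrix id e with hA
  have hAA : Aᵀ * A = 1 := by
    ext a b
    have : (Aᵀ * A) a b = (Uᵀ * U) (e a) (e b) := rfl
    rw [this, hU, Matrix.one_apply, Matrix.one_apply]
    simp [hinj.eq_iff]
  have hAop : OpLe A 1 := OpLe.of_isometry hAA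
  set r : Fin k → ℝ := fun i => (Real.sqrt (s (e i)))⁻¹ with hr
  have hsq : ∀ i, 0 < Real.sqrt (s (e i)) := fun i => Real.sqrt_pos.2 (hpos i)
  have hWT : Wᵀ = Matrix.diagonal r * Aᵀ := by rw [hWeq]; simp
  have hWW : Wᵀ * W = Matrix.diagonal fun i => r i * r i := by
    rw [hWT, hWeq, Matrix.mul_assoc, ← Matrix.mul_assoc Aᵀ, hAA, Matrix.one_mul,
      Matrix.diagonal_mul_diagonal]
  have hrr : ∀ i, s (e i) * (r i * r i) = 1 := by
    intro i
    simp only [hr]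
    rw [← mul_inv, Real.mul_self_sqrt (hpos i).le, mul_inv_cancel₀ (hpos i).ne']
  have hinv : (Wᵀ * W)⁻¹ = Matrix.diagonal fun i => s (e i) := by
    apply Matrix.inv_eq_left_inv
    rw [hWW, Matrix.diagonal_mul_diagonal]
    simp [hrr]
  have hunit : IsUnit (Wᵀ * W) := by
    rw [Matrix.isUnit_iff_isUnit_det, hWW, Matrix.det_diagonal, isUnit_iff_ne_zero]
    refine Finset.prod_ne_zero_iff.2 fun i _ => ?_
    intro h
    have := hrr i
    rw [h, mul_zero] at this
    exact zero_ne_one this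
  have hpinv : (pinv W)ᵀ = A * Matrix.diagonal fun i => Real.sqrt (s (e i)) := by
    rw [pinv, hinv, hWT, ← Matrix.mul_assoc, Matrix.diagonal_mul_diagonal, Matrix.transpose_mul,
      Matrix.transpose_transpose, Matrix.diagonal_transpose]
    congr 2
    ext i
    simp only [hr]
    nth_rewrite 1 [← Real.mul_self_sqrt (hpos i).le]
    rw [mul_assoc, mul_inv_cancel₀ (hsq i).ne', mul_one]
  -- The scalings cancel, and the orthogonal projection to the span of the `k` leading left singular
  -- vectors remains.
  have hproj : (pinv W)ᵀ * Wᵀ = A * Aᵀ := by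
    rw [hpinv, hWT, Matrix.mul_assoc, ← Matrix.mul_assoc (Matrix.diagonal _),
      Matrix.diagonal_mul_diagonal]
    have : (fun i => Real.sqrt (s (e i)) * r i) = fun _ => 1 := by
      ext i; exact mul_inv_cancel₀ (hsq i).ne'
    rw [this, Matrix.diagonal_one, Matrix.one_mul]
  have hrle : ∀ i, |r i| ≤ Real.sqrt (5 / (2 * ς)) := by
    intro i
    simp only [hr]
    rw [abs_of_pos (inv_pos.2 (hsq i)), ← Real.sqrt_inv]
    apply Real.sqrt_le_sqrt
    rw [inv_le_comm₀ (hpos i) (by positivity), inv_div]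
    refine le_trans (le_of_eq ?_) (hhead i)
    ring
  have hWop : OpLe W (Real.sqrt (5 / (2 * ς))) := by
    have h := hAop.mul (OpLe.diagonal (Real.sqrt_nonneg _) hrle) zero_le_one
    rw [one_mul] at h
    rw [hWeq]; exact h
  refine ⟨?_, hWop, ?_, ?_, ?_⟩
  · rw [← Matrix.rank_transpose_mul_self, Matrix.rank_of_isUnit _ hunit, Fintype.card_fin]
  · rw [hpinv]
    have h := hAop.mul (OpLe.diagonal (f := fun i => Real.sqrt (s (e i)))
      (Real.sqrt_nonneg (2 * t)) fun i => by
        rw [abs_of_nonneg (Real.sqrt_nonneg _)]; exact Real.sqrt_le_sqrt (hmax _)) zero_le_one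
    rwa [one_mul] at h
  · intro i
    rw [Matrix.mulVec_mulVec, hproj]
    -- `y` is orthogonal to the leading singular vectors, so `P'ᵀ y`, and with it `P y`, is small.
    -- On the other hand `⟨O_i, y⟩ = ‖y‖²`, which forces `‖P y‖ ≥ σ * D i * ‖y‖²`. This bounds `y`
    -- without comparing subspaces.
    set y := O.col i - (A * Aᵀ) *ᵥ O.col i with hy
    have hAy : Aᵀ *ᵥ y = 0 := by
      rw [hy, Matrix.mulVec_sub, Matrix.mulVec_mulVec, ← Matrix.mul_assoc, hAA, Matrix.one_mul,
        sub_self]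
    have hUy : ∀ j : Fin d, (j : ℕ) < k → (Uᵀ *ᵥ y) j = 0 := fun j hj => congrFun hAy ⟨j, hj⟩
    have h1 : l2 (P'ᵀ *ᵥ y) ≤ ε * l2 y := by
      refine l2_le_of_sq_le (mul_nonneg hε0 (l2_nonneg y)) ?_
      rw [hsvd.l2_transpose_mulVec_sq, mul_pow, hsvd.l2_sq_eq, Finset.mul_sum]
      refine Finset.sum_le_sum fun j _ => ?_
      by_cases hj : (j : ℕ) < k
      · rw [hUy j hj]; simp
      · exact mul_le_mul_of_nonneg_right
          (pow_le_pow_left₀ (hsvd.nonneg j) (htail j (not_lt.1 hj)) 2) (sq_nonneg _)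
    have h2 : l2 (P *ᵥ y) ≤ 2 * ε * l2 y := by
      have hdec : P *ᵥ y = P'ᵀ *ᵥ y - (P' - P)ᵀ *ᵥ y := by
        rw [← Matrix.sub_mulVec, ← Matrix.transpose_sub, sub_sub_cancel, hP,
          weighted_gram_transpose]
      rw [hdec]
      have := l2_sub_le (P'ᵀ *ᵥ y) ((P' - P)ᵀ *ᵥ y)
      have := hopT y
      linarith
    have h3 : (Oᵀ *ᵥ y) i = l2 y ^ 2 := by
      have h4 : (Oᵀ *ᵥ y) i = O.col i ⬝ᵥ y := rfl
      have h5 : O.col i = y + (A * Aᵀ) *ᵥ O.col i := by rw [hy]; simp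
      have h6 : ((A * Aᵀ) *ᵥ O.col i) ⬝ᵥ y = 0 := by
        rw [dotProduct_comm, ← Matrix.mulVec_mulVec, dotProduct_mulVec_transpose, hAy,
          zero_dotProduct]
      rw [h4, h5, add_dotProduct, h6, add_zero, l2_sq_eq_dotProduct]
    have h4 : σ * (D i * l2 y ^ 2) ≤ 2 * ε * l2 y := by
      refine le_trans ?_ h2
      rw [hP, weighted_gram_mulVec]
      refine le_trans ?_ (hOσ _)
      refine mul_le_mul_of_nonneg_left ?_ hσ.le
      have h := abs_apply_le_l2 (fun i => D i * (Oᵀ *ᵥ y) i) i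
      simp only [h3] at h
      exact (le_abs_self _).trans h
    have hDi : 0 < D i := lt_of_lt_of_le hD₀ (hD i)
    rw [le_div_iff₀ (mul_pos hDi hσ)]
    rcases (l2_nonneg y).eq_or_lt with h0 | hy0
    · rw [← h0, zero_mul]; positivity
    · have h5 : l2 y * (l2 y * (D i * σ)) ≤ l2 y * (2 * ε) := by linarith
      exact le_of_mul_le_mul_left h5 hy0
  -- The left modulus `Pt` is whitened exactly by `W`, so the defect for `P` is `Wᵀ (P - Pt) W`. For
  -- `P'` itself this could fail, since its left and right singular vectors may differ.
  · set Pt := U * Matrix.diagonal s * Uᵀ with hPtdef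
    have hmod := left_modulus_frobenius hsvd (P := P) (by rw [hP, weighted_gram_transpose])
      (fun x => by
        rw [hP, weighted_gram_quad]
        exact Finset.sum_nonneg fun i _ => mul_nonneg (hD0 i) (mul_self_nonneg _))
    have hfro : l2 (fun p : Fin d × Fin d => (Pt - P) p.1 p.2) ≤ Real.sqrt 2 * ε := by
      refine l2_le_of_sq_le (by positivity) (hmod.trans ?_)
      rw [mul_pow, Real.sq_sqrt (by norm_num)]
      exact mul_le_mul_of_nonneg_left (pow_le_pow_left₀ (l2_nonneg _) hε 2) (by norm_num)
    have hPtW : Wᵀ * Pt * W = 1 := by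
      have h1 : Aᵀ * Pt * A = Matrix.diagonal fun i => s (e i) := by
        ext a b
        have h2 : (Aᵀ * Pt * A) a b = (Uᵀ * Pt * U) (e a) (e b) := rfl
        have h3 : Uᵀ * Pt * U = Matrix.diagonal s := by
          rw [hPtdef]
          calc Uᵀ * (U * Matrix.diagonal s * Uᵀ) * U
              = (Uᵀ * U) * Matrix.diagonal s * (Uᵀ * U) := by simp only [Matrix.mul_assoc]
            _ = _ := by rw [hU, Matrix.one_mul, Matrix.mul_one]
        rw [h2, h3, Matrix.diagonal_apply, Matrix.diagonal_apply]
        simp [hinj.eq_iff]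
      calc Wᵀ * Pt * W = Matrix.diagonal r * (Aᵀ * Pt * A) * Matrix.diagonal r := by
            rw [hWT, hWeq]; simp only [Matrix.mul_assoc]
        _ = 1 := by
            rw [h1, Matrix.diagonal_mul_diagonal, Matrix.diagonal_mul_diagonal,
              ← Matrix.diagonal_one]
            congr 1
            ext i
            have := hrr i
            linarith
    have hdec : Wᵀ * P * W - 1 = Wᵀ * (-(Pt - P) * W) := by
      rw [← hPtW, neg_sub, Matrix.sub_mul, Matrix.mul_sub, Matrix.mul_assoc Wᵀ Pt W,
        Matrix.mul_assoc Wᵀ P W]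
    have hop2 : OpLe (-(Pt - P)) (Real.sqrt 2 * ε) := by
      intro x
      rw [Matrix.neg_mulVec, l2_neg]
      exact ((OpLe.of_frobenius _).mono hfro) x
    rw [hdec]
    have h := (hWop.transpose (Real.sqrt_nonneg _)).mul (hop2.mul hWop (by positivity))
      (Real.sqrt_nonneg _)
    refine h.mono (le_of_eq ?_)
    have h5 : Real.sqrt (5 / (2 * ς)) * Real.sqrt (5 / (2 * ς)) = 5 / (2 * ς) :=
      Real.mul_self_sqrt (by positivity)
    linear_combination (Real.sqrt 2 * ε) * h5

end WhiteningMatrix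

/-! ### Left singular vectors of a perturbed, nearly orthogonal decomposition -/

section SingularVectors

variable {k : ℕ} {B : Matrix (Fin k) (Fin k) ℝ} {g : ℝ}

lemma near_orthogonal_sq (hg : OpLe (B * Bᵀ - 1) g) (x : Fin k → ℝ) :
    |l2 (Bᵀ *ᵥ x) ^ 2 - l2 x ^ 2| ≤ g * l2 x ^ 2 := by
  have h1 : l2 (Bᵀ *ᵥ x) ^ 2 - l2 x ^ 2 = x ⬝ᵥ ((B * Bᵀ - 1) *ᵥ x) := by
    rw [Matrix.sub_mulVec, Matrix.one_mulVec, dotProduct_sub, ← l2_sq_eq_dotProduct,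
      ← Matrix.mulVec_mulVec, dotProduct_mulVec_transpose, ← l2_sq_eq_dotProduct]
  rw [h1]
  refine (abs_dotProduct_le _ _).trans ?_
  have := mul_le_mul_of_nonneg_left (hg x) (l2_nonneg x)
  linarith

lemma near_orthogonal_transpose_le (hg : OpLe (B * Bᵀ - 1) g) {c : ℝ} (hc : 0 ≤ c)
    (hgc : 1 + g ≤ c ^ 2) : OpLe Bᵀ c := by
  intro x
  refine l2_le_of_sq_le (mul_nonneg hc (l2_nonneg x)) ?_
  have h := (abs_le.1 (near_orthogonal_sq hg x)).2
  nlinarith [sq_nonneg (l2 x)]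

/-- The hypothesis controls `Bᵀ` from below, hence `Bᵀ` is injective and, being square, surjective.
Writing `x = Bᵀ y` gives `B x = y + (B Bᵀ - 1) y`, which transfers the lower bound to `B`. -/
lemma near_orthogonal_lower (hg : OpLe (B * Bᵀ - 1) g) (hg4 : g ≤ 1 / 4) (x : Fin k → ℝ) :
    1 / 2 * l2 x ≤ l2 (B *ᵥ x) := by
  have hinj : Function.Injective (Matrix.mulVecLin Bᵀ) := by
    rw [← LinearMap.ker_eq_bot, LinearMap.ker_eq_bot']
    intro y hy
    have hy' : Bᵀ *ᵥ y = 0 := hy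
    have h := (abs_le.1 (near_orthogonal_sq hg y)).1
    rw [hy', l2_eq_zero.2 rfl] at h
    have h2 : l2 y = 0 := by nlinarith [sq_nonneg (l2 y), l2_nonneg y]
    exact l2_eq_zero.1 h2
  obtain ⟨y, hy⟩ := LinearMap.injective_iff_surjective.1 hinj x
  have hy' : Bᵀ *ᵥ y = x := hy
  have h1 : l2 x ≤ 5 / 4 * l2 y := by
    rw [← hy']
    exact near_orthogonal_transpose_le hg (by norm_num) (by norm_num; linarith) y
  have h2 : l2 y ≤ l2 (B *ᵥ x) + 1 / 4 * l2 y := by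
    have h3 : y = B *ᵥ x - (B * Bᵀ - 1) *ᵥ y := by
      rw [Matrix.sub_mulVec, Matrix.one_mulVec, ← Matrix.mulVec_mulVec, hy']; simp
    have h4 := l2_sub_le (B *ᵥ x) ((B * Bᵀ - 1) *ᵥ y)
    rw [← h3] at h4
    have h5 := hg y
    nlinarith [l2_nonneg y]
  linarith [l2_nonneg x]

lemma IsSVD.mulVec_right {M U V : Matrix (Fin k) (Fin k) ℝ} {s : Fin k → ℝ} (h : IsSVD M U s V)
    (a : Fin k) : M *ᵥ V.col a = s a • U.col a := by
  have hV : Vᵀ *ᵥ V.col a = Pi.single a 1 := by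
    ext b
    have : (Vᵀ *ᵥ V.col a) b = (Vᵀ * V) b a := rfl
    rw [this, h.right_mul, Matrix.one_apply, Pi.single_apply]
  rw [h.eq, ← Matrix.mulVec_mulVec, hV, ← Matrix.mulVec_mulVec, Matrix.diagonal_mulVec_single,
    mul_one]
  ext b
  simp [Matrix.mulVec_single, mul_comm]

lemma IsSVD.transpose_mulVec_left {M U V : Matrix (Fin k) (Fin k) ℝ} {s : Fin k → ℝ}
    (h : IsSVD M U s V) (a : Fin k) : Mᵀ *ᵥ U.col a = s a • V.col a := by
  have hT : IsSVD Mᵀ V s U :=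
    ⟨h.right_orthogonal, h.left_orthogonal, h.nonneg, h.antitone, by
      rw [h.eq]; simp [Matrix.mul_assoc]⟩
  exact hT.mulVec_right a

lemma l2_col_of_isometry {A : Matrix (Fin k) (Fin k) ℝ} (hA : Aᵀ * A = 1) (a : Fin k) :
    l2 (A.col a) = 1 := by
  have h : l2 (A.col a) ^ 2 = 1 := by
    rw [l2_sq_eq_dotProduct]
    have : A.col a ⬝ᵥ A.col a = (Aᵀ * A) a a := rfl
    rw [this, hA, Matrix.one_apply_eq]
  nlinarith [l2_nonneg (A.col a)]

/-- Coordinates of a singular pair far from the singular value are small. -/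
lemma far_coordinate_bound {μ s c c' G : ℝ} (hs : 0 ≤ s) (hG : 0 < G) (hfar : G ≤ |(|μ| - s)|) :
    |c| ≤ (|μ * c - s * c'| + |μ * c' - s * c|) / G := by
  have h1 : G ≤ |μ - s| := by
    refine hfar.trans ?_
    have := abs_abs_sub_abs_le_abs_sub μ s
    rwa [abs_of_nonneg hs] at this
  have h2 : G ≤ |μ + s| := by
    refine hfar.trans ?_
    have := abs_abs_sub_abs_le_abs_sub μ (-s)
    rwa [abs_neg, abs_of_nonneg hs, sub_neg_eq_add] at this
  set e := μ * c - s * c' with he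
  set f := μ * c' - s * c with hf
  -- Sum and difference decouple the two equations, with factors `μ - s` and `μ + s`. Both are at
  -- least `G` in modulus, whatever the sign of `μ`.
  have h3 : |μ - s| * |c + c'| ≤ |e| + |f| := by
    rw [← abs_mul]
    have : (μ - s) * (c + c') = e + f := by rw [he, hf]; ring
    rw [this]; exact abs_add_le _ _
  have h4 : |μ + s| * |c - c'| ≤ |e| + |f| := by
    rw [← abs_mul]
    have : (μ + s) * (c - c') = e - f := by rw [he, hf]; ring
    rw [this]; exact abs_sub _ _
  have h5 : 2 * |c| ≤ |c + c'| + |c - c'| := by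
    have := abs_add_le (c + c') (c - c')
    have h6 : c + c' + (c - c') = 2 * c := by ring
    rw [h6, abs_mul, abs_two] at this
    exact this
  rw [le_div_iff₀ hG]
  have h7 : G * |c + c'| ≤ |e| + |f| :=
    (mul_le_mul_of_nonneg_right h1 (abs_nonneg _)).trans h3
  have h8 : G * |c - c'| ≤ |e| + |f| :=
    (mul_le_mul_of_nonneg_right h2 (abs_nonneg _)).trans h4
  nlinarith

variable {μ : Fin k → ℝ} {M R U V : Matrix (Fin k) (Fin k) ℝ} {s : Fin k → ℝ} {ρ Λ Δ η : ℝ}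

/-- `B`, `diag(μ)` and `Bᵀ` have norms at most `5 / 4`, `5 / 4 * Λ` and `5 / 4`, and `(5 / 4) ^ 3 <
2`. -/
lemma singular_value_le (hg : OpLe (B * Bᵀ - 1) g) (hg4 : g ≤ 1 / 4) (hM : M =
    B * Matrix.diagonal μ * Bᵀ + R) (hR : OpLe R ρ) (hΛ : 0 ≤ Λ) (hμ : ∀ j, |μ j| ≤ 5 / 4 * Λ)
    (hsvd : IsSVD M U s V) (a : Fin k) : s a ≤ 2 * Λ + ρ := by
  have hBT : OpLe Bᵀ (5 / 4) :=
    near_orthogonal_transpose_le hg (by norm_num) (by norm_num; linarith)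
  have hB : OpLe B (5 / 4) := by
    have := hBT.transpose (by norm_num)
    rwa [Matrix.transpose_transpose] at this
  have h1 : OpLe M (5 / 4 * (5 / 4 * Λ) * (5 / 4) + ρ) := by
    rw [hM]
    exact ((hB.mul (OpLe.diagonal (by positivity) hμ) (by norm_num)).mul hBT (by positivity)).add hR
  have h2 := h1 (V.col a)
  rw [hsvd.mulVec_right, l2_smul, l2_col_of_isometry hsvd.left_mul, l2_col_of_isometry
    hsvd.right_mul, abs_of_nonneg (hsvd.nonneg a)] at h2
  linarith

/-- Residuals of a singular pair in the coordinates given by `B`. -/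
lemma singular_pair_residual (hg : OpLe (B * Bᵀ - 1) g) (hg4 : g ≤ 1 / 4)
    {x y : Fin k → ℝ} {σ : ℝ} (hσ : 0 ≤ σ) (hx : l2 x = 1) (hy : l2 y = 1) {R : Matrix (Fin k)
    (Fin k) ℝ} (hR : OpLe R ρ) (h : (B * Matrix.diagonal μ * Bᵀ + R) *ᵥ x = σ • y) :
    l2 (fun j => μ j * (Bᵀ *ᵥ x) j - σ * (Bᵀ *ᵥ y) j) ≤ 2 * (ρ + σ * g) := by
  set e : Fin k → ℝ := fun j => μ j * (Bᵀ *ᵥ x) j - σ * (Bᵀ *ᵥ y) j with he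
  have hBe : B *ᵥ e = -(R *ᵥ x + σ • ((B * Bᵀ - 1) *ᵥ y)) := by
    have h1 : e = Matrix.diagonal μ *ᵥ (Bᵀ *ᵥ x) - σ • (Bᵀ *ᵥ y) := by
      ext j
      rw [Pi.sub_apply, Matrix.mulVec_diagonal]
      rfl
    have h2 : B *ᵥ (Matrix.diagonal μ *ᵥ (Bᵀ *ᵥ x)) = σ • y - R *ᵥ x := by
      rw [← h, Matrix.add_mulVec, Matrix.mulVec_mulVec, Matrix.mulVec_mulVec,
        add_sub_cancel_right]
    rw [h1, Matrix.mulVec_sub, h2, Matrix.mulVec_smul, Matrix.sub_mulVec, Matrix.one_mulVec,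
      ← Matrix.mulVec_mulVec, smul_sub]
    abel
  have h1 := near_orthogonal_lower hg hg4 e
  rw [hBe, l2_neg] at h1
  have h2 := l2_add_le (R *ᵥ x) (σ • ((B * Bᵀ - 1) *ᵥ y))
  rw [l2_smul, abs_of_nonneg hσ] at h2
  have h3 := hR x
  have h4 := mul_le_mul_of_nonneg_left (hg y) hσ
  rw [hx] at h3
  rw [hy] at h4
  linarith

/-- The left singular vectors of a perturbation of `B diag(μ) Bᵀ`, where `B` is nearly orthogonal
and the `|μ j|` are well separated, are close to the columns of `B`. -/
lemma left_singular_vectors_close (hg0 : 0 ≤ g) (hg : OpLe (B * Bᵀ - 1) g) (hg4 : g ≤ 1 / 4)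
    (hM : M = B * Matrix.diagonal μ * Bᵀ + R) (hρ : 0 ≤ ρ) (hR : OpLe R ρ) (hΛ : 0 ≤ Λ)
    (hμ : ∀ j, |μ j| ≤ 5 / 4 * Λ) (hsvd : IsSVD M U s V) (hΔ : 0 < Δ)
    (hgap : ∀ i j, i ≠ j → Δ ≤ |(|μ i| - |μ j|)|)
    (hη : 4 * (3 * ρ + 4 * Λ * g) / Δ ≤ η) (hη4 : η ≤ 1 / 4) :
    ∃ τ : Equiv.Perm (Fin k), ∀ i,
      ∑ j ∈ Finset.univ.erase i, (Bᵀ *ᵥ U.col (τ i)) j ^ 2 ≤ η ^ 2 := by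
  have hη0 : 0 ≤ η := le_trans (by positivity) hη
  have hBT : OpLe Bᵀ (9 / 8) :=
    near_orthogonal_transpose_le hg (by norm_num) (by norm_num; linarith)
  have hres : ∀ a : Fin k,
      l2 (fun j => μ j * (Bᵀ *ᵥ U.col a) j - s a * (Bᵀ *ᵥ V.col a) j) ≤ 3 * ρ + 4 * Λ * g ∧
      l2 (fun j => μ j * (Bᵀ *ᵥ V.col a) j - s a * (Bᵀ *ᵥ U.col a) j) ≤ 3 * ρ + 4 * Λ * g := by
    intro a
    have hs := singular_value_le hg hg4 hM hR hΛ hμ hsvd a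
    have hs0 := hsvd.nonneg a
    have hU1 := l2_col_of_isometry hsvd.left_mul a
    have hV1 := l2_col_of_isometry hsvd.right_mul a
    have hle : 2 * (ρ + s a * g) ≤ 3 * ρ + 4 * Λ * g := by nlinarith
    have hMT : Mᵀ = B * Matrix.diagonal μ * Bᵀ + Rᵀ := by
      rw [hM]; simp [Matrix.mul_assoc]
    refine ⟨(singular_pair_residual hg hg4 hs0 hU1 hV1 (hR.transpose hρ) ?_).trans hle,
      (singular_pair_residual hg hg4 hs0 hV1 hU1 hR ?_).trans hle⟩
    · rw [← hMT]; exact hsvd.transpose_mulVec_left a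
    · rw [← hM]; exact hsvd.mulVec_right a
  have hfar : ∀ a : Fin k, ∀ J : Finset (Fin k), (∀ j ∈ J, Δ / 2 ≤ |(|μ j| - s a)|) →
      ∑ j ∈ J, (Bᵀ *ᵥ U.col a) j ^ 2 ≤ η ^ 2 := by
    intro a J hJ
    set e : Fin k → ℝ := fun j => μ j * (Bᵀ *ᵥ U.col a) j - s a * (Bᵀ *ᵥ V.col a) j with he
    set f : Fin k → ℝ := fun j => μ j * (Bᵀ *ᵥ V.col a) j - s a * (Bᵀ *ᵥ U.col a) j with hf
    set χ := 3 * ρ + 4 * Λ * g with hχ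
    have hχ0 : 0 ≤ χ := by positivity
    have he2 : ∑ j, e j ^ 2 ≤ χ ^ 2 := by
      rw [← l2_sq]; exact pow_le_pow_left₀ (l2_nonneg _) (hres a).1 2
    have hf2 : ∑ j, f j ^ 2 ≤ χ ^ 2 := by
      rw [← l2_sq]; exact pow_le_pow_left₀ (l2_nonneg _) (hres a).2 2
    calc ∑ j ∈ J, (Bᵀ *ᵥ U.col a) j ^ 2
        ≤ ∑ j ∈ J, 8 / Δ ^ 2 * (e j ^ 2 + f j ^ 2) := by
          refine Finset.sum_le_sum fun j hj => ?_
          have h1 := far_coordinate_bound (c := (Bᵀ *ᵥ U.col a) j) (c' := (Bᵀ *ᵥ V.col a) j)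
            (hsvd.nonneg a) (half_pos hΔ) (hJ j hj)
          have h2 : (Bᵀ *ᵥ U.col a) j ^ 2 ≤ ((|e j| + |f j|) / (Δ / 2)) ^ 2 := by
            rw [← sq_abs]; exact pow_le_pow_left₀ (abs_nonneg _) h1 2
          refine h2.trans ?_
          have h3 : ((|e j| + |f j|) / (Δ / 2)) ^ 2 = 4 / Δ ^ 2 * (|e j| + |f j|) ^ 2 := by
            field_simp; ring
          have h4 : (|e j| + |f j|) ^ 2 ≤ 2 * (e j ^ 2 + f j ^ 2) := by
            rw [← sq_abs (e j), ← sq_abs (f j)]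
            nlinarith [sq_nonneg (|e j| - |f j|)]
          have h5 : 0 ≤ 4 / Δ ^ 2 := by positivity
          rw [h3]
          calc 4 / Δ ^ 2 * (|e j| + |f j|) ^ 2 ≤ 4 / Δ ^ 2 * (2 * (e j ^ 2 + f j ^ 2)) :=
                mul_le_mul_of_nonneg_left h4 h5
            _ = _ := by ring
      _ ≤ ∑ j, 8 / Δ ^ 2 * (e j ^ 2 + f j ^ 2) :=
          Finset.sum_le_sum_of_subset_of_nonneg (Finset.subset_univ J)
            fun j _ _ => by positivity
      _ = 8 / Δ ^ 2 * (∑ j, e j ^ 2 + ∑ j, f j ^ 2) := by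
          rw [← Finset.mul_sum, Finset.sum_add_distrib]
      _ ≤ 8 / Δ ^ 2 * (χ ^ 2 + χ ^ 2) :=
          mul_le_mul_of_nonneg_left (add_le_add he2 hf2) (by positivity)
      _ = (4 * χ / Δ) ^ 2 := by field_simp; ring
      _ ≤ η ^ 2 := pow_le_pow_left₀ (by positivity) hη 2
  have hcol : ∀ a : Fin k, 1 - g ≤ ∑ j, (Bᵀ *ᵥ U.col a) j ^ 2 := by
    intro a
    have h := (abs_le.1 (near_orthogonal_sq hg (U.col a))).1
    rw [l2_col_of_isometry hsvd.left_mul, l2_sq] at h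
    linarith
  -- Otherwise all coordinates of `Bᵀ u_a` would be small, although its squared norm is at least `1
  -- - g ≥ 3 / 4`.
  have hnear : ∀ a : Fin k, ∃ i, |(|μ i| - s a)| < Δ / 2 := by
    intro a
    by_contra hcon
    push Not at hcon
    have h1 := hfar a Finset.univ fun j _ => hcon j
    have h2 := hcol a
    nlinarith
  choose π hπ using hnear
  have herase : ∀ a : Fin k,
      ∑ j ∈ Finset.univ.erase (π a), (Bᵀ *ᵥ U.col a) j ^ 2 ≤ η ^ 2 := by
    intro a
    refine hfar a _ fun j hj => ?_
    by_contra hcon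
    push Not at hcon
    have h1 := hgap j (π a) (Finset.ne_of_mem_erase hj)
    have h2 := hπ a
    have h3 : |μ j| - |μ (π a)| = (|μ j| - s a) - (|μ (π a)| - s a) := by ring
    rw [h3] at h1
    have h4 := abs_sub (|μ j| - s a) (|μ (π a)| - s a)
    linarith
  have hbig : ∀ a : Fin k, 1 - g - η ^ 2 ≤ (Bᵀ *ᵥ U.col a) (π a) ^ 2 := by
    intro a
    have h1 := hcol a
    rw [← Finset.add_sum_erase _ _ (Finset.mem_univ (π a))] at h1
    have h2 := herase a
    linarith
  -- If two singular vectors shared the index `i`, column `i` of `B` would have squared norm at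
  -- least `2 * (1 - g - η ^ 2) ≥ 11 / 8`, which exceeds `(9 / 8) ^ 2`.
  have hinj : Function.Injective π := by
    intro a b hab
    by_contra hne
    have hsum : ∑ a', (Uᵀ *ᵥ B.col (π a)) a' ^ 2 ≤ (9 / 8) ^ 2 := by
      rw [← hsvd.l2_sq_eq]
      have hB : OpLe B (9 / 8) := by
        have := hBT.transpose (by norm_num)
        rwa [Matrix.transpose_transpose] at this
      have h := hB (Pi.single (π a) 1)
      rw [Matrix.mulVec_single_one] at h
      have h2 : l2 (Pi.single (π a) (1 : ℝ)) = 1 := by simp [l2]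
      rw [h2, mul_one] at h
      exact pow_le_pow_left₀ (l2_nonneg _) h 2
    have hcoord : ∀ a', (Uᵀ *ᵥ B.col (π a)) a' = (Bᵀ *ᵥ U.col a') (π a) := by
      intro a'
      exact dotProduct_comm (U.col a') (B.col (π a))
    have h2 := Finset.add_le_sum (f := fun a' => (Uᵀ *ᵥ B.col (π a)) a' ^ 2)
      (fun i _ => sq_nonneg _) (Finset.mem_univ a) (Finset.mem_univ b) hne
    simp only [hcoord] at h2 hsum
    have h3 := hbig a
    have h4 := hbig b
    rw [← hab] at h4
    nlinarith
  refine ⟨(Equiv.ofBijective π (Finite.injective_iff_bijective.1 hinj)).symm, fun i => ?_⟩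
  set a := (Equiv.ofBijective π (Finite.injective_iff_bijective.1 hinj)).symm i with ha
  have hi : π a = i := by
    have := (Equiv.ofBijective π (Finite.injective_iff_bijective.1 hinj)).apply_symm_apply i
    exact this
  have := herase a
  rwa [hi] at this

/-- If all but one of the coordinates of a nearly unit vector are small, it is close to plus or
minus a basis vector. -/
lemma exists_sign_close (hg0 : 0 ≤ g) (hg4 : g ≤ 1 / 4) (hη0 : 0 ≤ η) (hη4 : η ≤ 1 / 4)
    {c : Fin k → ℝ} (hc : |l2 c ^ 2 - 1| ≤ g) (i : Fin k)
    (hsmall : ∑ j ∈ Finset.univ.erase i, c j ^ 2 ≤ η ^ 2) :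
    ∃ ς : ℝ, ς ^ 2 = 1 ∧ |ς| = 1 ∧ l2 (c - ς • Pi.single i 1) ≤ g + 2 * η := by
  have hsum : l2 c ^ 2 = c i ^ 2 + ∑ j ∈ Finset.univ.erase i, c j ^ 2 := by
    rw [l2_sq, Finset.add_sum_erase _ (fun j => c j ^ 2) (Finset.mem_univ i)]
  have hnn : 0 ≤ ∑ j ∈ Finset.univ.erase i, c j ^ 2 := Finset.sum_nonneg fun j _ => sq_nonneg _
  have hci : |c i ^ 2 - 1| ≤ g + η ^ 2 := by
    rw [abs_le] at hc ⊢
    constructor <;> nlinarith [hc.1, hc.2]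
  have key : ∀ ς : ℝ, ς ^ 2 = 1 → 0 ≤ ς * c i → l2 (c - ς • Pi.single i 1) ≤ g + 2 * η := by
    intro ς hς hpos
    have h1 : (c i - ς) ^ 2 ≤ (g + η ^ 2) ^ 2 := by
      have h2 : (c i ^ 2 - 1) ^ 2 = (c i - ς) ^ 2 * (c i + ς) ^ 2 := by rw [← hς]; ring
      have h3 : 1 ≤ (c i + ς) ^ 2 := by nlinarith [sq_nonneg (c i)]
      have h4 : (c i ^ 2 - 1) ^ 2 ≤ (g + η ^ 2) ^ 2 := by
        rw [← sq_abs (c i ^ 2 - 1)]; exact pow_le_pow_left₀ (abs_nonneg _) hci 2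
      nlinarith [sq_nonneg (c i - ς)]
    refine l2_le_of_sq_le (by positivity) ?_
    rw [l2_sq, ← Finset.add_sum_erase _ _ (Finset.mem_univ i)]
    have h5 : ∑ j ∈ Finset.univ.erase i, (c - ς • Pi.single i 1 : Fin k → ℝ) j ^ 2 =
        ∑ j ∈ Finset.univ.erase i, c j ^ 2 := by
      refine Finset.sum_congr rfl fun j hj => ?_
      simp [Pi.single_eq_of_ne (Finset.ne_of_mem_erase hj)]
    rw [h5]
    simp only [Pi.sub_apply, Pi.smul_apply, Pi.single_eq_same, smul_eq_mul, mul_one]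
    have h6 : η ^ 2 ≤ η := by nlinarith
    nlinarith [mul_nonneg hg0 hη0]
  rcases le_total 0 (c i) with h | h
  · exact ⟨1, by norm_num, by norm_num, key 1 (by norm_num) (by linarith)⟩
  · exact ⟨-1, by norm_num, by norm_num, key (-1) (by norm_num) (by linarith)⟩

end SingularVectors

/-! ### Reconstruction of the topics -/

section Reconstruction

variable {d k : ℕ}

lemma OpLe.of_bilinear {m n : Type*} [Fintype m] [Fintype n] {A : Matrix m n ℝ} {c : ℝ}
    (hc : 0 ≤ c) (h : ∀ x y, |x ⬝ᵥ (A *ᵥ y)| ≤ c * (l2 x * l2 y)) : OpLe A c := by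
  intro y
  have h1 := h (A *ᵥ y) y
  rw [← l2_sq_eq_dotProduct, abs_of_nonneg (sq_nonneg _)] at h1
  rcases (l2_nonneg (A *ᵥ y)).eq_or_lt with h0 | hpos
  · rw [← h0]; exact mul_nonneg hc (l2_nonneg y)
  · nlinarith

/-- The diagonal tensor `∑ᵢ 2/(α₀+2) Dᵢ Oᵢ ⊗ Oᵢ ⊗ Oᵢ` contracted with `η`. -/
def diagTriples (α₀ : ℝ) (O : Matrix (Fin d) (Fin k) ℝ) (D : Fin k → ℝ) (η : Fin d → ℝ) :
    Matrix (Fin d) (Fin d) ℝ :=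
  O * Matrix.diagonal (fun i => 2 / (α₀ + 2) * D i * (Oᵀ *ᵥ η) i) * Oᵀ

/-- The whitened, rescaled topics. -/
def whitened (O : Matrix (Fin d) (Fin k) ℝ) (D : Fin k → ℝ) (W : Matrix (Fin d) (Fin k) ℝ) :
    Matrix (Fin k) (Fin k) ℝ :=
  Wᵀ * O * Matrix.diagonal fun i => Real.sqrt (D i)

/-- The coefficients of the whitened third moment. -/
def whitenedCoeff (α₀ : ℝ) (D : Fin k → ℝ) (i : Fin k) : ℝ := 2 / ((α₀ + 2) * Real.sqrt (D i))

variable {O : Matrix (Fin d) (Fin k) ℝ} {D : Fin k → ℝ} {W : Matrix (Fin d) (Fin k) ℝ} {α₀ : ℝ}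

lemma whitened_mul_transpose (hD : ∀ i, 0 < D i) :
    whitened O D W * (whitened O D W)ᵀ = Wᵀ * (O * Matrix.diagonal D * Oᵀ) * W := by
  have h : Matrix.diagonal D = Matrix.diagonal (fun i => Real.sqrt (D i)) *
      Matrix.diagonal fun i => Real.sqrt (D i) := by
    rw [Matrix.diagonal_mul_diagonal]
    congr 1
    ext i
    exact (Real.mul_self_sqrt (hD i).le).symm
  rw [h]
  simp only [whitened, Matrix.transpose_mul, Matrix.transpose_transpose,
    Matrix.diagonal_transpose, Matrix.mul_assoc]

lemma whitened_transpose_mulVec (v : Fin k → ℝ) (j : Fin k) :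
    ((whitened O D W)ᵀ *ᵥ v) j = Real.sqrt (D j) * (Oᵀ *ᵥ (W *ᵥ v)) j := by
  have h : (whitened O D W)ᵀ = Matrix.diagonal (fun i => Real.sqrt (D i)) * (Oᵀ * W) := by
    simp [whitened]
  rw [h, ← Matrix.mulVec_mulVec, Matrix.mulVec_diagonal, Matrix.mulVec_mulVec]

/-- Each of the three slots takes a factor `√(D j)` into `whitened O D W`. Together these make `D j
* √(D j)`, so the coefficient is divided by `√(D j)`. -/
lemma whitened_diagTriples (hD : ∀ i, 0 < D i) (hα : 0 < α₀) (θ : Fin k → ℝ) :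
    Wᵀ * diagTriples α₀ O D (W *ᵥ θ) * W = whitened O D W *
      Matrix.diagonal (fun j => whitenedCoeff α₀ D j * ((whitened O D W)ᵀ *ᵥ θ) j) *
        (whitened O D W)ᵀ := by
  have h : Matrix.diagonal (fun i => 2 / (α₀ + 2) * D i * (Oᵀ *ᵥ (W *ᵥ θ)) i) =
      Matrix.diagonal (fun i => Real.sqrt (D i)) *
        (Matrix.diagonal (fun j => whitenedCoeff α₀ D j * ((whitened O D W)ᵀ *ᵥ θ) j) *
        Matrix.diagonal fun i => Real.sqrt (D i)) := by
    rw [Matrix.diagonal_mul_diagonal, Matrix.diagonal_mul_diagonal]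
    congr 1
    ext i
    rw [whitened_transpose_mulVec, whitenedCoeff]
    have hs := Real.sqrt_pos.2 (hD i)
    have h2 : α₀ + 2 ≠ 0 := by linarith
    nth_rewrite 1 [← Real.mul_self_sqrt (hD i).le]
    field_simp
  rw [diagTriples, h]
  generalize (fun j => whitenedCoeff α₀ D j * ((whitened O D W)ᵀ *ᵥ θ) j) = f
  simp only [whitened, Matrix.transpose_mul, Matrix.transpose_transpose,
    Matrix.diagonal_transpose, Matrix.mul_assoc]

lemma cubic_diagTriples (hD : ∀ i, 0 < D i) (hα : 0 < α₀) (v : Fin k → ℝ) :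
    (W *ᵥ v) ⬝ᵥ (diagTriples α₀ O D (W *ᵥ v) *ᵥ (W *ᵥ v)) =
      ∑ j, whitenedCoeff α₀ D j * ((whitened O D W)ᵀ *ᵥ v) j ^ 3 := by
  rw [diagTriples, weighted_gram_quad]
  refine Finset.sum_congr rfl fun j _ => ?_
  rw [whitened_transpose_mulVec, whitenedCoeff]
  have hs := Real.sqrt_pos.2 (hD j)
  have h2 : α₀ + 2 ≠ 0 := by linarith
  nth_rewrite 1 [← Real.mul_self_sqrt (hD j).le]
  field_simp

/-- The factor `(α₀ + 2) / 2 * λ i` is `1 / √(D i)`. Thus a topic is recovered from `λ i B_i`, the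
vector that cubic form times singular vector approximates. -/
lemma whitened_col (hD : ∀ i, 0 < D i) (hα : 0 < α₀) (i : Fin k) :
    Wᵀ *ᵥ O.col i = ((α₀ + 2) / 2 * whitenedCoeff α₀ D i) • (whitened O D W).col i := by
  have hs := Real.sqrt_pos.2 (hD i)
  have h2 : α₀ + 2 ≠ 0 := by linarith
  have hcol : (whitened O D W).col i = Real.sqrt (D i) • (Wᵀ *ᵥ O.col i) := by
    ext a
    have h : (whitened O D W).col i a = whitened O D W a i := rfl
    rw [h, whitened, Matrix.mul_diagonal, mul_comm]
    rfl
  rw [hcol, smul_smul, whitenedCoeff]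
  have : (α₀ + 2) / 2 * (2 / ((α₀ + 2) * Real.sqrt (D i))) * Real.sqrt (D i) = 1 := by
    field_simp
  rw [this, one_smul]

variable {T : (Fin d → ℝ) → Matrix (Fin d) (Fin d) ℝ} {F ω : ℝ}

lemma whitened_noise (hF : 0 ≤ F) (hω : 0 ≤ ω) (hW : OpLe W ω)
    (hT : ∀ η x y, |x ⬝ᵥ ((T η - diagTriples α₀ O D η) *ᵥ y)| ≤ F * (l2 x * (l2 y * l2 η)))
    {θ : Fin k → ℝ} (hθ : l2 θ = 1) :
    OpLe (Wᵀ * (T (W *ᵥ θ) - diagTriples α₀ O D (W *ᵥ θ)) * W) (F * ω ^ 3) := by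
  refine OpLe.of_bilinear (by positivity) fun x y => ?_
  have h1 : x ⬝ᵥ ((Wᵀ * (T (W *ᵥ θ) - diagTriples α₀ O D (W *ᵥ θ)) * W) *ᵥ y) =
      (W *ᵥ x) ⬝ᵥ ((T (W *ᵥ θ) - diagTriples α₀ O D (W *ᵥ θ)) *ᵥ (W *ᵥ y)) := by
    rw [Matrix.mul_assoc, ← Matrix.mulVec_mulVec, dotProduct_mulVec_transpose,
      Matrix.transpose_transpose, ← Matrix.mulVec_mulVec]
  rw [h1]
  refine (hT _ _ _).trans ?_
  have hx := hW x
  have hy := hW y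
  have hθ' := hW θ
  rw [hθ, mul_one] at hθ'
  calc F * (l2 (W *ᵥ x) * (l2 (W *ᵥ y) * l2 (W *ᵥ θ)))
      ≤ F * ((ω * l2 x) * ((ω * l2 y) * ω)) := by
        have := l2_nonneg (W *ᵥ x)
        have := l2_nonneg (W *ᵥ y)
        have := l2_nonneg (W *ᵥ θ)
        have := l2_nonneg x
        have := l2_nonneg y
        gcongr
    _ = F * ω ^ 3 * (l2 x * l2 y) := by ring

lemma cubic_noise (hF : 0 ≤ F) (hω : 0 ≤ ω) (hW : OpLe W ω)
    (hT : ∀ η x y, |x ⬝ᵥ ((T η - diagTriples α₀ O D η) *ᵥ y)| ≤ F * (l2 x * (l2 y * l2 η)))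
    (hD : ∀ i, 0 < D i) (hα : 0 < α₀) {v : Fin k → ℝ} (hv : l2 v = 1) :
    |(W *ᵥ v) ⬝ᵥ (T (W *ᵥ v) *ᵥ (W *ᵥ v)) -
      ∑ j, whitenedCoeff α₀ D j * ((whitened O D W)ᵀ *ᵥ v) j ^ 3| ≤ F * ω ^ 3 := by
  rw [← cubic_diagTriples hD hα, ← dotProduct_sub, ← Matrix.sub_mulVec]
  refine (hT _ _ _).trans ?_
  have h := hW v
  rw [hv, mul_one] at h
  have h0 := l2_nonneg (W *ᵥ v)
  calc F * (l2 (W *ᵥ v) * (l2 (W *ᵥ v) * l2 (W *ᵥ v))) ≤ F * (ω * (ω * ω)) := by gcongr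
    _ = F * ω ^ 3 := by ring

/-- With the convention `x / 0 = 0` this holds also if the cubic form vanishes, so the analysis
never divides by it. -/
lemma reconstruct_eq (α₀ : ℝ) (T : (Fin d → ℝ) → Matrix (Fin d) (Fin d) ℝ)
    (W : Matrix (Fin d) (Fin k) ℝ) (v : Fin k → ℝ) :
    reconstruct α₀ T W v = (pinv W)ᵀ *ᵥ
      (((α₀ + 2) / 2 * ((W *ᵥ v) ⬝ᵥ (T (W *ᵥ v) *ᵥ (W *ᵥ v)))) • v) := by
  rw [reconstruct, scale, inv_div, Matrix.mulVec_smul]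
  congr 1
  ring

/-- The reconstruction error in terms of the whitened quantities. -/
lemma reconstruct_error (hD : ∀ i, 0 < D i) (hα : 0 < α₀) {κ : ℝ}
    (hQ : OpLe (pinv W)ᵀ κ) (v : Fin k → ℝ) (i : Fin k) :
    l2 (O.col i - reconstruct α₀ T W v) ≤ l2 (O.col i - (pinv W)ᵀ *ᵥ (Wᵀ *ᵥ O.col i)) +
      κ * ((α₀ + 2) / 2 * l2 (whitenedCoeff α₀ D i • (whitened O D W).col i -
        ((W *ᵥ v) ⬝ᵥ (T (W *ᵥ v) *ᵥ (W *ᵥ v))) • v)) := by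
  have h : O.col i - reconstruct α₀ T W v = (O.col i - (pinv W)ᵀ *ᵥ (Wᵀ *ᵥ O.col i)) +
      (pinv W)ᵀ *ᵥ (((α₀ + 2) / 2) • (whitenedCoeff α₀ D i • (whitened O D W).col i -
        ((W *ᵥ v) ⬝ᵥ (T (W *ᵥ v) *ᵥ (W *ᵥ v))) • v)) := by
    rw [smul_sub, smul_smul, smul_smul, ← whitened_col hD hα, Matrix.mulVec_sub, reconstruct_eq]
    abel
  rw [h]
  refine (l2_add_le _ _).trans (add_le_add le_rfl ?_)
  refine (hQ _).trans (le_of_eq ?_)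
  rw [l2_smul, abs_of_pos (by linarith : (0 : ℝ) < (α₀ + 2) / 2)]

lemma sum_abs_cube_le {c : Fin k → ℝ} {b : ℝ} (hc : l2 c ≤ b) : ∑ j, |c j| ^ 3 ≤ b ^ 3 := by
  have h0 := l2_nonneg c
  calc ∑ j, |c j| ^ 3 ≤ ∑ j, b * c j ^ 2 := by
        refine Finset.sum_le_sum fun j _ => ?_
        have h1 := (abs_apply_le_l2 c j).trans hc
        rw [← sq_abs (c j)]
        nlinarith [sq_nonneg |c j|]
    _ = b * l2 c ^ 2 := by rw [← Finset.mul_sum, l2_sq]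
    _ ≤ b * b ^ 2 := mul_le_mul_of_nonneg_left (pow_le_pow_left₀ h0 hc 2) (h0.trans hc)
    _ = b ^ 3 := by ring

variable {Λ : ℝ}

/-- An a priori bound for the scale of the reconstruction. -/
lemma abs_cubic_le (hF : 0 ≤ F) (hω : 0 ≤ ω) (hW : OpLe W ω)
    (hT : ∀ η x y, |x ⬝ᵥ ((T η - diagTriples α₀ O D η) *ᵥ y)| ≤ F * (l2 x * (l2 y * l2 η)))
    (hD : ∀ i, 0 < D i) (hα : 0 < α₀) (hΛ : ∀ i, |whitenedCoeff α₀ D i| ≤ Λ)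
    {b : ℝ} (hB : OpLe (whitened O D W)ᵀ b) {v : Fin k → ℝ} (hv : l2 v = 1) :
    |(W *ᵥ v) ⬝ᵥ (T (W *ᵥ v) *ᵥ (W *ᵥ v))| ≤ F * ω ^ 3 + Λ * b ^ 3 := by
  have h1 := cubic_noise hF hω hW hT hD hα hv
  set c := (whitened O D W)ᵀ *ᵥ v with hc
  have hcb : l2 c ≤ b := by have := hB v; rwa [hv, mul_one] at this
  have h2 : |∑ j, whitenedCoeff α₀ D j * c j ^ 3| ≤ Λ * b ^ 3 := by
    rcases Nat.eq_zero_or_pos k with rfl | hk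
    · exfalso
      rw [l2_eq_zero.2 (Subsingleton.elim v 0)] at hv
      exact zero_ne_one hv
    have hΛ0 : 0 ≤ Λ := (abs_nonneg _).trans (hΛ ⟨0, hk⟩)
    refine (Finset.abs_sum_le_sum_abs _ _).trans ?_
    refine le_trans ?_ (mul_le_mul_of_nonneg_left (sum_abs_cube_le hcb) hΛ0)
    rw [Finset.mul_sum]
    refine Finset.sum_le_sum fun j _ => ?_
    rw [abs_mul, abs_pow]
    exact mul_le_mul_of_nonneg_right (hΛ j) (by positivity)
  set K := (W *ᵥ v) ⬝ᵥ (T (W *ᵥ v) *ᵥ (W *ᵥ v)) with hK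
  have h3 := abs_sub_abs_le_abs_sub K (∑ j, whitenedCoeff α₀ D j * c j ^ 3)
  linarith

/-- If a unit vector is close to plus or minus a whitened topic, then so is the corresponding
rescaled vector to the rescaled topic. -/
lemma whitened_topic_error {g ζ ς : ℝ} (hF : 0 ≤ F) (hω : 0 ≤ ω) (hW : OpLe W ω)
    (hT : ∀ η x y, |x ⬝ᵥ ((T η - diagTriples α₀ O D η) *ᵥ y)| ≤ F * (l2 x * (l2 y * l2 η)))
    (hD : ∀ i, 0 < D i) (hα : 0 < α₀) (hΛ : ∀ i, |whitenedCoeff α₀ D i| ≤ Λ)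
    (hg : OpLe (whitened O D W * (whitened O D W)ᵀ - 1) g) (hg4 : g ≤ 1 / 4)
    {v : Fin k → ℝ} (hv : l2 v = 1) (i : Fin k) (hς : ς ^ 2 = 1) (hς1 : |ς| = 1)
    (hζ1 : ζ ≤ 1) (hgζ : g ≤ ζ) (hζ : l2 ((whitened O D W)ᵀ *ᵥ v - ς • Pi.single i 1) ≤ ζ) :
    l2 (whitenedCoeff α₀ D i • (whitened O D W).col i -
      ((W *ᵥ v) ⬝ᵥ (T (W *ᵥ v) *ᵥ (W *ᵥ v))) • v) ≤ F * ω ^ 3 + 10 * Λ * ζ := by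
  have h1 := cubic_noise hF hω hW hT hD hα hv
  set B := whitened O D W with hB
  set c := Bᵀ *ᵥ v with hc
  set K := (W *ᵥ v) ⬝ᵥ (T (W *ᵥ v) *ᵥ (W *ᵥ v)) with hK
  set lam := whitenedCoeff α₀ D with hlam
  set x := c - ς • Pi.single i 1 with hx
  have hΛ0 : 0 ≤ Λ := (abs_nonneg _).trans (hΛ i)
  have hζ0 : 0 ≤ ζ := (l2_nonneg x).trans hζ
  have hBop : OpLe B (5 / 4) := by
    have := (near_orthogonal_transpose_le hg (c := 5 / 4) (by norm_num)
      (by norm_num; linarith)).transpose (by norm_num)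
    rwa [Matrix.transpose_transpose] at this
  -- `v = B (Bᵀ v) - (B Bᵀ - 1) v` with `Bᵀ v = ς e_i + x`: the error is at most `5 / 4 * ζ + g`.
  have hclose : l2 (v - ς • B.col i) ≤ 9 / 4 * ζ := by
    have h : v - ς • B.col i = B *ᵥ x - (B * Bᵀ - 1) *ᵥ v := by
      rw [hx, Matrix.mulVec_sub, Matrix.mulVec_smul, Matrix.mulVec_single_one, Matrix.sub_mulVec,
        Matrix.one_mulVec, hc, Matrix.mulVec_mulVec]
      abel
    rw [h]
    have h2 := l2_sub_le (B *ᵥ x) ((B * Bᵀ - 1) *ᵥ v)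
    have h3 := hBop x
    have h4 := hg v
    rw [hv, mul_one] at h4
    linarith
  have hcube : |∑ j, lam j * c j ^ 3 - ς * lam i| ≤ 7 * Λ * ζ := by
    have hxj : ∀ j, j ≠ i → c j = x j := by
      intro j hj; simp [hx, Pi.single_eq_of_ne hj]
    have hxi : c i = ς + x i := by simp [hx]
    have hxi1 : |x i| ≤ ζ := (abs_apply_le_l2 x i).trans hζ
    -- Expansion of `(ς + x i) ^ 3` with `ς ^ 2 = 1`; the term `x i ^ 3` joins the sum over the
    -- other indices.
    have hdec : ∑ j, lam j * c j ^ 3 - ς * lam i =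
        lam i * (3 * x i + 3 * ς * x i ^ 2) + ∑ j, lam j * x j ^ 3 := by
      rw [← Finset.add_sum_erase _ _ (Finset.mem_univ i),
        ← Finset.add_sum_erase _ (fun j => lam j * x j ^ 3) (Finset.mem_univ i)]
      have h : ∑ j ∈ Finset.univ.erase i, lam j * c j ^ 3 =
          ∑ j ∈ Finset.univ.erase i, lam j * x j ^ 3 :=
        Finset.sum_congr rfl fun j hj => by rw [hxj j (Finset.ne_of_mem_erase hj)]
      rw [h, hxi]
      linear_combination (lam i * ς + 3 * lam i * x i) * hς
    have h5 : |∑ j, lam j * x j ^ 3| ≤ Λ * ζ := by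
      refine (Finset.abs_sum_le_sum_abs _ _).trans ?_
      have h6 : ∑ j, |x j| ^ 3 ≤ ζ := by
        refine (sum_abs_cube_le hζ).trans ?_
        have : ζ ^ 2 ≤ 1 := by nlinarith
        nlinarith
      refine le_trans ?_ (mul_le_mul_of_nonneg_left h6 hΛ0)
      rw [Finset.mul_sum]
      refine Finset.sum_le_sum fun j _ => ?_
      rw [abs_mul, abs_pow]
      exact mul_le_mul_of_nonneg_right (hΛ j) (by positivity)
    have h7 : |3 * x i + 3 * ς * x i ^ 2| ≤ 6 * ζ := by
      refine (abs_add_le _ _).trans ?_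
      rw [abs_mul, abs_mul, abs_mul, hς1, abs_pow]
      norm_num
      have : |x i| ^ 2 ≤ ζ := by nlinarith [abs_nonneg (x i)]
      rw [sq_abs] at this
      linarith
    rw [hdec]
    refine (abs_add_le _ _).trans ?_
    rw [abs_mul]
    have h8 : |lam i| * |3 * x i + 3 * ς * x i ^ 2| ≤ Λ * (6 * ζ) :=
      mul_le_mul (hΛ i) h7 (abs_nonneg _) hΛ0
    linarith
  have hKς : |K - ς * lam i| ≤ F * ω ^ 3 + 7 * Λ * ζ := by
    have h : K - ς * lam i = (K - ∑ j, lam j * c j ^ 3) + (∑ j, lam j * c j ^ 3 - ς * lam i) := by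
      ring
    rw [h]
    exact (abs_add_le _ _).trans (add_le_add h1 hcube)
  -- The sign disappears here: `K ≈ ς * λ i` and `v ≈ ς B_i`, and `ς ^ 2 = 1`.
  have hfin : lam i • B.col i - K • v =
      -((K - ς * lam i) • v) - (ς * lam i) • (v - ς • B.col i) := by
    have h : lam i • B.col i = (ς ^ 2 * lam i) • B.col i := by rw [hς, one_mul]
    rw [h, smul_sub, smul_smul, sub_smul]
    have : ς * lam i * ς = ς ^ 2 * lam i := by ring
    rw [this]
    abel
  rw [hfin]
  refine (l2_sub_le _ _).trans ?_
  rw [l2_neg, l2_smul, l2_smul, hv, mul_one, abs_mul, hς1, one_mul]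
  have h9 : |lam i| * l2 (v - ς • B.col i) ≤ Λ * (9 / 4 * ζ) :=
    mul_le_mul (hΛ i) hclose (l2_nonneg _) hΛ0
  have : 0 ≤ Λ * ζ := mul_nonneg hΛ0 hζ0
  linarith

end Reconstruction

/-! ### Accuracy of the algorithm for given moment errors -/

section Accuracy

variable {d k : ℕ}

/-- The eigenvalue gap produced by a random direction. -/
lemma sphereUniform_gap (hk : 0 < k) {B : Matrix (Fin k) (Fin k) ℝ} {g L : ℝ}
    (hg : OpLe (B * Bᵀ - 1) g) (hg4 : g ≤ 1 / 4) {lam : Fin k → ℝ} (hL : 0 < L)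
    (hlam : ∀ i, L ≤ lam i) :
    3 / 4 < (sphereUniform k).real {θ | ∀ i j, i ≠ j → L / (64 * k ^ 3) ≤
      |(|lam i * (Bᵀ *ᵥ (θ.1 : Fin k → ℝ)) i| - |lam j * (Bᵀ *ᵥ (θ.1 : Fin k → ℝ)) j|)|} := by
  have hk' : (0 : ℝ) < k := by exact_mod_cast hk
  have : NeZero k := ⟨hk.ne'⟩
  -- For each pair of topics one order of the indices encodes the sum of the two coefficients and
  -- the other their difference. Both are needed, as `||a| - |b||` is the smaller of `|a + b|` and
  -- `|a - b|`; the `k * (k - 1)` vectors still number less than `k ^ 2`.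
  let sg : Fin k × Fin k → ℝ := fun p => if p.1 < p.2 then 1 else -1
  let x : Fin k × Fin k → Fin k → ℝ := fun p =>
    lam p.1 • Pi.single p.1 1 + (sg p * lam p.2) • Pi.single p.2 1
  let u : Fin k × Fin k → EuclideanSpace ℝ (Fin k) := fun p => WithLp.toLp 2 (B *ᵥ x p)
  have hnorm : ∀ p ∈ (Finset.univ : Finset (Fin k)).offDiag, L / 2 ≤ ‖u p‖ := by
    rintro ⟨i, j⟩ hp
    have hij : i ≠ j := (Finset.mem_offDiag.1 hp).2.2
    have h1 := near_orthogonal_lower hg hg4 (x (i, j))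
    have h2 := abs_apply_le_l2 (x (i, j)) i
    have h3 : x (i, j) i = lam i := by simp [x, Pi.single_eq_of_ne hij]
    rw [h3, abs_of_nonneg (hL.le.trans (hlam i))] at h2
    have h4 : ‖u (i, j)‖ = l2 (B *ᵥ x (i, j)) := rfl
    rw [h4]
    linarith [hlam i]
  have hinner : ∀ p (θ : EuclideanSpace ℝ (Fin k)), inner ℝ (u p) θ =
      lam p.1 * (Bᵀ *ᵥ (θ : Fin k → ℝ)) p.1 + sg p * (lam p.2 * (Bᵀ *ᵥ (θ : Fin k → ℝ)) p.2) := by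
    intro p θ
    have h1 : inner ℝ (u p) θ = (θ : Fin k → ℝ) ⬝ᵥ (B *ᵥ x p) := by
      rw [EuclideanSpace.inner_eq_star_dotProduct, star_trivial]
    rw [h1, dotProduct_mulVec_transpose, dotProduct_add, dotProduct_smul, dotProduct_smul,
      dotProduct_single, dotProduct_single, smul_eq_mul, smul_eq_mul]
    ring
  have hcard : (Finset.univ : Finset (Fin k)).offDiag.card < k ^ 2 := by
    rw [Finset.offDiag_card, Finset.card_univ, Fintype.card_fin, sq]
    exact Nat.sub_lt (Nat.mul_pos hk hk) hk
  refine (sphereUniform_forall_inner_large hk _ hcard u fun p hp h0 => ?_).trans_le ?_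
  · have := hnorm p hp
    rw [h0, norm_zero] at this
    linarith
  · refine measureReal_mono ?_ (measure_ne_top _ _)
    intro θ hθ i j hij
    have key : ∀ p ∈ (Finset.univ : Finset (Fin k)).offDiag, L / (64 * k ^ 3) ≤
        |lam p.1 * (Bᵀ *ᵥ (θ.1 : Fin k → ℝ)) p.1 +
          sg p * (lam p.2 * (Bᵀ *ᵥ (θ.1 : Fin k → ℝ)) p.2)| := by
      intro p hp
      rw [← hinner]
      refine le_trans ?_ (hθ p hp)
      have h : L / (64 * (k : ℝ) ^ 3) = L / 2 / (32 * k ^ 3) := by field_simp; norm_num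
      rw [h]
      exact div_le_div_of_nonneg_right (hnorm p hp) (by positivity)
    set a := lam i * (Bᵀ *ᵥ (θ.1 : Fin k → ℝ)) i
    set b := lam j * (Bᵀ *ᵥ (θ.1 : Fin k → ℝ)) j
    have hboth : L / (64 * k ^ 3) ≤ |a + b| ∧ L / (64 * k ^ 3) ≤ |a - b| := by
      have h1 := key (i, j) (by simp [hij])
      have h2 := key (j, i) (by simp [hij.symm])
      rcases lt_or_gt_of_ne hij with h | h
      · simp only [sg, h, h.not_gt, if_true, if_false] at h1 h2
        refine ⟨by simpa using h1, ?_⟩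
        rw [abs_sub_comm]
        simpa [sub_eq_add_neg] using h2
      · simp only [sg, h, h.not_gt, if_true, if_false] at h1 h2
        refine ⟨?_, by simpa [sub_eq_add_neg] using h1⟩
        rw [add_comm]
        simpa using h2
    rcases abs_cases a with ⟨ha, _⟩ | ⟨ha, _⟩ <;> rcases abs_cases b with ⟨hb, _⟩ | ⟨hb, _⟩ <;>
      rw [ha, hb]
    · exact hboth.2
    · rw [sub_neg_eq_add]; exact hboth.1
    · rw [show -a - b = -(a + b) by ring, abs_neg]; exact hboth.1
    · rw [show -a - -b = -(a - b) by ring, abs_neg]; exact hboth.2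

variable {O : Matrix (Fin d) (Fin k) ℝ} {D : Fin k → ℝ} {W : Matrix (Fin d) (Fin k) ℝ} {α₀ : ℝ}
  {T : (Fin d → ℝ) → Matrix (Fin d) (Fin d) ℝ} {F ω κ g Λ : ℝ}

/-- Error bound valid for any unit vector in the reconstruction step. -/
lemma reconstruct_error_crude (hF : 0 ≤ F) (hω : 0 ≤ ω) (hW : OpLe W ω)
    (hT : ∀ η x y, |x ⬝ᵥ ((T η - diagTriples α₀ O D η) *ᵥ y)| ≤ F * (l2 x * (l2 y * l2 η)))
    (hD : ∀ i, 0 < D i) (hα : 0 < α₀) (hΛ : ∀ i, |whitenedCoeff α₀ D i| ≤ Λ)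
    (hκ : 0 ≤ κ) (hQ : OpLe (pinv W)ᵀ κ)
    (hg : OpLe (whitened O D W * (whitened O D W)ᵀ - 1) g) (hg3 : g ≤ 3)
    {v : Fin k → ℝ} (hv : l2 v = 1) (i : Fin k) :
    l2 (O.col i - reconstruct α₀ T W v) ≤ l2 (O.col i - (pinv W)ᵀ *ᵥ (Wᵀ *ᵥ O.col i)) +
      κ * ((α₀ + 2) / 2 * (F * ω ^ 3 + 10 * Λ)) := by
  have hΛ0 : 0 ≤ Λ := (abs_nonneg _).trans (hΛ i)
  have hBT : OpLe (whitened O D W)ᵀ 2 :=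
    near_orthogonal_transpose_le hg (by norm_num) (by norm_num; linarith)
  have hB : OpLe (whitened O D W) 2 := by
    have := hBT.transpose (by norm_num)
    rwa [Matrix.transpose_transpose] at this
  refine (reconstruct_error hD hα hQ v i).trans (add_le_add le_rfl ?_)
  refine mul_le_mul_of_nonneg_left (mul_le_mul_of_nonneg_left ?_ (by linarith)) hκ
  refine (l2_sub_le _ _).trans ?_
  rw [l2_smul, l2_smul, hv, mul_one]
  -- With `‖B‖ ≤ 2`, the cubic form gives `2 ^ 3 * Λ` and the topic `2 * Λ`: together `10 * Λ`.
  have h1 := abs_cubic_le hF hω hW hT hD hα hΛ hBT hv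
  have h2 : l2 ((whitened O D W).col i) ≤ 2 := by
    have h := hB (Pi.single i 1)
    have h1 : l2 (Pi.single i 1 : Fin k → ℝ) ≤ 1 :=
      l2_le_one_of_sum_eq_one (fun j => by
        rcases eq_or_ne j i with rfl | hj
        · simp
        · simp [Pi.single_eq_of_ne hj]) (by simp)
    rw [Matrix.mulVec_single_one] at h
    linarith
  have h3 : |whitenedCoeff α₀ D i| * l2 ((whitened O D W).col i) ≤ Λ * 2 :=
    mul_le_mul (hΛ i) h2 (l2_nonneg _) hΛ0
  linarith

/-- Error bound when the random direction separates the singular values. -/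
lemma reconstruct_error_of_gap {Δ η : ℝ} (hF : 0 ≤ F) (hω : 0 ≤ ω) (hW : OpLe W ω)
    (hT : ∀ η x y, |x ⬝ᵥ ((T η - diagTriples α₀ O D η) *ᵥ y)| ≤ F * (l2 x * (l2 y * l2 η)))
    (hD : ∀ i, 0 < D i) (hα : 0 < α₀) (hΛ0 : 0 ≤ Λ) (hΛ : ∀ i, |whitenedCoeff α₀ D i| ≤ Λ)
    (hκ : 0 ≤ κ) (hQ : OpLe (pinv W)ᵀ κ) (hg0 : 0 ≤ g)
    (hg : OpLe (whitened O D W * (whitened O D W)ᵀ - 1) g) (hg4 : g ≤ 1 / 4)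
    {θ : Fin k → ℝ} (hθ : l2 θ = 1) (hΔ : 0 < Δ)
    (hgap : ∀ i j, i ≠ j → Δ ≤ |(|whitenedCoeff α₀ D i * ((whitened O D W)ᵀ *ᵥ θ) i| -
      |whitenedCoeff α₀ D j * ((whitened O D W)ᵀ *ᵥ θ) j|)|)
    (hη : 4 * (3 * (F * ω ^ 3) + 4 * Λ * g) / Δ ≤ η) (hη4 : η ≤ 1 / 4)
    {v : Fin k → Fin k → ℝ} (hv : IsLeftSingularFamily (Wᵀ * T (W *ᵥ θ) * W) v) :
    ∃ τ : Equiv.Perm (Fin k), ∀ i, l2 (O.col i - reconstruct α₀ T W (v (τ i))) ≤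
      l2 (O.col i - (pinv W)ᵀ *ᵥ (Wᵀ *ᵥ O.col i)) +
        κ * ((α₀ + 2) / 2 * (F * ω ^ 3 + 10 * Λ * (g + 2 * η))) := by
  obtain ⟨U, s, V, hsvd, hvU⟩ := hv
  have hρ : 0 ≤ F * ω ^ 3 := by positivity
  have hη0 : 0 ≤ η := le_trans (by positivity) hη
  have hM : Wᵀ * T (W *ᵥ θ) * W = whitened O D W *
      Matrix.diagonal (fun j => whitenedCoeff α₀ D j * ((whitened O D W)ᵀ *ᵥ θ) j) *
        (whitened O D W)ᵀ + Wᵀ * (T (W *ᵥ θ) - diagTriples α₀ O D (W *ᵥ θ)) * W := by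
    rw [← whitened_diagTriples hD hα, Matrix.mul_sub, Matrix.sub_mul, add_sub_cancel]
  have hμ : ∀ j, |whitenedCoeff α₀ D j * ((whitened O D W)ᵀ *ᵥ θ) j| ≤ 5 / 4 * Λ := by
    intro j
    have h1 := near_orthogonal_transpose_le hg (c := 5 / 4) (by norm_num)
      (by norm_num; linarith) θ
    rw [hθ, mul_one] at h1
    rw [abs_mul, mul_comm (5 / 4)]
    exact mul_le_mul (hΛ j) ((abs_apply_le_l2 _ j).trans h1) (abs_nonneg _) hΛ0
  obtain ⟨τ, hτ⟩ := left_singular_vectors_close hg0 hg hg4 hM hρ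
    (whitened_noise hF hω hW hT hθ) hΛ0 hμ hsvd hΔ hgap hη hη4
  refine ⟨τ, fun i => ?_⟩
  have hv1 : l2 (v (τ i)) = 1 := by rw [hvU]; exact l2_col_of_isometry hsvd.left_mul _
  have hc : |l2 ((whitened O D W)ᵀ *ᵥ v (τ i)) ^ 2 - 1| ≤ g := by
    have := near_orthogonal_sq hg (v (τ i))
    rwa [hv1, one_pow, mul_one] at this
  have hτi := hτ i
  rw [← hvU] at hτi
  obtain ⟨ς, hς, hς1, hclose⟩ := exists_sign_close hg0 hg4 hη0 hη4 hc i hτi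
  refine (reconstruct_error hD hα hQ _ i).trans (add_le_add le_rfl ?_)
  refine mul_le_mul_of_nonneg_left (mul_le_mul_of_nonneg_left ?_ (by linarith)) hκ
  exact whitened_topic_error hF hω hW hT hD hα hΛ hg hg4 hv1 i hς hς1 (by linarith)
    (by linarith) hclose

/-- The upper bound on `D i` gives `2 * A / (α₀ + 2) = 2 * A / (A ^ 2 + 1)` as a lower bound, which
is at least `1 / A` because `A ≥ 1`. The lower bound on `D i` gives the other inequality. -/
lemma whitenedCoeff_bounds {A q : ℝ} (hA : 0 < A) (hA2 : A ^ 2 = α₀ + 1) (hα : 0 < α₀)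
    (hq : 0 < q) (i : Fin k) (hD : (q / A) ^ 2 ≤ D i) (hD1 : D i ≤ 1 / A ^ 2) :
    1 / A ≤ whitenedCoeff α₀ D i ∧ whitenedCoeff α₀ D i ≤ 2 * A / ((α₀ + 2) * q) := by
  have h1 : q / A ≤ Real.sqrt (D i) := Real.le_sqrt_of_sq_le hD
  have h0 : 0 < Real.sqrt (D i) := lt_of_lt_of_le (by positivity) h1
  have h2 : Real.sqrt (D i) ≤ 1 / A := by
    rw [Real.sqrt_le_left (by positivity), div_pow, one_pow]; exact hD1
  rw [le_div_iff₀ hA] at h2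
  rw [whitenedCoeff]
  rw [le_div_iff₀ (by positivity), div_le_div_iff₀ (by positivity) (by positivity)]
  rw [div_le_iff₀ hA] at h1
  constructor
  · rw [one_div, inv_mul_le_iff₀ hA]
    nlinarith
  · have : 0 ≤ α₀ + 2 := by linarith
    nlinarith

set_option maxHeartbeats 1000000 in
/-- The empirical algorithm succeeds, with explicit constants, once the errors of the modified
moments are small. -/
lemma accuracy_of_moment_errors {hkd : k ≤ d} (hk : 0 < k) {A q σ E : ℝ}
    {P' : Matrix (Fin d) (Fin d) ℝ} (hα : 0 < α₀) (hA : 0 < A) (hA2 : A ^ 2 = α₀ + 1)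
    (hq : 0 < q) (hq1 : q ≤ 1) (hσ : 0 < σ) (hσ1 : σ ≤ 1)
    (hOσ : ∀ y, σ * l2 y ≤ l2 (O *ᵥ y)) (hcol : ∀ i, l2 (O.col i) ≤ 1)
    (hD : ∀ i, (q / A) ^ 2 ≤ D i) (hDt : ∑ i, D i ≤ 1 / A ^ 2)
    (hP : l2 (fun p : Fin d × Fin d => (P' - O * Matrix.diagonal D * Oᵀ) p.1 p.2) ≤ 3 * E)
    (hT : ∀ η x y, |x ⬝ᵥ ((T η - diagTriples α₀ O D η) *ᵥ y)| ≤
      13 * E * (l2 x * (l2 y * l2 η)))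
    (hE : E ≤ q ^ 2 * σ ^ 2 / (5 * A ^ 2)) (hW : IsWhitening hkd P' W) :
    W.rank = k ∧
    3 / 4 < (sphereUniform k).real
      {θ | ∀ v : Fin k → Fin k → ℝ,
        IsLeftSingularFamily (Wᵀ * T (W *ᵥ (θ.1 : Fin k → ℝ)) * W) v →
        ∃ τ : Equiv.Perm (Fin k), ∀ i, l2 (O.col i - reconstruct α₀ T W (v (τ i))) ≤
          2 * 10 ^ 7 * (A ^ 4 * k ^ 3 * E / (q ^ 4 * σ ^ 3))} := by
  have : NeZero k := ⟨hk.ne'⟩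
  have hE0 : 0 ≤ E := by linarith [(l2_nonneg _).trans hP]
  have hK : (1 : ℝ) ≤ (k : ℝ) ^ 3 := one_le_pow₀ (by exact_mod_cast hk)
  have hA1 : 1 ≤ A := by nlinarith
  have hD0 : ∀ i, 0 < D i := fun i => lt_of_lt_of_le (by positivity) (hD i)
  have hD1 : ∀ i, D i ≤ 1 / A ^ 2 := fun i =>
    (Finset.single_le_sum (fun j _ => (hD0 j).le) (Finset.mem_univ i)).trans hDt
  obtain ⟨hrank, hWop, hQ, hproj, hg⟩ := whitening_bounds hk hW hP hσ hOσ
    (by positivity : 0 < (q / A) ^ 2) hD hcol hDt (by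
      refine (mul_le_mul_of_nonneg_left hE (by norm_num : (0 : ℝ) ≤ 3)).trans (le_of_eq ?_)
      field_simp)
  refine ⟨hrank, ?_⟩
  rw [← whitened_mul_transpose hD0] at hg
  -- All bounds are expressed through `y`.
  set y := A ^ 2 * E / (q ^ 3 * σ ^ 3) with hy
  have hy0 : 0 ≤ y := by positivity
  have hEy : E = y * q ^ 3 * σ ^ 3 / A ^ 2 := by rw [hy]; field_simp
  -- `Ψ / q` is the target error up to the constant, while `Ψ` itself controls `g` and, up to a
  -- constant, `η`.
  set Ψ := A ^ 2 * (k : ℝ) ^ 3 * y with hΨ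
  have hfinal : A ^ 4 * (k : ℝ) ^ 3 * E / (q ^ 4 * σ ^ 3) = Ψ / q := by
    rw [hΨ, hy]; field_simp
  have hΨ0 : 0 ≤ Ψ := by positivity
  have hA21 : 1 ≤ A ^ 2 := one_le_pow₀ hA1
  have hAK : A ^ 2 * y ≤ Ψ := by rw [hΨ]; nlinarith [mul_nonneg (sq_nonneg A) hy0]
  have hyΨ : y ≤ Ψ := by nlinarith
  have hqσ : q * σ ≤ 1 := by nlinarith
  -- The whitening matrix and its pseudo-inverse.
  have hω : OpLe W (8 / 5 * (A / (q * σ))) := by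
    refine hWop.mono ?_
    rw [Real.sqrt_le_left (by positivity)]
    have : 5 / (2 * ((q / A) ^ 2 * σ ^ 2)) = 5 / 2 * (A / (q * σ)) ^ 2 := by field_simp
    rw [this]
    nlinarith [sq_nonneg (A / (q * σ))]
  have hκ : OpLe (pinv W)ᵀ (3 / 2 / A) := by
    refine hQ.mono ?_
    rw [Real.sqrt_le_left (by positivity)]
    have : (3 / 2 / A) ^ 2 = 9 / 4 * (1 / A ^ 2) := by field_simp; norm_num
    rw [this]
    have : 0 ≤ 1 / A ^ 2 := by positivity
    linarith
  have hρ : 13 * E * (8 / 5 * (A / (q * σ))) ^ 3 ≤ 54 * (A * y) := by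
    have : 13 * E * (8 / 5 * (A / (q * σ))) ^ 3 = 13 * (8 / 5) ^ 3 * (A * y) := by
      rw [hEy]; field_simp
    rw [this]
    have : 0 ≤ A * y := by positivity
    linarith
  have hgy : OpLe (whitened O D W * (whitened O D W)ᵀ - 1) (11 * (y * (q * σ))) := by
    refine hg.mono ?_
    have h2 : Real.sqrt 2 ≤ 22 / 15 := by
      rw [Real.sqrt_le_left (by norm_num)]; norm_num
    have : 5 / (2 * ((q / A) ^ 2 * σ ^ 2)) * (Real.sqrt 2 * (3 * E)) =
        15 / 2 * Real.sqrt 2 * (y * (q * σ)) := by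
      rw [hEy]; field_simp; ring
    rw [this]
    have : 0 ≤ y * (q * σ) := by positivity
    nlinarith
  have hproj' : ∀ i, l2 (O.col i - (pinv W)ᵀ *ᵥ (Wᵀ *ᵥ O.col i)) ≤ 6 * Ψ := by
    intro i
    refine (hproj i).trans ?_
    calc 2 * (3 * E) / (D i * σ) ≤ 2 * (3 * E) / ((q / A) ^ 2 * σ) := by
          have := hD i
          gcongr
      _ = 6 * (y * (q * σ * σ)) := by rw [hEy]; field_simp; ring
      _ ≤ 6 * Ψ := by
          have : q * σ * σ ≤ 1 := by nlinarith [mul_pos hq hσ]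
          nlinarith
  set Λ := 2 * A / ((α₀ + 2) * q) with hΛ
  have hΛ0 : 0 ≤ Λ := by positivity
  have hcoeff := fun i => whitenedCoeff_bounds hA hA2 hα hq i (hD i) (hD1 i)
  have hΛi : ∀ i, |whitenedCoeff α₀ D i| ≤ Λ := fun i => by
    rw [abs_of_nonneg (le_trans (by positivity) (hcoeff i).1)]; exact (hcoeff i).2
  have hΛκ : 3 / 2 / A * ((α₀ + 2) / 2 * Λ) = 3 / 2 / q := by
    have : α₀ + 2 ≠ 0 := by linarith
    rw [hΛ]; field_simp
  have hρκ : 3 / 2 / A * ((α₀ + 2) / 2 * (54 * (A * y))) ≤ 81 * Ψ := by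
    have : 3 / 2 / A * ((α₀ + 2) / 2 * (54 * (A * y))) = 81 / 2 * ((A ^ 2 + 1) * y) := by
      rw [hA2]; field_simp; ring
    rw [this]
    nlinarith
  have hΨq : Ψ ≤ Ψ / q := by rw [le_div_iff₀ hq]; nlinarith
  have hF : 0 ≤ 13 * E := by positivity
  have hω0 : 0 ≤ 8 / 5 * (A / (q * σ)) := by positivity
  have hκ0 : 0 ≤ 3 / 2 / A := by positivity
  rw [hfinal]
  -- For large `Ψ` the target exceeds a multiple of `1 / q`, and arbitrary unit vectors in arbitrary
  -- order achieve it for every `θ`. For small `Ψ` both `g` and `η` are below `1 / 4`, and the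
  -- separation of singular values applies.
  rcases le_or_gt (1 / 10 ^ 6) Ψ with hbig | hsmall
  · have huniv : {θ : Metric.sphere (0 : EuclideanSpace ℝ (Fin k)) 1 | ∀ v : Fin k → Fin k → ℝ,
        IsLeftSingularFamily (Wᵀ * T (W *ᵥ (θ.1 : Fin k → ℝ)) * W) v →
        ∃ τ : Equiv.Perm (Fin k), ∀ i, l2 (O.col i - reconstruct α₀ T W (v (τ i))) ≤
          2 * 10 ^ 7 * (Ψ / q)} = Set.univ := by
      refine Set.eq_univ_of_forall fun θ v hv => ⟨1, fun i => ?_⟩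
      obtain ⟨U, s, V, hsvd, hvU⟩ := hv
      have hv1 : l2 (v i) = 1 := by rw [hvU]; exact l2_col_of_isometry hsvd.left_mul _
      have hg3 : 11 * (y * (q * σ)) ≤ 3 := by
        have : y * (q * σ) = A ^ 2 * E / (q ^ 2 * σ ^ 2) := by rw [hy]; field_simp
        have h5 : A ^ 2 * E / (q ^ 2 * σ ^ 2) ≤ 1 / 5 := by
          rw [div_le_iff₀ (by positivity)]
          rw [le_div_iff₀ (by positivity)] at hE
          linarith
        rw [this]; linarith
      have h := reconstruct_error_crude hF hω0 hω hT hD0 hα hΛi hκ0 hκ hgy hg3 hv1 i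
      refine h.trans ?_
      have h1 : 3 / 2 / A * ((α₀ + 2) / 2 * (13 * E * (8 / 5 * (A / (q * σ))) ^ 3 + 10 * Λ)) ≤
          81 * Ψ + 10 * (3 / 2 / q) := by
        rw [← hΛκ]
        have := mul_le_mul_of_nonneg_left (mul_le_mul_of_nonneg_left hρ
          (by linarith : 0 ≤ (α₀ + 2) / 2)) hκ0
        linarith
      have h2 : 1 / q ≤ 10 ^ 6 * (Ψ / q) := by
        rw [mul_div_assoc', div_le_div_iff_of_pos_right hq]
        linarith
      have h3 : 10 * (3 / 2 / q) = 15 * (1 / q) := by ring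
      have := hproj' i
      linarith
    rw [huniv, probReal_univ]
    norm_num
  · have hg4 : 11 * (y * (q * σ)) ≤ 1 / 4 := by nlinarith
    have hgΨ : 11 * (y * (q * σ)) ≤ 11 * Ψ := by nlinarith
    refine (sphereUniform_gap hk hgy hg4 (by positivity : 0 < 1 / A)
      fun i => (hcoeff i).1).trans_le ?_
    refine measureReal_mono ?_ (measure_ne_top _ _)
    intro θ hθ v hv
    have hθ1 : l2 (θ.1 : Fin k → ℝ) = 1 := by
      have := θ.2
      rw [mem_sphere_zero_iff_norm] at this
      exact this
    -- `64000 = 4 * 250 * 64`, where `250 = 3 * 54 + 4 * 22` and `64 * k ^ 3` comes from the gap.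
    have hη : 4 * (3 * (13 * E * (8 / 5 * (A / (q * σ))) ^ 3) + 4 * Λ * (11 * (y * (q * σ)))) /
        (1 / A / (64 * (k : ℝ) ^ 3)) ≤ 64000 * Ψ := by
      have hΛg : Λ * (11 * (y * (q * σ))) ≤ 22 * (A * y) := by
        have : Λ * (11 * (y * (q * σ))) = 22 * (A * y) * (σ / (α₀ + 2)) := by
          rw [hΛ]; field_simp; ring
        rw [this]
        have h1 : σ / (α₀ + 2) ≤ 1 := by rw [div_le_one (by linarith)]; linarith
        have : 0 ≤ 22 * (A * y) := by positivity
        nlinarith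
      have : 4 * (3 * (13 * E * (8 / 5 * (A / (q * σ))) ^ 3) + 4 * Λ * (11 * (y * (q * σ)))) ≤
          4 * (250 * (A * y)) := by linarith
      rw [div_le_iff₀ (by positivity)]
      refine this.trans (le_of_eq ?_)
      rw [hΨ]; field_simp; ring
    obtain ⟨τ, hτ⟩ := reconstruct_error_of_gap hF hω0 hω hT hD0 hα hΛ0 hΛi hκ0 hκ
      (by positivity) hgy hg4 hθ1 (by positivity : 0 < 1 / A / (64 * (k : ℝ) ^ 3)) hθ hη
      (by linarith) hv
    refine ⟨τ, fun i => (hτ i).trans ?_⟩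
    have h1 : 3 / 2 / A * ((α₀ + 2) / 2 * (13 * E * (8 / 5 * (A / (q * σ))) ^ 3 +
        10 * Λ * (11 * (y * (q * σ)) + 2 * (64000 * Ψ)))) ≤
          81 * Ψ + 10 * (3 / 2 / q) * (128011 * Ψ) := by
      rw [← hΛκ]
      have h2 := mul_le_mul_of_nonneg_left (mul_le_mul_of_nonneg_left hρ
        (by linarith : 0 ≤ (α₀ + 2) / 2)) hκ0
      have h3 : 0 ≤ 3 / 2 / A * ((α₀ + 2) / 2 * Λ) := by
        have : 0 ≤ (α₀ + 2) / 2 := by linarith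
        positivity
      have h4 : 11 * (y * (q * σ)) + 2 * (64000 * Ψ) ≤ 128011 * Ψ := by linarith
      have h5 := mul_le_mul_of_nonneg_left h4 h3
      linarith
    have h2 : 10 * (3 / 2 / q) * (128011 * Ψ) = 15 * 128011 * (Ψ / q) := by ring
    have := hproj' i
    linarith

end Accuracy

/-! ### Sample complexity -/

section SampleComplexity

variable {d k : ℕ}

lemma pMin_le (α : Fin k → ℝ) (i : Fin k) : pMin α ≤ α i / ∑ j, α j :=
  ciInf_le (Set.finite_range _).bddBelow i

lemma pMin_pos (hk : 0 < k) {α : Fin k → ℝ} (hα : ∀ i, 0 < α i) : 0 < pMin α := by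
  have : Nonempty (Fin k) := ⟨⟨0, hk⟩⟩
  obtain ⟨i, hi⟩ := exists_eq_ciInf_of_finite (f := fun i => α i / ∑ j, α j)
  rw [pMin, ← hi]
  exact div_pos (hα i) (Finset.sum_pos (fun j _ => hα j) Finset.univ_nonempty)

lemma pMin_le_one (hk : 0 < k) {α : Fin k → ℝ} (hα : ∀ i, 0 < α i) : pMin α ≤ 1 :=
  (pMin_le α ⟨0, hk⟩).trans (div_le_one_of_le₀
    (Finset.single_le_sum (fun j _ => (hα j).le) (Finset.mem_univ _))
    (Finset.sum_nonneg fun j _ => (hα j).le))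

lemma IsTopicMatrix.l2_col_le {O : Matrix (Fin d) (Fin k) ℝ} (hO : IsTopicMatrix O) (i : Fin k) :
    l2 (O.col i) ≤ 1 :=
  l2_le_one_of_sum_eq_one (fun j => hO.nonneg j i) (hO.sum_col i)

lemma IsTopicMatrix.sigmaMin_le_one {O : Matrix (Fin d) (Fin k) ℝ} (hO : IsTopicMatrix O)
    (hk : 0 < k) : sigmaMin O ≤ 1 := by
  have h := sigmaMin_mul_l2_le O (Pi.single ⟨0, hk⟩ 1)
  have h1 : l2 (Pi.single ⟨0, hk⟩ 1 : Fin k → ℝ) = 1 := by simp [l2_eq_sqrt, Pi.single_apply]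
  rw [Matrix.mulVec_single_one, h1, mul_one] at h
  exact h.trans (hO.l2_col_le _)

lemma sum_topicWeight {α : Fin k → ℝ} (hs : 0 < ∑ i, α i) :
    ∑ i, topicWeight α i = 1 / (∑ i, α i + 1) := by
  simp only [topicWeight]
  rw [← Finset.sum_div, ← Finset.sum_div, div_self hs.ne']

/-- The `3` inside the logarithm stems from the union bound over three frequency vectors; it is
traded for a constant factor. -/
lemma one_add_sqrt_log_three_div_le {δ : ℝ} (hδ₀ : 0 < δ) (hδ₁ : δ < 1) :
    1 + Real.sqrt (Real.log (3 / δ)) ≤ 3 * (1 + Real.sqrt (Real.log (1 / δ))) := by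
  have h1 : Real.log (3 / δ) = Real.log 3 + Real.log (1 / δ) := by
    rw [← Real.log_mul (by norm_num) (by positivity)]; congr 1; ring
  have h0 : 0 ≤ Real.log (1 / δ) := Real.log_nonneg (by rw [le_div_iff₀ hδ₀]; linarith)
  have h3 : Real.log 3 ≤ 2 := (Real.log_le_sub_one_of_pos (by norm_num)).trans (by norm_num)
  have hs := Real.sqrt_nonneg (Real.log (1 / δ))
  have : Real.sqrt (Real.log (3 / δ)) ≤ 2 + Real.sqrt (Real.log (1 / δ)) := by
    rw [Real.sqrt_le_left (by linarith), h1]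
    nlinarith [Real.sq_sqrt h0]
  linarith

/-- The algorithm succeeds on every sample whose word frequencies are close to their means. -/
lemma ecaSucceeds_of_freq_close (hk : 0 < k) (hkd : k ≤ d) {α : Fin k → ℝ} (hα : ∀ i, 0 < α i)
    {O : Matrix (Fin d) (Fin k) ℝ} (hO : IsTopicMatrix O) (hrank : O.rank = k)
    (hq1 : ∑ w, documentProb α O w = 1) {N : ℕ} (hN : 0 < N) (w : Fin N → Fin 3 → Fin d) {E : ℝ}
    (h1 : l2 (freq (fun s => s 0) w - labelProb (documentProb α O) fun s => s 0) ≤ E)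
    (h2 : l2 (freq (fun s => (s 0, s 1)) w -
      labelProb (documentProb α O) fun s => (s 0, s 1)) ≤ E)
    (h3 : l2 (freq (fun s => (s 0, s 1, s 2)) w -
      labelProb (documentProb α O) fun s => (s 0, s 1, s 2)) ≤ E)
    (hE : E ≤ pMin α * sigmaMin O ^ 2 / (5 * (∑ i, α i + 1))) :
    ECASucceeds hkd (∑ i, α i) O (2 * 10 ^ 7 *
      ((∑ i, α i + 1) ^ 2 * (k : ℝ) ^ 3 * E / (pMin α ^ 2 * sigmaMin O ^ 3))) w := by
  intro W hW
  have hs : 0 < ∑ i, α i :=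
    Finset.sum_pos (fun j _ => hα j) ⟨⟨0, hk⟩, Finset.mem_univ _⟩
  have hp := pMin_pos hk hα
  obtain ⟨hP, hT⟩ := modified_moment_errors hα hO hq1 hN w h1 h2 h3
  have hA2 : Real.sqrt (∑ i, α i + 1) ^ 2 = ∑ i, α i + 1 := Real.sq_sqrt (by linarith)
  have hp2 : Real.sqrt (pMin α) ^ 2 = pMin α := Real.sq_sqrt hp.le
  -- Taking `A = √(α₀ + 1)` and `q = √(pMin α)` as parameters makes the bounds on whitening and
  -- coefficients rational expressions.
  have h := accuracy_of_moment_errors (hkd := hkd) (O := O) (D := topicWeight α) (W := W)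
    (T := empTriples (∑ i, α i) w) hk
    (A := Real.sqrt (∑ i, α i + 1)) (q := Real.sqrt (pMin α)) (σ := sigmaMin O) (E := E)
    hs (Real.sqrt_pos.2 (by linarith)) hA2 (Real.sqrt_pos.2 hp)
    (Real.sqrt_le_one.2 (pMin_le_one hk hα)) (sigmaMin_pos hk hrank) (hO.sigmaMin_le_one hk)
    (sigmaMin_mul_l2_le O) hO.l2_col_le
    (fun i => by
      rw [div_pow, hA2, hp2]
      exact div_le_div_of_nonneg_right (pMin_le α i) (by linarith))
    (by rw [hA2, sum_topicWeight hs]) hP hT (by rw [hA2, hp2]; exact hE) hW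
  have hA4 : Real.sqrt (∑ i, α i + 1) ^ 4 = (∑ i, α i + 1) ^ 2 := by rw [pow_mul _ 2 2, hA2]
  have hp4 : Real.sqrt (pMin α) ^ 4 = pMin α ^ 2 := by rw [pow_mul _ 2 2, hp2]
  rw [hA4, hp4] at h
  exact h

end SampleComplexity

end LDA

end

theorem theorem5 :
    ∃ c : ℝ, 0 < c ∧
      ∀ (k d : ℕ) (_hk : 0 < k) (hkd : k ≤ d)
        (α : Fin k → ℝ) (_hα : ∀ i, 0 < α i) (α₀ : ℝ) (_hα₀ : α₀ = ∑ i, α i)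
        (O : Matrix (Fin d) (Fin k) ℝ) (_hO : LDA.IsTopicMatrix O) (_hrank : O.rank = k)
        (δ : ℝ) (_hδ₀ : 0 < δ) (_hδ₁ : δ < 1)
        (N : ℕ)
        (_hN : ((α₀ + 1) * (6 + 6 * Real.sqrt (Real.log (3 / δ))) /
          (LDA.pMin α * LDA.sigmaMin O ^ 2)) ^ 2 ≤ (N : ℝ))
        (Ω : Type*) [MeasurableSpace Ω] (P : Measure Ω) [IsProbabilityMeasure P]
        (X : Fin N → Ω → (Fin 3 → Fin d)) (_hX : ∀ n, Measurable (X n))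
        (_hlaw : ∀ n, P.map (X n) = LDA.documentLaw α O) (_hindep : iIndepFun X P),
        1 - δ < P.real
          {ω | LDA.ECASucceeds hkd α₀ O
            (c * ((α₀ + 1) ^ 2 * (k : ℝ) ^ 3 / (LDA.pMin α ^ 2 * LDA.sigmaMin O ^ 3)) *
              ((1 + Real.sqrt (Real.log (1 / δ))) / Real.sqrt N))
            (fun n => X n ω)} := by
  -- `2 * 10 ^ 7` from the accuracy bound, `6 / 5` from the concentration radius and `3` from
  -- replacing `3 / δ` by `1 / δ` multiply to less than `10 ^ 8`.
  refine ⟨10 ^ 8, by norm_num, ?_⟩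
  intro k d hk hkd α hα α₀ hα₀ O hO hrank δ hδ₀ hδ₁ N hN Ω _ P _ X hX hlaw hindep
  subst hα₀
  have hs : 0 < ∑ i, α i :=
    Finset.sum_pos (fun j _ => hα j) ⟨⟨0, hk⟩, Finset.mem_univ _⟩
  have hp := LDA.pMin_pos hk hα
  have hσ := LDA.sigmaMin_pos hk hrank
  set σ := LDA.sigmaMin O
  set p := LDA.pMin α
  set L := Real.sqrt (Real.log (3 / δ)) with hL
  have hL0 : 0 ≤ L := Real.sqrt_nonneg _
  have hroot : (∑ i, α i + 1) * (6 + 6 * L) / (p * σ ^ 2) ≤ Real.sqrt N :=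
    Real.le_sqrt_of_sq_le hN
  have hsN : 0 < Real.sqrt N := lt_of_lt_of_le (by positivity) hroot
  have hN0 : 0 < N := by exact_mod_cast Real.sqrt_pos.1 hsN
  have hdoc : (fun w => (LDA.documentLaw α O).real {w}) = LDA.documentProb α O :=
    funext fun w => LDA.documentLaw_real_singleton α hα O hO w
  have hq1 : ∑ w, LDA.documentProb α O w = 1 := by
    have : IsProbabilityMeasure (LDA.documentLaw α O) := by
      rw [← hlaw ⟨0, hN0⟩]; exact Measure.isProbabilityMeasure_map (hX _).aemeasurable
    rw [← hdoc, sum_measureReal_singleton, Finset.coe_univ, probReal_univ]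
  have hfreq := LDA.three_freq_close (fun s : Fin 3 → Fin d => s 0) (fun s => (s 0, s 1))
    (fun s => (s 0, s 1, s 2)) hN0 hX hlaw hindep hδ₀ hδ₁
  rw [hdoc] at hfreq
  refine hfreq.trans_le (measureReal_mono ?_ (measure_ne_top _ _))
  rintro ω ⟨h1, h2, h3⟩
  -- The sample size matches this exactly: `5 * (6 / 5) * (1 + L) = 6 + 6 * L`.
  have hE : 6 / 5 * (1 + L) / Real.sqrt N ≤ p * σ ^ 2 / (5 * (∑ i, α i + 1)) := by
    rw [div_le_iff₀ (by positivity)] at hroot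
    rw [div_le_div_iff₀ hsN (by positivity)]
    nlinarith
  have h := LDA.ecaSucceeds_of_freq_close hk hkd hα hO hrank hq1 hN0 (fun n => X n ω)
    (by rw [LDA.l2_eq_sqrt]; exact h1) (by rw [LDA.l2_eq_sqrt]; exact h2)
    (by rw [LDA.l2_eq_sqrt]; exact h3) hE
  intro W hW
  obtain ⟨hr, hθ⟩ := h W hW
  refine ⟨hr, hθ.trans_le (measureReal_mono ?_ ?_)⟩
  · intro θ hθ v hv
    obtain ⟨τ, hτ⟩ := hθ v hv
    refine ⟨τ, fun i => (hτ i).trans ?_⟩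
    have hlog := LDA.one_add_sqrt_log_three_div_le hδ₀ hδ₁
    rw [← hL] at hlog
    have hl0 := Real.sqrt_nonneg (Real.log (1 / δ))
    set l := Real.sqrt (Real.log (1 / δ))
    have hC : 0 ≤ (∑ i, α i + 1) ^ 2 * (k : ℝ) ^ 3 / (p ^ 2 * σ ^ 3) / Real.sqrt N := by positivity
    calc 2 * 10 ^ 7 * ((∑ i, α i + 1) ^ 2 * (k : ℝ) ^ 3 * (6 / 5 * (1 + L) / Real.sqrt N) /
          (p ^ 2 * σ ^ 3))
        = 2 * 10 ^ 7 * (6 / 5 * (1 + L)) *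
          ((∑ i, α i + 1) ^ 2 * (k : ℝ) ^ 3 / (p ^ 2 * σ ^ 3) / Real.sqrt N) := by ring
      _ ≤ 10 ^ 8 * (1 + l) *
          ((∑ i, α i + 1) ^ 2 * (k : ℝ) ^ 3 / (p ^ 2 * σ ^ 3) / Real.sqrt N) :=
          mul_le_mul_of_nonneg_right (by linarith) hC
      _ = _ := by ring
  · have : NeZero k := ⟨hk.ne'⟩
    exact measure_ne_top _ _
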